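/- Let $S$ be a compact Sasakian manifold of dimension $2m+1$: a compact smooth manifold with a Riemannian metric $g$ and a complex structure $J$ on the cone $C(S)=S\times\mathbb{R}_{>0}$ such that $(C(S),\,dr^2+r^2g,\,J)$ is a Kähler manifold and $\mathcal{L}_{r\partial/\partial r}J=0$. Identify $S$ with $\{r=1\}\subset C(S)$, and let $\xi=J(r\frac{\partial}{\partial r})$ be the Reeb field, $\eta=g(\xi,\cdot)$ the contact form, $D=\ker\eta$ the contact bundle, and $g^T=g|_D$ the transverse Kähler metric, with transverse complex structure $J|_D$. A smooth function $u\colon S\to\mathbb{C}$ is basic if $\xi u=0$. (A $1$-form $\alpha$ is basic if $\alpha(\xi)=0$ and $\mathcal{L}_\xi\alpha=0$.) For basic $u$ let $d_Bu=du$, and let $\bar\partial_Bu=\frac12(du+\sqrt{-1}\,du\circ J)$ on $D$, extended by $0$ along $\xi$; this is the $(0,1)$-part of $du$. On basic functions and on basic $1$-forms use the Hermitian $L^2$ inner products $$\langle u,v\rangle=\int_S u\,\bar v\;d\mathrm{vol}_g,\qquad \langle\alpha,\beta\rangle=\int_S g^T(\alpha,\bar\beta)\;d\mathrm{vol}_g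 ,$$ where $g^T$ is extended complex bilinearly to complex covectors on $D$. For $T=d_B$ or $T=\bar\partial_B$, the adjoint $T^*$ sends a basic $1$-form $\alpha$ to the basic function $T^*\alpha$ with $\langle Tv,\alpha\rangle=\langle v,T^*\alpha\rangle$ for all basic functions $v$. Since $d_B^*$ and $\bar\partial_B^*$ vanish on functions, the basic Laplacian and the basic Dolbeault Laplacian on basic functions are $$\triangle^B u=d_B^*d_Bu,\qquad \square^B u=\bar\partial_B^*\bar\partial_Bu .$$ Let $\triangle_g=d^*d$ be the (nonnegative) Riemannian Laplacian on functions, in local coordinates $\triangle_gu=-\frac{1}{\sqrt{\det g}}\,\partial_i\big(\sqrt{\det g}\,g^{ij}\,\partial_ju\big)$. Then for every basic function $u$ on $S$ the adjoint values $d_B^*d_Bu$ and $\bar\partial_B^*\bar\partial_Bu$ exist and are unique, and $$\triangle_g u=\triangle^B u=2\,\square^B u .$$ -/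

import Mathlib

open scoped Manifold ContDiff

namespace Sasaki

/-! ## Riemannian manifolds: coordinates, Laplacian, integration -/

section Riemannian

/-- Smooth Riemannian metrics on an `n`-dimensional manifold. -/
abbrev Metric (n : ℕ) (S : Type*) [TopologicalSpace S]
    [ChartedSpace (EuclideanSpace ℝ (Fin n)) S] [IsManifold (𝓡 n) ∞ S] :=
  Bundle.ContMDiffRiemannianMetric (𝓡 n) ∞ (EuclideanSpace ℝ (Fin n))
    (fun p : S => TangentSpace (𝓡 n) p)

/-- Complex-valued `1`-forms (no smoothness imposed). -/
abbrev OneForm (n : ℕ) (S : Type*) [TopologicalSpace S]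
    [ChartedSpace (EuclideanSpace ℝ (Fin n)) S] :=
  ∀ p : S, TangentSpace (𝓡 n) p →L[ℝ] ℂ

variable {n : ℕ} {S : Type*} [TopologicalSpace S] [ChartedSpace (EuclideanSpace ℝ (Fin n)) S]

/-- The `i`-th coordinate vector field `∂ᵢ` of the chart at `c`, at the point with
coordinates `y`. -/
noncomputable def coordVec (c : S) (y : EuclideanSpace ℝ (Fin n)) (i : Fin n) :
    TangentSpace (𝓡 n) ((extChartAt (𝓡 n) c).symm y) :=
  mfderiv 𝓘(ℝ, EuclideanSpace ℝ (Fin n)) (𝓡 n) (extChartAt (𝓡 n) c).symm y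
    (EuclideanSpace.single i (1 : ℝ))

instance (p : S) : FiniteDimensional ℝ (TangentSpace (𝓡 n) p) :=
  inferInstanceAs (FiniteDimensional ℝ (EuclideanSpace ℝ (Fin n)))

/-- The differential of a complex-valued function. -/
noncomputable def d (u : S → ℂ) : OneForm n S := fun p => mfderiv (𝓡 n) 𝓘(ℝ, ℂ) u p

variable [IsManifold (𝓡 n) ∞ S]

/-- The matrix `g_{ij} = g(∂ᵢ, ∂ⱼ)` of the metric in the chart at `c`. -/
noncomputable def gram (g : Metric n S) (c : S) (y : EuclideanSpace ℝ (Fin n)) :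
    Matrix (Fin n) (Fin n) ℝ :=
  Matrix.of fun i j => g.inner ((extChartAt (𝓡 n) c).symm y) (coordVec c y i) (coordVec c y j)

/-- The Riemannian density `√(det g_{ij})` in the chart at `c`. -/
noncomputable def density (g : Metric n S) (c : S) (y : EuclideanSpace ℝ (Fin n)) : ℝ :=
  Real.sqrt (gram g c y).det

/-- The (nonnegative) Laplace-Beltrami operator of `g` on complex-valued functions,
`Δ_g u = - (det g)^{-1/2} ∂ᵢ ((det g)^{1/2} g^{ij} ∂ⱼ u)`, computed at `p` in the chart at `p`. -/
noncomputable def laplacian (g : Metric n S) (u : S → ℂ) (p : S) : ℂ :=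
  let y₀ : EuclideanSpace ℝ (Fin n) := extChartAt (𝓡 n) p p
  (-(((density g p y₀)⁻¹ : ℝ) : ℂ)) * ∑ i : Fin n,
    fderiv ℝ (fun y : EuclideanSpace ℝ (Fin n) =>
      ∑ j : Fin n, ((density g p y * (gram g p y)⁻¹ i j : ℝ) : ℂ) *
        fderiv ℝ (fun z => u ((extChartAt (𝓡 n) p).symm z)) y (EuclideanSpace.single j (1 : ℝ)))
      y₀ (EuclideanSpace.single i (1 : ℝ))

/-- A smooth partition of unity subordinate to the charts, used to integrate. -/
noncomputable def chartPartition (n : ℕ) (S : Type*) [TopologicalSpace S]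
    [ChartedSpace (EuclideanSpace ℝ (Fin n)) S] [IsManifold (𝓡 n) ∞ S]
    [T2Space S] [SigmaCompactSpace S] : SmoothPartitionOfUnity S (𝓡 n) S Set.univ :=
  Classical.choose (SmoothPartitionOfUnity.exists_isSubordinate_chartAt_source (𝓡 n) S)

theorem chartPartition_isSubordinate (n : ℕ) (S : Type*) [TopologicalSpace S]
    [ChartedSpace (EuclideanSpace ℝ (Fin n)) S] [IsManifold (𝓡 n) ∞ S]
    [T2Space S] [SigmaCompactSpace S] :
    (chartPartition n S).IsSubordinate
      (fun c => (chartAt (EuclideanSpace ℝ (Fin n)) c).source) :=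
  Classical.choose_spec (SmoothPartitionOfUnity.exists_isSubordinate_chartAt_source (𝓡 n) S)

/-- The integral `∫_S f dvol_g` of a function against the Riemannian volume element
`√(det g_{ij}) dy¹ … dyⁿ`, by a partition of unity subordinate to the charts. -/
noncomputable def integral [T2Space S] [SigmaCompactSpace S] (g : Metric n S) (f : S → ℂ) : ℂ :=
  ∑ᶠ c : S, ∫ y in (extChartAt (𝓡 n) c).target,
    ((chartPartition n S c ((extChartAt (𝓡 n) c).symm y) * density g c y : ℝ) : ℂ) *
      f ((extChartAt (𝓡 n) c).symm y)

end Riemannian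

/-- For a finite-dimensional space `W` with a real inner product `B`, the induced Hermitian inner
product `B^{ab} αₐ conj β_b` of complex-valued covectors `α`, `β`, where `(B^{ab})` is the inverse
of the Gram matrix of a basis of `W`. It does not depend on the basis. -/
noncomputable def covectorInner {W : Type*} [AddCommGroup W] [Module ℝ W]
    [FiniteDimensional ℝ W]
    (B : W → W → ℝ) (α β : W → ℂ) : ℂ :=
  let b := Module.finBasis ℝ W
  ∑ i, ∑ j, (((Matrix.of fun k l => B (b k) (b l))⁻¹ i j : ℝ) : ℂ) *
    α (b i) * (starRingEnd ℂ) (β (b j))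

/-! ## The Kähler cone of a Sasakian manifold -/

section Cone

/-- The open half-line `ℝ_{>0}`. -/
def posReals : TopologicalSpace.Opens ℝ := ⟨Set.Ioi 0, isOpen_Ioi⟩

/-- The cone `C(S) = S × ℝ_{>0}`. -/
abbrev Cone (S : Type*) := S × posReals

/-- The model with corners (without boundary) of the cone. Its tangent space at `(p, r)` is
`T_p S × ℝ`, the second component being `dr`. -/
noncomputable abbrev coneModel (n : ℕ) := (𝓡 n).prod 𝓘(ℝ, ℝ)

variable {n : ℕ} {S : Type*} [TopologicalSpace S] [ChartedSpace (EuclideanSpace ℝ (Fin n)) S]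

/-- The component in `T_p S` of a tangent vector of the cone at `(p, r)`. -/
noncomputable def baseComp {x : Cone S} (v : TangentSpace (coneModel n) x) : TangentSpace (𝓡 n) x.1 :=
  Prod.fst (show EuclideanSpace ℝ (Fin n) × ℝ from v)

/-- The component `dr(v)` of a tangent vector of the cone. -/
noncomputable def radComp {x : Cone S} (v : TangentSpace (coneModel n) x) : ℝ :=
  Prod.snd (show EuclideanSpace ℝ (Fin n) × ℝ from v)

/-- The tangent vector of the cone at `x = (p, r)` with components `v ∈ T_p S` and `a ∂/∂r`. -/
noncomputable def coneVec (x : Cone S) (v : TangentSpace (𝓡 n) x.1) (a : ℝ) : TangentSpace (coneModel n) x :=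
  (show EuclideanSpace ℝ (Fin n) × ℝ from (v, a))

/-- The Euler vector field `r ∂/∂r` on the cone. -/
noncomputable def euler (n : ℕ) {S : Type*} [TopologicalSpace S]
    [ChartedSpace (EuclideanSpace ℝ (Fin n)) S] (x : Cone S) : TangentSpace (coneModel n) x :=
  coneVec x 0 (x.2 : ℝ)

/-- The point `(p, 1)` of the cone. -/
def atOne (p : S) : Cone S := (p, ⟨1, Set.mem_Ioi.mpr one_pos⟩)

variable [IsManifold (𝓡 n) ∞ S]

/-- The cone metric `dr² + r² g`. -/
noncomputable def coneMetric (g : Metric n S) (x : Cone S)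
    (v w : TangentSpace (coneModel n) x) : ℝ :=
  radComp v * radComp w + (x.2 : ℝ) ^ 2 * g.inner x.1 (baseComp v) (baseComp w)

/-- The vector field `X` on the cone is smooth at `x`. -/
def SmoothFieldAt (X : ∀ x : Cone S, TangentSpace (coneModel n) x) (x : Cone S) : Prop :=
  ContMDiffAt (coneModel n) (coneModel n).tangent ∞
    (fun y => (⟨y, X y⟩ : TangentBundle (coneModel n) (Cone S))) x

/-- The directional derivative at `x` of the real function `f` on the cone along the vector `v`. -/
noncomputable def dirDeriv (f : Cone S → ℝ) (x : Cone S) (v : TangentSpace (coneModel n) x) : ℝ :=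
  mfderiv (coneModel n) 𝓘(ℝ, ℝ) f x v

end Cone

/-- A Sasakian structure on a manifold `S` of dimension `2m+1`: a Riemannian metric `g` and a
complex structure `J` on the cone `C(S)` which makes `(C(S), dr² + r² g)` a Kähler manifold and
satisfies `L_{r∂/∂r} J = 0`. -/
structure SasakianStructure (m : ℕ) (S : Type*) [TopologicalSpace S]
    [ChartedSpace (EuclideanSpace ℝ (Fin (2 * m + 1))) S] [IsManifold (𝓡 (2 * m + 1)) ∞ S] where
  /-- the Sasaki metric -/
  g : Metric (2 * m + 1) S
  /-- the complex structure of the cone -/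
  J : ∀ x : Cone S, TangentSpace (coneModel (2 * m + 1)) x →L[ℝ]
    TangentSpace (coneModel (2 * m + 1)) x
  /-- `J` is a smooth tensor field -/
  smooth_J : ContMDiff (coneModel (2 * m + 1))
    ((coneModel (2 * m + 1)).prod 𝓘(ℝ, (EuclideanSpace ℝ (Fin (2 * m + 1)) × ℝ) →L[ℝ]
      (EuclideanSpace ℝ (Fin (2 * m + 1)) × ℝ))) ∞
    (fun x : Cone S => Bundle.TotalSpace.mk'
      ((EuclideanSpace ℝ (Fin (2 * m + 1)) × ℝ) →L[ℝ] (EuclideanSpace ℝ (Fin (2 * m + 1)) × ℝ))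
      (E := fun x : Cone S => TangentSpace (coneModel (2 * m + 1)) x →L[ℝ]
        TangentSpace (coneModel (2 * m + 1)) x) x (J x))
  /-- `J² = -1` -/
  J_sq : ∀ (x : Cone S) (v : TangentSpace (coneModel (2 * m + 1)) x), J x (J x v) = -v
  /-- `J` is integrable: its Nijenhuis tensor vanishes -/
  integrable : ∀ (x : Cone S) (X Y : ∀ x : Cone S, TangentSpace (coneModel (2 * m + 1)) x),
    SmoothFieldAt X x → SmoothFieldAt Y x →
    VectorField.mlieBracket (coneModel (2 * m + 1)) (fun y => J y (X y)) (fun y => J y (Y y)) x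
      - J x (VectorField.mlieBracket (coneModel (2 * m + 1)) (fun y => J y (X y)) Y x)
      - J x (VectorField.mlieBracket (coneModel (2 * m + 1)) X (fun y => J y (Y y)) x)
      - VectorField.mlieBracket (coneModel (2 * m + 1)) X Y x = 0
  /-- the cone metric is Hermitian -/
  hermitian : ∀ (x : Cone S) (v w : TangentSpace (coneModel (2 * m + 1)) x),
    coneMetric g x (J x v) (J x w) = coneMetric g x v w
  /-- the fundamental form `ω(X, Y) = ḡ(J X, Y)` is closed -/
  closed : ∀ (x : Cone S) (X Y Z : ∀ x : Cone S, TangentSpace (coneModel (2 * m + 1)) x),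
    SmoothFieldAt X x → SmoothFieldAt Y x → SmoothFieldAt Z x →
    dirDeriv (fun y => coneMetric g y (J y (Y y)) (Z y)) x (X x)
      + dirDeriv (fun y => coneMetric g y (J y (Z y)) (X y)) x (Y x)
      + dirDeriv (fun y => coneMetric g y (J y (X y)) (Y y)) x (Z x)
      - coneMetric g x (J x (VectorField.mlieBracket (coneModel (2 * m + 1)) X Y x)) (Z x)
      - coneMetric g x (J x (VectorField.mlieBracket (coneModel (2 * m + 1)) Y Z x)) (X x)
      - coneMetric g x (J x (VectorField.mlieBracket (coneModel (2 * m + 1)) Z X x)) (Y x) = 0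
  /-- `(L_{r∂/∂r} J) X = [r∂/∂r, J X] - J [r∂/∂r, X] = 0` -/
  lie_euler_J : ∀ (x : Cone S) (X : ∀ x : Cone S, TangentSpace (coneModel (2 * m + 1)) x),
    SmoothFieldAt X x →
    VectorField.mlieBracket (coneModel (2 * m + 1)) (euler (2 * m + 1)) (fun y => J y (X y)) x
      = J x (VectorField.mlieBracket (coneModel (2 * m + 1)) (euler (2 * m + 1)) X x)

namespace SasakianStructure

/-! ## Basic functions and the basic Laplacians -/

variable {m : ℕ} {S : Type*} [TopologicalSpace S]
    [ChartedSpace (EuclideanSpace ℝ (Fin (2 * m + 1))) S] [IsManifold (𝓡 (2 * m + 1)) ∞ S]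
    (𝓢 : SasakianStructure m S)

/-- The Reeb field `ξ = J(r∂/∂r)` on `S = {r = 1}`. -/
noncomputable def reeb (p : S) : TangentSpace (𝓡 (2 * m + 1)) p :=
  baseComp (𝓢.J (atOne p) (euler (2 * m + 1) (atOne p)))

/-- The contact form `η = g(ξ, ·)`. -/
noncomputable def eta (p : S) : TangentSpace (𝓡 (2 * m + 1)) p →L[ℝ] ℝ :=
  𝓢.g.inner p (𝓢.reeb p)

/-- The contact bundle `D = ker η`. -/
noncomputable def contact (p : S) : Submodule ℝ (TangentSpace (𝓡 (2 * m + 1)) p) :=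
  LinearMap.ker (𝓢.eta p : TangentSpace (𝓡 (2 * m + 1)) p →ₗ[ℝ] ℝ)

/-- The transverse metric `g^T`: the restriction of `g` to `D`. -/
noncomputable def transverseMetric (p : S) (v w : 𝓢.contact p) : ℝ :=
  𝓢.g.inner p (v : TangentSpace (𝓡 (2 * m + 1)) p) (w : TangentSpace (𝓡 (2 * m + 1)) p)

/-- The transverse complex structure, extended by zero along `ξ`: the `TS`-component of `J` on
`TS ⊂ TC(S)|_{r = 1}`. It agrees with `J` on `D` and maps `ξ` to `0`. -/
noncomputable def transverseJ (p : S) (v : TangentSpace (𝓡 (2 * m + 1)) p) :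
    TangentSpace (𝓡 (2 * m + 1)) p :=
  baseComp (𝓢.J (atOne p) (coneVec (atOne p) v 0))

/-- Basic functions: smooth functions `u` with `ξ u = 0`. -/
def IsBasic (u : S → ℂ) : Prop :=
  ContMDiff (𝓡 (2 * m + 1)) 𝓘(ℝ, ℂ) ∞ u ∧ ∀ p : S, d u p (𝓢.reeb p) = 0

/-- The operator `∂̄_B` on functions, `∂̄_B u = (du + √-1 du ∘ J) / 2`: the `(0,1)`-part of `du`
with respect to the transverse complex structure. Its values are recorded as functions on the
tangent spaces. -/
noncomputable def dbar (u : S → ℂ) (p : S) (v : TangentSpace (𝓡 (2 * m + 1)) p) : ℂ :=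
  (d u p v + Complex.I * d u p (𝓢.transverseJ p v)) / 2

/-- The operator `d_B`: the exterior derivative on basic functions. -/
noncomputable def dB (_𝓢 : SasakianStructure m S) (u : S → ℂ) (p : S)
    (v : TangentSpace (𝓡 (2 * m + 1)) p) : ℂ :=
  d u p v

section Integral

variable [T2Space S] [SigmaCompactSpace S]

/-- The `L²` inner product `∫_S u conj(v) dvol_g` of functions. -/
noncomputable def functionInner (u v : S → ℂ) : ℂ :=
  integral 𝓢.g (fun p => u p * (starRingEnd ℂ) (v p))

/-- The `L²` inner product `∫_S g^T(α, conj β) dvol_g` of basic `1`-forms, defined by the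
transverse metric. -/
noncomputable def formInner (α β : ∀ p : S, TangentSpace (𝓡 (2 * m + 1)) p → ℂ) : ℂ :=
  integral 𝓢.g (fun p => covectorInner (𝓢.transverseMetric p)
    (fun v : 𝓢.contact p => α p v) (fun v : 𝓢.contact p => β p v))

/-- `f` is a value at the basic `1`-form `α` of the adjoint of the operator `T` from basic functions
to basic `1`-forms: `f` is basic and `⟨T v, α⟩ = ⟨v, f⟩` for all basic functions `v`. -/
def IsAdjointValue (T : (S → ℂ) → ∀ p : S, TangentSpace (𝓡 (2 * m + 1)) p → ℂ)
    (α : ∀ p : S, TangentSpace (𝓡 (2 * m + 1)) p → ℂ) (f : S → ℂ) : Prop :=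
  𝓢.IsBasic f ∧ ∀ v : S → ℂ, 𝓢.IsBasic v → 𝓢.formInner (T v) α = 𝓢.functionInner v f

/-- The adjoint operator `T^*` of `T` on basic `1`-forms (arbitrary where there is no value). -/
noncomputable def adjoint (T : (S → ℂ) → ∀ p : S, TangentSpace (𝓡 (2 * m + 1)) p → ℂ)
    (α : ∀ p : S, TangentSpace (𝓡 (2 * m + 1)) p → ℂ) : S → ℂ :=
  Classical.epsilon (𝓢.IsAdjointValue T α)

/-- The basic Laplacian `Δ^B = d_B^* d_B + d_B d_B^*` on functions, where `d_B^* = 0`. -/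
noncomputable def basicLaplacian (u : S → ℂ) : S → ℂ := 𝓢.adjoint 𝓢.dB (𝓢.dB u)

/-- The basic Dolbeault Laplacian `□^B = ∂̄_B^* ∂̄_B + ∂̄_B ∂̄_B^*` on functions, where
`∂̄_B^* = 0`. -/
noncomputable def basicDolbeaultLaplacian (u : S → ℂ) : S → ℂ := 𝓢.adjoint 𝓢.dbar (𝓢.dbar u)

end Integral

end SasakianStructure

end Sasaki

/-!
Since `ω = dη / 2` is closed and `L_ξ J = 0`, the Reeb field `ξ` preserves `g`, so the Riemannian
Laplacian maps basic functions to basic functions and Green's identity gives `Δ_g u = d_B^* d_B u`.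
For `∂̄_B`, let `Φ` be `J` on the contact bundle, extended by zero along `ξ`. For basic `u` the flow
of `Φ ∇u` distorts the bilinear form `ω + η ⊗ η` only by trace-free terms, and the determinant of
this form is `det g`, so `Φ ∇u` is divergence free. Integrating by parts, the terms of
`⟨∂̄_B v, ∂̄_B u⟩` that contain `Φ` therefore cancel, which leaves `⟨dv, du⟩ / 2`. Uniqueness of
adjoint values is the positivity of the `L²` product of basic functions.
-/

namespace Sasaki

set_option maxSynthPendingDepth 3

open Module Topology

/-! ### Determinants and divergence -/

section Determinant

variable {ι : Type*} [Fintype ι] [DecidableEq ι]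
  {E : Type*} [NormedAddCommGroup E] [NormedSpace ℝ E]
  {F : Type*} [NormedAddCommGroup F] [NormedSpace ℝ F]

theorem contDiff_det {k : WithTop ℕ∞} :
    ContDiff ℝ k fun A : ι → ι → ℝ => (Matrix.of A).det := by
  simp only [Matrix.det_apply', Matrix.of_apply]
  fun_prop

theorem fderiv_log_det {A : F → Matrix ι ι ℝ} {y : F}
    (hA : ∀ i j, DifferentiableAt ℝ (fun x => A x i j) y) (h0 : (A y).det ≠ 0) (v : F) :
    fderiv ℝ (fun x => Real.log (A x).det) y v =
      ((A y)⁻¹ * Matrix.of fun i j => fderiv ℝ (fun x => A x i j) y v).trace := by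
  let detRows : ContinuousMultilinearMap ℝ (fun _ : ι => ι → ℝ) ℝ :=
    ⟨Matrix.detRowAlternating.toMultilinearMap, (continuous_id (X := Matrix ι ι ℝ)).matrix_det⟩
  have hrows : HasFDerivAt (F := ι → ι → ℝ) A
      (.pi fun i => .pi fun j => fderiv ℝ (fun x => A x i j) y) y :=
    hasFDerivAt_pi.2 fun i => hasFDerivAt_pi.2 fun j => (hA i j).hasFDerivAt
  set A' : Matrix ι ι ℝ := Matrix.of fun i j => fderiv ℝ (fun x => A x i j) y v
  have hcramer : ∀ i, (A' * (A y).adjugate) i i = ((A y).updateRow i (A' i)).det := fun i => by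
    rw [← Matrix.cramer_transpose_apply, Matrix.cramer_eq_adjugate_mulVec,
      ← Matrix.adjugate_transpose, Matrix.mulVec_transpose]
    rfl
  calc fderiv ℝ (fun x => Real.log (A x).det) y v
      = (A y).det⁻¹ * ∑ i, ((A y).updateRow i (A' i)).det :=
        (congrArg (· v) (((detRows.hasFDerivAt (A y)).comp y hrows).log h0).fderiv).trans
          (congrArg ((A y).det⁻¹ * ·) (detRows.linearDeriv_apply (A y) A'))
    _ = ((A y)⁻¹ * A').trace := by
        rw [Matrix.trace_mul_comm, Matrix.inv_def, Ring.inverse_eq_inv', Matrix.mul_smul,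
          Matrix.trace_smul, smul_eq_mul, Matrix.trace]
        simp only [Matrix.diag_apply, hcramer]

/-- The Gram matrix of a bilinear form in a basis. -/
noncomputable def gramMatrix (e : Basis ι ℝ E) (b : E →L[ℝ] E →L[ℝ] ℝ) : Matrix ι ι ℝ :=
  LinearMap.BilinForm.toMatrix e b.toBilinForm

@[simp]
theorem gramMatrix_apply (e : Basis ι ℝ E) (b : E →L[ℝ] E →L[ℝ] ℝ) (i j : ι) :
    gramMatrix e b i j = b (e i) (e j) :=
  LinearMap.BilinForm.toMatrix_apply e b.toBilinForm i j

theorem gramMatrix_bilinearComp (e : Basis ι ℝ E) (b : E →L[ℝ] E →L[ℝ] ℝ) (A C : E →L[ℝ] E) :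
    gramMatrix e (b.bilinearComp A C) = (LinearMap.toMatrix e e (A : E →ₗ[ℝ] E)).transpose *
      gramMatrix e b * LinearMap.toMatrix e e (C : E →ₗ[ℝ] E) :=
  LinearMap.BilinForm.toMatrix_comp e e b.toBilinForm A C

theorem det_gramMatrix_bilinearComp (e : Basis ι ℝ E) (b : E →L[ℝ] E →L[ℝ] ℝ)
    (A C : E →L[ℝ] E) :
    (gramMatrix e (b.bilinearComp A C)).det = A.det * (gramMatrix e b).det * C.det := by
  simp only [gramMatrix_bilinearComp, Matrix.det_mul, Matrix.det_transpose,
    LinearMap.det_toMatrix, ContinuousLinearMap.det]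

theorem posDef_gramMatrix (e : Basis ι ℝ E) {b : E →L[ℝ] E →L[ℝ] ℝ} (hsymm : ∀ v w, b v w = b w v)
    (hpos : ∀ v, v ≠ 0 → 0 < b v v) : (gramMatrix e b).PosDef :=
  (LinearMap.BilinForm.posDef_toQuadraticMap_iff_matrix e _ ⟨hsymm⟩).1 hpos

theorem differentiableAt_gramMatrix (e : Basis ι ℝ E) {B : F → E →L[ℝ] E →L[ℝ] ℝ} {y : F}
    (hB : DifferentiableAt ℝ B y) (i j : ι) :
    DifferentiableAt ℝ (fun x => gramMatrix e (B x) i j) y := by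
  simp only [gramMatrix_apply]
  fun_prop

theorem fderiv_gramMatrix (e : Basis ι ℝ E) {B : F → E →L[ℝ] E →L[ℝ] ℝ} {y : F}
    (hB : DifferentiableAt ℝ B y) (v : F) :
    (Matrix.of fun i j => fderiv ℝ (fun x => gramMatrix e (B x) i j) y v) =
      gramMatrix e (fderiv ℝ B y v) := by
  ext i j
  simp only [Matrix.of_apply, gramMatrix_apply]
  rw [fderiv_clm_apply (by fun_prop) (by fun_prop), fderiv_clm_apply hB (by fun_prop)]
  simp

variable [FiniteDimensional ℝ E]

theorem fderiv_trace {A : F → E →L[ℝ] E} {y : F} (hA : DifferentiableAt ℝ A y) (v : F) :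
    fderiv ℝ (fun x => LinearMap.trace ℝ E (A x)) y v = LinearMap.trace ℝ E (fderiv ℝ A y v) := by
  let tr : (E →L[ℝ] E) →L[ℝ] ℝ :=
    LinearMap.toContinuousLinearMap (LinearMap.trace ℝ E ∘ₗ ContinuousLinearMap.coeLM ℝ)
  exact congrArg (· v) (tr.hasFDerivAt.comp y hA.hasFDerivAt).fderiv

theorem differentiableAt_trace {A : F → E →L[ℝ] E} {y : F} (hA : DifferentiableAt ℝ A y) :
    DifferentiableAt ℝ (fun x => LinearMap.trace ℝ E (A x)) y :=
  (LinearMap.toContinuousLinearMap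
    (LinearMap.trace ℝ E ∘ₗ ContinuousLinearMap.coeLM ℝ)).differentiableAt.comp y hA

theorem contDiff_clm_det {k : WithTop ℕ∞} :
    ContDiff ℝ k (ContinuousLinearMap.det : (E →L[ℝ] E) → ℝ) := by
  let e := finBasis ℝ E
  let entries : (E →L[ℝ] E) →ₗ[ℝ] Matrix _ _ ℝ :=
    (LinearMap.toMatrix e e).toLinearMap ∘ₗ ContinuousLinearMap.coeLM ℝ
  have hentries : ContDiff ℝ k fun A : E →L[ℝ] E => fun i j => entries A i j :=
    contDiff_pi.2 fun i => contDiff_pi.2 fun j =>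
      (LinearMap.toContinuousLinearMap (Matrix.entryLinearMap ℝ ℝ i j ∘ₗ entries)).contDiff
  have hdet : ContinuousLinearMap.det = fun A : E →L[ℝ] E => (entries A).det :=
    funext fun A => (LinearMap.det_toMatrix e (A : E →ₗ[ℝ] E)).symm
  exact hdet ▸ contDiff_det.comp hentries

theorem fderiv_log_clm_det {A : F → E →L[ℝ] E} {L : E →L[ℝ] E} {y : F}
    (hA : DifferentiableAt ℝ A y) (hL : L ∘L A y = .id ℝ E) (v : F) :
    fderiv ℝ (fun x => Real.log (A x).det) y v = LinearMap.trace ℝ E (L ∘L fderiv ℝ A y v) := by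
  let e := finBasis ℝ E
  have hinv : LinearMap.toMatrix e e (L : E →ₗ[ℝ] E) *
      LinearMap.toMatrix e e (A y : E →ₗ[ℝ] E) = 1 := by
    rw [← LinearMap.toMatrix_comp, ← ContinuousLinearMap.toLinearMap_comp, hL]
    exact LinearMap.toMatrix_id e
  have hentry : ∀ i j, (fun x => LinearMap.toMatrix e e (A x : E →ₗ[ℝ] E) i j) =
      fun x => LinearMap.toContinuousLinearMap (e.coord i) (A x (e j)) := fun i j => by
    ext x
    simp [LinearMap.toMatrix_apply]
  have hdiff : ∀ i j,
      DifferentiableAt ℝ (fun x => LinearMap.toMatrix e e (A x : E →ₗ[ℝ] E) i j) y :=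
    fun i j => by rw [hentry]; fun_prop
  simp only [ContinuousLinearMap.det, ← LinearMap.det_toMatrix e]
  rw [fderiv_log_det hdiff (Matrix.isUnit_det_of_left_inverse hinv).ne_zero,
    Matrix.inv_eq_left_inv hinv, LinearMap.trace_eq_matrix_trace ℝ e,
    ContinuousLinearMap.toLinearMap_comp, LinearMap.toMatrix_comp e e e]
  congr 2
  ext i j
  rw [Matrix.of_apply, hentry, fderiv_clm_apply (by fun_prop) (by fun_prop),
    fderiv_clm_apply hA (by fun_prop)]
  simp [LinearMap.toMatrix_apply]

end Determinant

section Divergence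

variable {E : Type*} [NormedAddCommGroup E] [NormedSpace ℝ E]
  {F : Type*} [NormedAddCommGroup F] [NormedSpace ℝ F]

theorem fderiv_clm_apply_apply {A : E → E →L[ℝ] F} {V : E → E} {y : E}
    (hA : DifferentiableAt ℝ A y) (hV : DifferentiableAt ℝ V y) (z : E) :
    fderiv ℝ (fun x => A x (V x)) y z = fderiv ℝ A y z (V y) + A y (fderiv ℝ V y z) := by
  simp [fderiv_clm_apply hA hV, add_comm]

theorem fderiv_form_apply {B : E → E →L[ℝ] E →L[ℝ] ℝ} {V W : E → E} {y : E}
    (hB : DifferentiableAt ℝ B y) (hV : DifferentiableAt ℝ V y) (hW : DifferentiableAt ℝ W y)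
    (z : E) :
    fderiv ℝ (fun x => B x (V x) (W x)) y z =
      fderiv ℝ B y z (V y) (W y) + B y (fderiv ℝ V y z) (W y) + B y (V y) (fderiv ℝ W y z) := by
  rw [fderiv_clm_apply_apply (hB.clm_apply hV) hW, fderiv_clm_apply_apply hB hV, add_apply]

/-- The Lie derivative of a bilinear form along a vector field. -/
noncomputable def lieForm (X : E → E) (B : E → E →L[ℝ] E →L[ℝ] ℝ) (y : E) :
    E →L[ℝ] E →L[ℝ] ℝ :=
  fderiv ℝ B y (X y) + (B y).comp (fderiv ℝ X y) + ((B y).flip.comp (fderiv ℝ X y)).flip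

theorem lieForm_apply (X : E → E) (B : E → E →L[ℝ] E →L[ℝ] ℝ) (y v w : E) :
    lieForm X B y v w =
      fderiv ℝ B y (X y) v w + B y (fderiv ℝ X y v) w + B y v (fderiv ℝ X y w) := rfl

/-- The divergence `ρ⁻¹ ∂ᵢ(ρ Xⁱ)` of the vector field `X` with respect to the density `ρ`, in the
coordinate-free form `X log |ρ| + tr DX`. -/
noncomputable def divergence (ρ : E → ℝ) (X : E → E) (y : E) : ℝ :=
  fderiv ℝ (fun x => Real.log (ρ x)) y (X y) + LinearMap.trace ℝ E (fderiv ℝ X y)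

theorem divergence_congr {ρ ρ' : E → ℝ} {X X' : E → E} {y : E} (hρ : ρ =ᶠ[𝓝 y] ρ')
    (hX : X =ᶠ[𝓝 y] X') : divergence ρ X y = divergence ρ' X' y := by
  have hlog : (fun x => Real.log (ρ x)) =ᶠ[𝓝 y] fun x => Real.log (ρ' x) := hρ.fun_comp Real.log
  rw [divergence, divergence, hlog.fderiv_eq, hX.fderiv_eq, hX.self_of_nhds]

section Basis

variable {ι : Type*} [Fintype ι]

theorem divergence_eq_sum_fderiv_repr (e : Basis ι ℝ E) {ρ : E → ℝ} {X : E → E} {y : E}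
    (hρ : DifferentiableAt ℝ ρ y) (h0 : ρ y ≠ 0) (hX : DifferentiableAt ℝ X y) :
    divergence ρ X y =
      (ρ y)⁻¹ * ∑ i, fderiv ℝ (fun x => ρ x * e.repr (X x) i) y (e i) := by
  classical
  have := Module.Finite.of_basis e
  have hterm : ∀ i, fderiv ℝ (fun x => ρ x * e.repr (X x) i) y (e i) =
      ρ y * LinearMap.toMatrix e e (fderiv ℝ X y : E →ₗ[ℝ] E) i i +
        e.repr (X y) i * fderiv ℝ ρ y (e i) := fun i => by
    have hcoord : HasFDerivAt (fun x => e.repr (X x) i) _ y :=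
      (LinearMap.toContinuousLinearMap (e.coord i)).hasFDerivAt.comp y hX.hasFDerivAt
    refine (congrArg (· (e i)) (hρ.hasFDerivAt.mul hcoord).fderiv).trans ?_
    simp [LinearMap.toMatrix_apply]
  have hsum : ∑ i, e.repr (X y) i * fderiv ℝ ρ y (e i) = fderiv ℝ ρ y (X y) := by
    conv_rhs => rw [← e.sum_repr (X y)]
    simp only [map_sum, map_smul, smul_eq_mul]
  rw [divergence, fderiv.log hρ h0, Finset.sum_congr rfl fun i _ => hterm i,
    Finset.sum_add_distrib, ← Finset.mul_sum, hsum, mul_add, inv_mul_cancel_left₀ h0,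
    LinearMap.trace_eq_matrix_trace ℝ e, Matrix.trace, add_comm]
  rfl

variable [DecidableEq ι] (e : Basis ι ℝ E) {B : E → E →L[ℝ] E →L[ℝ] ℝ} {X : E → E} {y : E}
  {C : E →L[ℝ] E} (hC : ∀ v w, lieForm X B y v w = B y (C v) w)
include hC

theorem gramMatrix_fderiv_apply_of_lieForm_eq :
    gramMatrix e (fderiv ℝ B y (X y)) =
      (LinearMap.toMatrix e e (C : E →ₗ[ℝ] E)).transpose * gramMatrix e (B y) -
        (LinearMap.toMatrix e e (fderiv ℝ X y : E →ₗ[ℝ] E)).transpose * gramMatrix e (B y) -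
        gramMatrix e (B y) * LinearMap.toMatrix e e (fderiv ℝ X y : E →ₗ[ℝ] E) := by
  have hform : (fderiv ℝ B y (X y)).toBilinForm = (B y).toBilinForm.compLeft C -
      (B y).toBilinForm.compLeft (fderiv ℝ X y) -
      (B y).toBilinForm.compRight (fderiv ℝ X y) := by
    ext v w
    have hvw := hC v w
    rw [lieForm_apply] at hvw
    simp only [LinearMap.sub_apply, LinearMap.BilinForm.compLeft_apply,
      LinearMap.BilinForm.compRight_apply, ContinuousLinearMap.toBilinForm_apply,
      ContinuousLinearMap.coe_coe, ← hvw]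
    ring
  rw [gramMatrix, hform, map_sub (LinearMap.BilinForm.toMatrix e),
    map_sub (LinearMap.BilinForm.toMatrix e), LinearMap.BilinForm.toMatrix_compLeft,
    LinearMap.BilinForm.toMatrix_compLeft, LinearMap.BilinForm.toMatrix_compRight]
  rfl

/-- The volume density of a nondegenerate form `B` changes along `X` at the rate `tr (B⁻¹ L_X B)/2`;
here the endomorphism `C = B⁻¹ L_X B` is given by its defining property. -/
theorem divergence_eq_half_trace {ρ : E → ℝ} (hB : DifferentiableAt ℝ B y)
    (h0 : (gramMatrix e (B y)).det ≠ 0)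
    (hρ : ∀ᶠ x in 𝓝 y, ρ x ^ 2 = |(gramMatrix e (B x)).det|) :
    divergence ρ X y = LinearMap.trace ℝ E C / 2 := by
  set M := gramMatrix e (B y)
  set DX := LinearMap.toMatrix e e (fderiv ℝ X y : E →ₗ[ℝ] E)
  have hlog : (fun x => Real.log (ρ x)) =ᶠ[𝓝 y]
      fun x => (1 / 2 : ℝ) • Real.log (gramMatrix e (B x)).det := by
    filter_upwards [hρ] with x hx
    rw [← Real.log_abs (gramMatrix e (B x)).det, ← hx, Real.log_pow, smul_eq_mul]
    ring
  have htrace : ∀ A : Matrix ι ι ℝ, (M⁻¹ * (A.transpose * M)).trace = A.trace := fun A => by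
    rw [Matrix.trace_mul_comm, mul_assoc, Matrix.mul_nonsing_inv _ h0.isUnit, mul_one,
      Matrix.trace_transpose]
  have htrace' : (M⁻¹ * (M * DX)).trace = DX.trace := by
    rw [← mul_assoc, Matrix.nonsing_inv_mul _ h0.isUnit, one_mul]
  have hdiff : DifferentiableAt ℝ (fun x => Real.log (gramMatrix e (B x)).det) y :=
    ((contDiff_det.differentiable one_ne_zero).differentiableAt.comp y
      (differentiableAt_pi.2 fun i => differentiableAt_pi.2
        (differentiableAt_gramMatrix e hB i))).log h0
  have hderiv : fderiv ℝ (fun x => Real.log (ρ x)) y (X y) =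
      (M⁻¹ * gramMatrix e (fderiv ℝ B y (X y))).trace / 2 := by
    rw [← fderiv_gramMatrix e hB, ← fderiv_log_det (differentiableAt_gramMatrix e hB) h0,
      hlog.fderiv_eq, fderiv_fun_const_smul hdiff, smul_apply, smul_eq_mul]
    ring
  rw [divergence, hderiv, gramMatrix_fderiv_apply_of_lieForm_eq e hC, mul_sub, mul_sub,
    Matrix.trace_sub, Matrix.trace_sub, htrace, htrace, htrace',
    LinearMap.trace_eq_matrix_trace ℝ e, LinearMap.trace_eq_matrix_trace ℝ e C]
  ring

end Basis

variable [FiniteDimensional ℝ E]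

theorem fderiv_divergence {ρ : E → ℝ} {X : E → E} {y : E} (hρ : ContDiffAt ℝ 2 ρ y)
    (h0 : ρ y ≠ 0) (hX : ContDiffAt ℝ 2 X y) (v : E) :
    fderiv ℝ (divergence ρ X) y v =
      fderiv ℝ (fderiv ℝ fun x => Real.log (ρ x)) y v (X y) +
        fderiv ℝ (fun x => Real.log (ρ x)) y (fderiv ℝ X y v) +
        LinearMap.trace ℝ E (fderiv ℝ (fderiv ℝ X) y v) := by
  have hlog := ((hρ.log h0).fderiv_right (m := 1) le_rfl).differentiableAt one_ne_zero
  have hX1 : DifferentiableAt ℝ X y := hX.differentiableAt two_ne_zero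
  have hX2 := (hX.fderiv_right (m := 1) le_rfl).differentiableAt one_ne_zero
  have hsum := fderiv_fun_add (hlog.clm_apply hX1) (differentiableAt_trace hX2)
  exact (congrArg (· v) hsum).trans <| by
    rw [add_apply, fderiv_clm_apply_apply hlog hX1, fderiv_trace hX2]

theorem divergence_lieBracket {ρ : E → ℝ} {X Y : E → E} {y : E} (hρ : ContDiffAt ℝ 2 ρ y)
    (h0 : ρ y ≠ 0) (hX : ContDiffAt ℝ 2 X y) (hY : ContDiffAt ℝ 2 Y y) :
    divergence ρ (VectorField.lieBracket ℝ X Y) y =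
      fderiv ℝ (divergence ρ Y) y (X y) - fderiv ℝ (divergence ρ X) y (Y y) := by
  have hX1 : DifferentiableAt ℝ X y := hX.differentiableAt two_ne_zero
  have hY1 : DifferentiableAt ℝ Y y := hY.differentiableAt two_ne_zero
  have hX2 := (hX.fderiv_right (m := 1) le_rfl).differentiableAt one_ne_zero
  have hY2 := (hY.fderiv_right (m := 1) le_rfl).differentiableAt one_ne_zero
  have hbracket : fderiv ℝ (VectorField.lieBracket ℝ X Y) y =
      fderiv ℝ (fderiv ℝ Y) y (X y) - fderiv ℝ (fderiv ℝ X) y (Y y) +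
        (fderiv ℝ Y y ∘L fderiv ℝ X y - fderiv ℝ X y ∘L fderiv ℝ Y y) := by
    ext v
    rw [VectorField.lieBracket_eq,
      fderiv_fun_sub (hY2.clm_apply hX1) (hX2.clm_apply hY1), sub_apply,
      fderiv_clm_apply_apply hY2 hX1, fderiv_clm_apply_apply hX2 hY1,
      hY.isSymmSndFDerivAt (by simp) v, hX.isSymmSndFDerivAt (by simp) v]
    simp only [add_apply, sub_apply, ContinuousLinearMap.comp_apply]
    abel
  have htrace : LinearMap.trace ℝ E (fderiv ℝ Y y ∘L fderiv ℝ X y) =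
      LinearMap.trace ℝ E (fderiv ℝ X y ∘L fderiv ℝ Y y) :=
    LinearMap.trace_mul_comm ℝ (fderiv ℝ Y y : E →ₗ[ℝ] E) (fderiv ℝ X y)
  rw [fderiv_divergence hρ h0 hX, fderiv_divergence hρ h0 hY, divergence, hbracket,
    VectorField.lieBracket, (hρ.log h0).isSymmSndFDerivAt (by simp) (X y)]
  simp only [map_add, map_sub, htrace, ContinuousLinearMap.toLinearMap_add,
    ContinuousLinearMap.toLinearMap_sub]
  ring

section ChangeOfCoordinates

variable {τ X Y : E → E} {y : E} (hτ : ContDiffAt ℝ 2 τ y) {L : E →L[ℝ] E}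
  (hL : L ∘L fderiv ℝ τ y = .id ℝ E) (hX : DifferentiableAt ℝ X y)
  (hY : DifferentiableAt ℝ Y (τ y)) (hXY : ∀ᶠ x in 𝓝 y, fderiv ℝ τ x (X x) = Y (τ x))
include hτ hL hX hY hXY

theorem trace_fderiv_pullback :
    LinearMap.trace ℝ E (L ∘L fderiv ℝ (fderiv ℝ τ) y (X y)) + LinearMap.trace ℝ E (fderiv ℝ X y) =
      LinearMap.trace ℝ E (fderiv ℝ Y (τ y)) := by
  have hτ1 : DifferentiableAt ℝ τ y := hτ.differentiableAt two_ne_zero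
  have hτ2 := (hτ.fderiv_right (m := 1) le_rfl).differentiableAt one_ne_zero
  have hfield : ∀ v, fderiv ℝ (fderiv ℝ τ) y (X y) v + fderiv ℝ τ y (fderiv ℝ X y v) =
      fderiv ℝ Y (τ y) (fderiv ℝ τ y v) := fun v => by
    rw [hτ.isSymmSndFDerivAt (by simp), ← fderiv_clm_apply_apply hτ2 hX,
      Filter.EventuallyEq.fderiv_eq (f₁ := fun x => fderiv ℝ τ x (X x)) hXY]
    exact congrArg (· v) (hY.hasFDerivAt.comp y hτ1.hasFDerivAt).fderiv
  have hconj : L ∘L fderiv ℝ (fderiv ℝ τ) y (X y) + fderiv ℝ X y =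
      L ∘L (fderiv ℝ Y (τ y) ∘L fderiv ℝ τ y) := by
    ext v
    have hLv : L (fderiv ℝ τ y (fderiv ℝ X y v)) = fderiv ℝ X y v :=
      congrArg (fun A : E →L[ℝ] E => A (fderiv ℝ X y v)) hL
    rw [add_apply, ContinuousLinearMap.comp_apply, ← hLv, ← map_add, hfield]
    rfl
  have hinv : (fderiv ℝ τ y : E →ₗ[ℝ] E) * (L : E →ₗ[ℝ] E) = 1 :=
    mul_eq_one_comm.1 (congrArg ContinuousLinearMap.toLinearMap hL)
  rw [← map_add, ← ContinuousLinearMap.toLinearMap_add, hconj]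
  exact (LinearMap.trace_mul_comm ℝ (L : E →ₗ[ℝ] E)
    ((fderiv ℝ Y (τ y) : E →ₗ[ℝ] E) * (fderiv ℝ τ y : E →ₗ[ℝ] E))).trans
    (by rw [mul_assoc, hinv, mul_one])

/-- The divergence is natural under a change of coordinates `τ` whose Jacobian relates the two
densities. -/
theorem divergence_pullback {ρ₁ ρ₂ : E → ℝ} (hρ₂ : DifferentiableAt ℝ ρ₂ (τ y))
    (h0 : ρ₂ (τ y) ≠ 0) (hρ : ∀ᶠ x in 𝓝 y, ρ₁ x = |(fderiv ℝ τ x).det| * ρ₂ (τ x)) :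
    divergence ρ₁ X y = divergence ρ₂ Y (τ y) := by
  have hτ1 : DifferentiableAt ℝ τ y := hτ.differentiableAt two_ne_zero
  have hτ2 := (hτ.fderiv_right (m := 1) le_rfl).differentiableAt one_ne_zero
  have hdet : DifferentiableAt ℝ (fun x => (fderiv ℝ τ x).det) y :=
    (contDiff_clm_det.differentiable one_ne_zero).differentiableAt.comp y hτ2
  have hdet0 : (fderiv ℝ τ y).det ≠ 0 := by
    refine right_ne_zero_of_mul (a := L.det) ?_
    rw [ContinuousLinearMap.det, ContinuousLinearMap.det, ← LinearMap.det_comp,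
      ← ContinuousLinearMap.toLinearMap_comp, hL]
    simp
  have hρ₂τ : DifferentiableAt ℝ (fun x => ρ₂ (τ x)) y := hρ₂.comp y hτ1
  have hlog : (fun x => Real.log (ρ₁ x)) =ᶠ[𝓝 y]
      fun x => Real.log (fderiv ℝ τ x).det + Real.log (ρ₂ (τ x)) := by
    filter_upwards [hρ, hdet.continuousAt.eventually_ne hdet0,
      hρ₂τ.continuousAt.eventually_ne h0] with x hx hx1 hx2
    rw [hx, Real.log_mul (abs_ne_zero.2 hx1) hx2, Real.log_abs]
  have hlogρ₂ : HasFDerivAt (fun x => Real.log (ρ₂ (τ x))) _ y :=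
    (hρ₂.log h0).hasFDerivAt.comp y hτ1.hasFDerivAt
  rw [divergence, divergence, hlog.fderiv_eq, fderiv_fun_add (hdet.log hdet0)
    hlogρ₂.differentiableAt, hlogρ₂.fderiv, add_apply, fderiv_log_clm_det hτ2 hL,
    ContinuousLinearMap.comp_apply, hXY.self_of_nhds, ← trace_fderiv_pullback hτ hL hX hY hXY]
  ring

end ChangeOfCoordinates

end Divergence

/-! ### Sasakian identities in a chart -/

section LieDerivative

variable {E : Type*} [NormedAddCommGroup E] [NormedSpace ℝ E]

/-- The Lie derivative of a `1`-form along a vector field. -/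
noncomputable def lieCovector (X : E → E) (α : E → E →L[ℝ] ℝ) (y : E) : E →L[ℝ] ℝ :=
  fderiv ℝ α y (X y) + (α y).comp (fderiv ℝ X y)

/-- The Lie derivative of a field of endomorphisms along a vector field. -/
noncomputable def lieEnd (X : E → E) (A : E → E →L[ℝ] E) (y : E) : E →L[ℝ] E :=
  fderiv ℝ A y (X y) - (fderiv ℝ X y).comp (A y) + (A y).comp (fderiv ℝ X y)

variable {X Y : E → E} {α β : E → E →L[ℝ] ℝ} {B : E → E →L[ℝ] E →L[ℝ] ℝ} {y : E}

theorem lieCovector_apply (X : E → E) (α : E → E →L[ℝ] ℝ) (y w : E) :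
    lieCovector X α y w = fderiv ℝ α y (X y) w + α y (fderiv ℝ X y w) := rfl

theorem lieEnd_apply (X : E → E) (A : E → E →L[ℝ] E) (y v : E) :
    lieEnd X A y v =
      fderiv ℝ A y (X y) v - fderiv ℝ X y (A y v) + A y (fderiv ℝ X y v) := rfl

theorem lieForm_congr {B' : E → E →L[ℝ] E →L[ℝ] ℝ} (hB : B =ᶠ[𝓝 y] B') :
    lieForm X B y = lieForm X B' y := by
  rw [lieForm, lieForm, hB.fderiv_eq, hB.self_of_nhds]

theorem lieCovector_eq_cartan (hα : DifferentiableAt ℝ α y) (hX : DifferentiableAt ℝ X y) (w : E) :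
    lieCovector X α y w = fderiv ℝ α y (X y) w - fderiv ℝ α y w (X y) +
      fderiv ℝ (fun x => α x (X x)) y w := by
  rw [fderiv_clm_apply_apply hα hX, lieCovector_apply]
  ring

theorem lieForm_eq_cartan (hB : DifferentiableAt ℝ B y) (hX : DifferentiableAt ℝ X y)
    (hskew : ∀ v w, B y v w = -B y w v)
    (hclosed : ∀ v w, fderiv ℝ B y (X y) v w = fderiv ℝ B y v (X y) w - fderiv ℝ B y w (X y) v)
    (v w : E) :
    lieForm X B y v w =
      fderiv ℝ (fun x => B x (X x)) y v w - fderiv ℝ (fun x => B x (X x)) y w v := by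
  rw [fderiv_clm_apply_apply hB hX, fderiv_clm_apply_apply hB hX, lieForm_apply, hclosed,
    hskew v, add_apply, add_apply]
  ring

theorem lieCovector_form_apply (hB : DifferentiableAt ℝ B y) (hY : DifferentiableAt ℝ Y y)
    (w : E) :
    lieCovector X (fun x => B x (Y x)) y w =
      lieForm X B y (Y y) w + B y (VectorField.lieBracket ℝ X Y y) w := by
  rw [lieCovector_apply, fderiv_clm_apply_apply hB hY, lieForm_apply, VectorField.lieBracket,
    map_sub, add_apply, sub_apply]
  ring

theorem lieForm_add {B' : E → E →L[ℝ] E →L[ℝ] ℝ} (hB : DifferentiableAt ℝ B y)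
    (hB' : DifferentiableAt ℝ B' y) (v w : E) :
    lieForm X (fun x => B x + B' x) y v w = lieForm X B y v w + lieForm X B' y v w := by
  simp only [lieForm_apply, fderiv_fun_add hB hB', add_apply]
  ring

theorem lieForm_sub {B' : E → E →L[ℝ] E →L[ℝ] ℝ} (hB : DifferentiableAt ℝ B y)
    (hB' : DifferentiableAt ℝ B' y) (v w : E) :
    lieForm X (fun x => B x - B' x) y v w = lieForm X B y v w - lieForm X B' y v w := by
  simp only [lieForm_apply, fderiv_fun_sub hB hB', sub_apply]
  ring

theorem fderiv_smulRight_apply (hα : DifferentiableAt ℝ α y) (hβ : DifferentiableAt ℝ β y)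
    (z v w : E) :
    fderiv ℝ (fun x => (α x).smulRight (β x)) y z v w =
      fderiv ℝ α y z v * β y w + α y v * fderiv ℝ β y z w := by
  have hderiv := ((ContinuousLinearMap.smulRightL ℝ E (E →L[ℝ] ℝ)).hasFDerivAt_of_bilinear
    hα.hasFDerivAt hβ.hasFDerivAt).fderiv
  refine (congrArg (fun A : E →L[ℝ] E →L[ℝ] E →L[ℝ] ℝ => A z v w) hderiv).trans ?_
  simp only [ContinuousLinearMap.precompR_apply, ContinuousLinearMap.compL_apply, add_apply,
    ContinuousLinearMap.comp_apply, ContinuousLinearMap.smulRightL_apply_apply,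
    ContinuousLinearMap.precompL_apply, ContinuousLinearMap.smulRight_apply, smul_apply,
    smul_eq_mul]
  ring

theorem lieForm_smulRight (hα : DifferentiableAt ℝ α y) (hβ : DifferentiableAt ℝ β y) (v w : E) :
    lieForm X (fun x => (α x).smulRight (β x)) y v w =
      lieCovector X α y v * β y w + α y v * lieCovector X β y w := by
  rw [lieForm_apply, fderiv_smulRight_apply hα hβ, lieCovector_apply, lieCovector_apply]
  simp only [ContinuousLinearMap.smulRight_apply, smul_apply, smul_eq_mul]
  ring

theorem lieForm_comp {A : E → E →L[ℝ] E} (hB : DifferentiableAt ℝ B y)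
    (hA : DifferentiableAt ℝ A y) (v w : E) :
    lieForm X (fun x => (B x).comp (A x)) y v w =
      lieForm X B y (A y v) w + B y (lieEnd X A y v) w := by
  have hderiv : ∀ z, fderiv ℝ (fun x => (B x).comp (A x)) y z v w =
      fderiv ℝ B y z (A y v) w + B y (fderiv ℝ A y z v) w := fun z => by
    rw [fderiv_clm_comp hB hA]
    simp [add_comm]
  rw [lieForm_apply, hderiv, lieForm_apply, lieEnd_apply, map_add, map_sub, add_apply, sub_apply]
  simp only [ContinuousLinearMap.comp_apply]
  ring

end LieDerivative

section LocalSasakian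

variable {E : Type*} [NormedAddCommGroup E] [NormedSpace ℝ E]

/-- The identities satisfied by the metric `G`, the Reeb field `ξ` and the transverse complex
structure `Φ` (extended by `Φ ξ = 0`) of a Sasakian manifold in a coordinate domain `T`. -/
structure IsLocalSasakian (T : Set E) (G : E → E →L[ℝ] E →L[ℝ] ℝ) (ξ : E → E)
    (Φ : E → E →L[ℝ] E) : Prop where
  isOpen : IsOpen T
  smooth_metric : ContDiffOn ℝ ∞ G T
  smooth_reeb : ContDiffOn ℝ ∞ ξ T
  smooth_Φ : ContDiffOn ℝ ∞ Φ T
  symm : ∀ y ∈ T, ∀ v w, G y v w = G y w v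
  pos : ∀ y ∈ T, ∀ v, v ≠ 0 → 0 < G y v v
  skew : ∀ y ∈ T, ∀ v w, G y (Φ y v) w = -G y v (Φ y w)
  unit : ∀ y ∈ T, G y (ξ y) (ξ y) = 1
  Φ_reeb : ∀ y ∈ T, Φ y (ξ y) = 0
  Φ_sq : ∀ y ∈ T, ∀ v, Φ y (Φ y v) = -v + G y (ξ y) v • ξ y
  contact : ∀ y ∈ T, ∀ v w, 2 * G y (Φ y v) w =
    fderiv ℝ (fun x => G x (ξ x)) y v w - fderiv ℝ (fun x => G x (ξ x)) y w v
  lie_Φ : ∀ y ∈ T, lieEnd ξ Φ y = 0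

namespace IsLocalSasakian

variable {T : Set E} {G : E → E →L[ℝ] E →L[ℝ] ℝ} {ξ : E → E} {Φ : E → E →L[ℝ] E}

local notation "η" => fun x => G x (ξ x)
local notation "β" => fun x => G x ∘L Φ x

variable (h : IsLocalSasakian T G ξ Φ) {y : E} (hy : y ∈ T)
include h hy

theorem mem_nhds : T ∈ 𝓝 y := h.isOpen.mem_nhds hy

theorem differentiableAt {F : Type*} [NormedAddCommGroup F] [NormedSpace ℝ F] {f : E → F}
    (hf : ContDiffOn ℝ ∞ f T) : DifferentiableAt ℝ f y :=
  (hf.contDiffAt (h.mem_nhds hy)).differentiableAt (by simp)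

theorem differentiableAt_fderiv {F : Type*} [NormedAddCommGroup F] [NormedSpace ℝ F] {f : E → F}
    (hf : ContDiffOn ℝ ∞ f T) : DifferentiableAt ℝ (fderiv ℝ f) y :=
  ((hf.contDiffAt (h.mem_nhds hy)).fderiv_right (m := 1) (by norm_cast)).differentiableAt
    one_ne_zero

theorem isSymmSndFDerivAt {F : Type*} [NormedAddCommGroup F] [NormedSpace ℝ F] {f : E → F}
    (hf : ContDiffOn ℝ ∞ f T) : IsSymmSndFDerivAt ℝ f y :=
  (hf.contDiffAt (h.mem_nhds hy)).isSymmSndFDerivAt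
    (by rw [minSmoothness_of_isRCLikeNormedField]; norm_cast)

theorem fderiv_congr {F : Type*} [NormedAddCommGroup F] [NormedSpace ℝ F] {f f' : E → F}
    (hf : ∀ x ∈ T, f x = f' x) : fderiv ℝ f y = fderiv ℝ f' y :=
  (Filter.eventuallyEq_of_mem (h.mem_nhds hy) hf).fderiv_eq

theorem fderiv_eq_zero {F : Type*} [NormedAddCommGroup F] [NormedSpace ℝ F] {f : E → F} {c : F}
    (hf : ∀ x ∈ T, f x = c) : fderiv ℝ f y = 0 := by
  rw [h.fderiv_congr hy (f' := fun _ => c) hf, fderiv_const_apply]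

omit hy in
theorem smooth_contactForm : ContDiffOn ℝ ∞ η T := h.smooth_metric.clm_apply h.smooth_reeb

omit hy in
theorem smooth_fundamentalForm : ContDiffOn ℝ ∞ β T := h.smooth_metric.clm_comp h.smooth_Φ

theorem contactForm_Φ (v : E) : G y (ξ y) (Φ y v) = 0 := by
  rw [← neg_eq_zero, ← h.skew y hy, h.Φ_reeb y hy, map_zero, zero_apply]

theorem lieCovector_reeb_contactForm : lieCovector ξ η y = 0 := by
  ext w
  rw [lieCovector_eq_cartan (h.differentiableAt hy h.smooth_contactForm)
    (h.differentiableAt hy h.smooth_reeb), ← h.contact y hy, h.Φ_reeb y hy,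
    h.fderiv_eq_zero hy h.unit]
  simp

theorem fundamentalForm_skew (v w : E) : G y (Φ y v) w = -G y (Φ y w) v := by
  rw [h.skew y hy, h.symm y hy]

theorem two_mul_fderiv_fundamentalForm (z v w : E) :
    2 * fderiv ℝ β y z v w = fderiv ℝ (fderiv ℝ η) y z v w - fderiv ℝ (fderiv ℝ η) y z w v := by
  have hη := h.differentiableAt_fderiv hy h.smooth_contactForm
  have hω := h.differentiableAt hy h.smooth_fundamentalForm
  have hconst : ∀ {B : E → E →L[ℝ] E →L[ℝ] ℝ} (_ : DifferentiableAt ℝ B y) (v w : E),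
      fderiv ℝ (fun x => B x v w) y z = fderiv ℝ B y z v w := fun hB v w => by
    simp [fderiv_form_apply hB (differentiableAt_const v) (differentiableAt_const w)]
  have hcontact := h.fderiv_congr hy (h.contact · · v w)
  rw [fderiv_fun_sub (by fun_prop) (by fun_prop)] at hcontact
  rw [← hconst hω, ← hconst hη, ← hconst hη, ← sub_apply, ← hcontact, ← smul_eq_mul, ← smul_apply]
  exact congrArg (fun A : E →L[ℝ] ℝ => A z) (fderiv_const_mul
    ((hω.clm_apply (differentiableAt_const v)).clm_apply (differentiableAt_const w)) 2).symm

theorem fundamentalForm_closed (x v w : E) :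
    fderiv ℝ β y x v w = fderiv ℝ β y v x w - fderiv ℝ β y w x v := by
  have hsymm := h.isSymmSndFDerivAt hy h.smooth_contactForm
  have hx := h.two_mul_fderiv_fundamentalForm hy x v w
  have hv := h.two_mul_fderiv_fundamentalForm hy v x w
  have hw := h.two_mul_fderiv_fundamentalForm hy w x v
  rw [hsymm x v, hsymm x w] at hx
  rw [hsymm v w] at hv
  linarith

theorem lieForm_fundamentalForm {X : E → E} (hX : DifferentiableAt ℝ X y) (v w : E) :
    lieForm X β y v w = fderiv ℝ (fun x => G x (Φ x (X x))) y v w -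
      fderiv ℝ (fun x => G x (Φ x (X x))) y w v :=
  lieForm_eq_cartan (h.differentiableAt hy h.smooth_fundamentalForm) hX
    (h.fundamentalForm_skew hy) (h.fundamentalForm_closed hy (X y)) v w

theorem lieForm_reeb_fundamentalForm (v w : E) : lieForm ξ β y v w = 0 := by
  rw [h.lieForm_fundamentalForm hy (h.differentiableAt hy h.smooth_reeb),
    h.fderiv_eq_zero hy (c := 0) fun x hx => by rw [h.Φ_reeb x hx, map_zero]]
  simp

theorem metric_eq : G y = (G y (ξ y)).smulRight (G y (ξ y)) - (G y ∘L Φ y) ∘L Φ y := by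
  ext v w
  simp [h.Φ_sq y hy v]

theorem differentiableAt_contactForm_smulRight :
    DifferentiableAt ℝ (fun x => (G x (ξ x)).smulRight (G x (ξ x))) y := by
  have hη := h.differentiableAt hy h.smooth_contactForm
  exact (isBoundedBilinearMap_smulRight.differentiableAt (η y, η y)).comp
    (f := fun x => (η x, η x)) y (hη.prodMk hη)

/-- All constituents of `G = η ⊗ η - ω(Φ ·, ·)` are invariant under the Reeb flow. -/
theorem lieForm_reeb_metric : lieForm ξ G y = 0 := by
  have hη := h.differentiableAt hy h.smooth_contactForm
  have hω := h.differentiableAt hy h.smooth_fundamentalForm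
  have hΦ := h.differentiableAt hy h.smooth_Φ
  ext v w
  rw [lieForm_congr (Filter.eventuallyEq_of_mem (h.mem_nhds hy) fun x hx => h.metric_eq hx),
    lieForm_sub (h.differentiableAt_contactForm_smulRight hy) (hω.clm_comp hΦ),
    lieForm_smulRight hη hη, lieForm_comp hω hΦ, h.lieCovector_reeb_contactForm hy,
    h.lieForm_reeb_fundamentalForm hy, h.lie_Φ y hy]
  simp

section Gradient

variable {u : E → ℝ} {Z : E → E} (hu : ContDiffOn ℝ ∞ u T) (hZ : ContDiffOn ℝ ∞ Z T)
  (hgrad : ∀ y ∈ T, G y (Z y) = fderiv ℝ u y) (hbasic : ∀ y ∈ T, fderiv ℝ u y (ξ y) = 0)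
include hu hZ hgrad hbasic

theorem lieBracket_reeb_gradient : VectorField.lieBracket ℝ ξ Z y = 0 := by
  have hflat : ∀ w, G y (VectorField.lieBracket ℝ ξ Z y) w = 0 := fun w => by
    have hdu : lieCovector ξ (fun x => G x (Z x)) y w = lieCovector ξ (fderiv ℝ u) y w := by
      rw [lieCovector_apply, lieCovector_apply, h.fderiv_congr hy hgrad, hgrad y hy]
    rw [lieCovector_form_apply (h.differentiableAt hy h.smooth_metric) (h.differentiableAt hy hZ),
      h.lieForm_reeb_metric hy, lieCovector_eq_cartan (h.differentiableAt_fderiv hy hu)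
        (h.differentiableAt hy h.smooth_reeb), h.fderiv_eq_zero hy hbasic,
      h.isSymmSndFDerivAt hy hu, sub_self] at hdu
    simpa using hdu
  by_contra hne
  exact (h.pos y hy _ hne).ne' (hflat _)

theorem lieForm_Φ_gradient_fundamentalForm (v w : E) :
    lieForm (fun x => Φ x (Z x)) β y v w = 0 := by
  have hω : ∀ x ∈ T, G x (Φ x (Φ x (Z x))) = -fderiv ℝ u x := fun x hx => by
    rw [h.Φ_sq x hx, h.symm x hx, hgrad x hx, hbasic x hx, zero_smul, add_zero, map_neg,
      hgrad x hx]
  rw [h.lieForm_fundamentalForm hy ((h.differentiableAt hy h.smooth_Φ).clm_apply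
    (h.differentiableAt hy hZ)), h.fderiv_congr hy hω, fderiv_fun_neg, neg_apply, neg_apply,
    neg_apply, neg_apply, h.isSymmSndFDerivAt hy hu v w, sub_self]

omit hu in
theorem lieCovector_Φ_gradient_contactForm :
    lieCovector (fun x => Φ x (Z x)) η y = (-2 : ℝ) • fderiv ℝ u y := by
  ext w
  rw [lieCovector_eq_cartan (h.differentiableAt hy h.smooth_contactForm)
    ((h.differentiableAt hy h.smooth_Φ).clm_apply (h.differentiableAt hy hZ)), ← h.contact y hy,
    h.fderiv_eq_zero hy (c := 0) fun x hx => h.contactForm_Φ hx (Z x), h.Φ_sq y hy,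
    h.symm y hy (ξ y), hgrad y hy, hbasic y hy]
  simp [← hgrad y hy]

theorem lieForm_Φ_gradient (v w : E) :
    lieForm (fun x => Φ x (Z x)) (fun x => G x ∘L Φ x + (G x (ξ x)).smulRight (G x (ξ x)))
      y v w = -2 * (fderiv ℝ u y v * G y (ξ y) w + G y (ξ y) v * fderiv ℝ u y w) := by
  have hη := h.differentiableAt hy h.smooth_contactForm
  rw [lieForm_add (h.differentiableAt hy h.smooth_fundamentalForm)
    (h.differentiableAt_contactForm_smulRight hy), lieForm_smulRight hη hη,
    h.lieForm_Φ_gradient_fundamentalForm hy hu hZ hgrad hbasic,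
    h.lieCovector_Φ_gradient_contactForm hy hZ hgrad hbasic]
  simp only [neg_smul, neg_apply, smul_apply, smul_eq_mul, neg_mul, mul_neg, zero_add]
  ring

end Gradient

section Density

variable {ι : Type*} [Fintype ι] [DecidableEq ι] (e : Basis ι ℝ E)

theorem det_gramMatrix_metric_pos : 0 < (gramMatrix e (G y)).det :=
  (posDef_gramMatrix e (h.symm y hy) (h.pos y hy)).det_pos

/-- The form is `G(Ψ ·, ·)` for `Ψ = Φ + η ⊗ ξ`, which is a root of `Ψ⁴ = 1`. -/
theorem abs_det_gramMatrix_fundamentalForm_add :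
    |(gramMatrix e (G y ∘L Φ y + (G y (ξ y)).smulRight (G y (ξ y)))).det| =
      |(gramMatrix e (G y)).det| := by
  set Ψ : E →L[ℝ] E := Φ y + (G y (ξ y)).smulRight (ξ y) with hΨ
  have hform : G y ∘L Φ y + (G y (ξ y)).smulRight (G y (ξ y)) =
      (G y).bilinearComp Ψ (.id ℝ E) := by
    ext v w
    simp [hΨ]
  have hΨ_sq : ∀ v, Ψ (Ψ v) = -v + (2 * G y (ξ y) v) • ξ y := fun v => by
    simp only [hΨ, add_apply, ContinuousLinearMap.smulRight_apply, map_add, map_smul,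
      h.contactForm_Φ hy, h.Φ_reeb y hy, h.Φ_sq y hy, h.unit y hy]
    module
  have hΨ_pow : (Ψ : E →ₗ[ℝ] E) ^ 4 = 1 := by
    ext v
    change Ψ (Ψ (Ψ (Ψ v))) = v
    simp only [hΨ_sq, map_add, map_neg, map_smul, h.unit y hy]
    module
  have hdet : |Ψ.det| = 1 :=
    (pow_eq_one_iff_of_nonneg (abs_nonneg _) four_ne_zero).1 (by
      rw [← abs_pow, ContinuousLinearMap.det, ← map_pow, hΨ_pow, map_one, abs_one])
  rw [hform, det_gramMatrix_bilinearComp, abs_mul, abs_mul, hdet, one_mul]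
  simp [ContinuousLinearMap.det]

variable {ρ : E → ℝ} (hρ : ∀ y ∈ T, ρ y ^ 2 = (gramMatrix e (G y)).det)
include hρ

theorem divergence_reeb : divergence ρ ξ y = 0 := by
  have hdensity : ∀ᶠ x in 𝓝 y, ρ x ^ 2 = |(gramMatrix e (G x)).det| := by
    filter_upwards [h.mem_nhds hy] with x hx
    rw [hρ x hx, abs_of_pos (h.det_gramMatrix_metric_pos hx e)]
  rw [divergence_eq_half_trace e (C := 0) (fun v w => by simp [h.lieForm_reeb_metric hy])
    (h.differentiableAt hy h.smooth_metric) (h.det_gramMatrix_metric_pos hy e).ne' hdensity]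
  simp

variable [FiniteDimensional ℝ E] {u : E → ℝ} {Z : E → E} (hu : ContDiffOn ℝ ∞ u T)
  (hZ : ContDiffOn ℝ ∞ Z T)
  (hgrad : ∀ y ∈ T, G y (Z y) = fderiv ℝ u y) (hbasic : ∀ y ∈ T, fderiv ℝ u y (ξ y) = 0)
include hu hZ hgrad hbasic

theorem fderiv_divergence_gradient_reeb (hsmooth : ContDiffOn ℝ ∞ ρ T) :
    fderiv ℝ (divergence ρ Z) y (ξ y) = 0 := by
  have hbracket : VectorField.lieBracket ℝ ξ Z =ᶠ[𝓝 y] 0 :=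
    Filter.eventuallyEq_of_mem (h.mem_nhds hy) fun x hx =>
      h.lieBracket_reeb_gradient hx hu hZ hgrad hbasic
  have htwo : (2 : WithTop ℕ∞) ≤ ∞ := by norm_cast
  have h0 : ρ y ≠ 0 := fun h0 => (h.det_gramMatrix_metric_pos hy e).ne' (by
    rw [← hρ y hy, h0, zero_pow two_ne_zero])
  have hsmoothAt : ∀ {F : Type _} [NormedAddCommGroup F] [NormedSpace ℝ F] {f : E → F},
      ContDiffOn ℝ ∞ f T → ContDiffAt ℝ 2 f y := fun hf =>
    (hf.contDiffAt (h.mem_nhds hy)).of_le htwo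
  have hdiv := divergence_lieBracket ((hsmooth.contDiffAt (h.mem_nhds hy)).of_le htwo) h0
    (hsmoothAt h.smooth_reeb) (hsmoothAt hZ)
  rw [divergence_congr (Filter.EventuallyEq.refl _ ρ) hbracket,
    h.fderiv_eq_zero hy fun x hx => h.divergence_reeb hx e hρ] at hdiv
  simpa [divergence] using hdiv.symm

theorem divergence_Φ_gradient : divergence ρ (fun x => Φ x (Z x)) y = 0 := by
  have hdensity : ∀ᶠ x in 𝓝 y, ρ x ^ 2 =
      |(gramMatrix e (G x ∘L Φ x + (G x (ξ x)).smulRight (G x (ξ x)))).det| := by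
    filter_upwards [h.mem_nhds hy] with x hx
    rw [h.abs_det_gramMatrix_fundamentalForm_add hx, hρ x hx,
      abs_of_pos (h.det_gramMatrix_metric_pos hx e)]
  have hnondeg :
      (gramMatrix e (G y ∘L Φ y + (G y (ξ y)).smulRight (G y (ξ y)))).det ≠ 0 := by
    rw [← abs_ne_zero, h.abs_det_gramMatrix_fundamentalForm_add hy, abs_ne_zero]
    exact (h.det_gramMatrix_metric_pos hy e).ne'
  have hηZ : G y (ξ y) (Z y) = 0 := by rw [h.symm y hy, hgrad y hy, hbasic y hy]
  have hlie : ∀ v w, lieForm (fun x => Φ x (Z x))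
      (fun x => G x ∘L Φ x + (G x (ξ x)).smulRight (G x (ξ x))) y v w =
        (G y ∘L Φ y + (G y (ξ y)).smulRight (G y (ξ y)))
          (((-2 : ℝ) • ((fderiv ℝ u y).smulRight (ξ y) - (G y (ξ y)).smulRight (Φ y (Z y))) :
            E →L[ℝ] E) v) w := fun v w => by
    rw [h.lieForm_Φ_gradient hy hu hZ hgrad hbasic, ← hgrad y hy]
    simp only [neg_mul, neg_smul, neg_apply, smul_apply, sub_apply,
      ContinuousLinearMap.smulRight_apply, add_apply, ContinuousLinearMap.comp_apply, map_neg,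
      map_smul, map_sub, map_zero, h.Φ_reeb y hy, h.Φ_sq y hy, hηZ, zero_smul, add_zero, smul_neg,
      sub_neg_eq_add, zero_add, h.unit y hy, smul_eq_mul, h.contactForm_Φ hy]
    ring
  rw [divergence_eq_half_trace e hlie ((h.differentiableAt hy h.smooth_fundamentalForm).fun_add
    (h.differentiableAt_contactForm_smulRight hy)) hnondeg hdensity]
  simp [LinearMap.trace_smulRight, hbasic y hy, h.contactForm_Φ hy]

end Density

end IsLocalSasakian

end LocalSasakian

section LocalKahlerCone

variable {E : Type*} [NormedAddCommGroup E] [NormedSpace ℝ E]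

theorem lieEnd_apply_eq_lieBracket {X : E → E} {A : E → E →L[ℝ] E} {y : E}
    (hA : DifferentiableAt ℝ A y) (v : E) :
    lieEnd X A y v = VectorField.lieBracket ℝ X (fun x => A x v) y -
      A y (VectorField.lieBracket ℝ X (fun _ => v) y) := by
  simp [lieEnd_apply, VectorField.lieBracket_eq, fderiv_clm_apply_apply hA
    (differentiableAt_const v)]

/-- The Euler field `r ∂/∂r` of the cone in a product chart, where it is linear. -/
noncomputable def eulerMap (E : Type*) [NormedAddCommGroup E] [NormedSpace ℝ E] :
    E × ℝ →L[ℝ] E × ℝ :=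
  .inr ℝ E ℝ ∘L .snd ℝ E ℝ

@[simp]
theorem eulerMap_apply (z : E × ℝ) : eulerMap E z = (0, z.2) := rfl

/-- The cone metric `dr² + r² G` in a product chart. -/
noncomputable def coneForm (G : E → E →L[ℝ] E →L[ℝ] ℝ) (z : E × ℝ) :
    E × ℝ →L[ℝ] E × ℝ →L[ℝ] ℝ :=
  (ContinuousLinearMap.snd ℝ E ℝ).smulRight (ContinuousLinearMap.snd ℝ E ℝ) +
    z.2 ^ 2 • (G z.1).bilinearComp (.fst ℝ E ℝ) (.fst ℝ E ℝ)

theorem coneForm_apply (G : E → E →L[ℝ] E →L[ℝ] ℝ) (z v w : E × ℝ) :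
    coneForm G z v w = v.2 * w.2 + z.2 ^ 2 * G z.1 v.1 w.1 := rfl

theorem differentiableAt_coneForm {G : E → E →L[ℝ] E →L[ℝ] ℝ} {X : E × ℝ → E × ℝ} {z : E × ℝ}
    (hG : DifferentiableAt ℝ G z.1) (hX : DifferentiableAt ℝ X z) (w : E × ℝ) :
    DifferentiableAt ℝ (fun x => coneForm G x (X x) w) z :=
  (hX.snd.mul_const _).add ((differentiableAt_snd.pow 2).mul
    (((hG.comp z differentiableAt_fst).clm_apply hX.fst).clm_apply (differentiableAt_const _)))

/-- The identities satisfied by the metric `G` and the complex structure `J` of the cone of a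
Sasakian manifold in a product chart `T × ℝ_{>0}`. -/
structure IsLocalKahlerCone (T : Set E) (G : E → E →L[ℝ] E →L[ℝ] ℝ)
    (J : E × ℝ → E × ℝ →L[ℝ] E × ℝ) : Prop where
  isOpen : IsOpen T
  smooth_metric : ContDiffOn ℝ ∞ G T
  smooth_J : ContDiffOn ℝ ∞ J (T ×ˢ Set.Ioi 0)
  symm : ∀ y ∈ T, ∀ v w, G y v w = G y w v
  pos : ∀ y ∈ T, ∀ v, v ≠ 0 → 0 < G y v v
  J_sq : ∀ z ∈ T ×ˢ Set.Ioi 0, ∀ v, J z (J z v) = -v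
  skew : ∀ z ∈ T ×ˢ Set.Ioi 0, ∀ v w, coneForm G z (J z v) w = -coneForm G z v (J z w)
  lie_euler : ∀ z ∈ T ×ˢ Set.Ioi 0, lieEnd (eulerMap E) J z = 0
  nijenhuis : ∀ z ∈ T ×ˢ Set.Ioi 0, ∀ X Y : E × ℝ → E × ℝ, ContDiff ℝ ∞ X → ContDiff ℝ ∞ Y →
    VectorField.lieBracket ℝ (fun x => J x (X x)) (fun x => J x (Y x)) z
      - J z (VectorField.lieBracket ℝ (fun x => J x (X x)) Y z)
      - J z (VectorField.lieBracket ℝ X (fun x => J x (Y x)) z)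
      - VectorField.lieBracket ℝ X Y z = 0
  closed : ∀ z ∈ T ×ˢ Set.Ioi 0, ∀ v₁ v₂ v₃,
    fderiv ℝ (fun x => coneForm G x (J x v₂) v₃) z v₁
      + fderiv ℝ (fun x => coneForm G x (J x v₃) v₁) z v₂
      + fderiv ℝ (fun x => coneForm G x (J x v₁) v₂) z v₃ = 0

/-- The Reeb field `J(r ∂/∂r)` on the slice `r = 1`. -/
noncomputable def sliceReeb (J : E × ℝ → E × ℝ →L[ℝ] E × ℝ) (y : E) : E :=
  (J (y, 1) (0, 1)).1

/-- The component of the complex structure of the cone tangent to the slice `r = 1`. -/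
noncomputable def sliceEnd (J : E × ℝ → E × ℝ →L[ℝ] E × ℝ) (y : E) : E →L[ℝ] E :=
  .fst ℝ E ℝ ∘L J (y, 1) ∘L .inl ℝ E ℝ

theorem sliceEnd_apply (J : E × ℝ → E × ℝ →L[ℝ] E × ℝ) (y v : E) :
    sliceEnd J y v = (J (y, 1) (v, 0)).1 := rfl

theorem hasFDerivAt_slice {F : Type*} [NormedAddCommGroup F] [NormedSpace ℝ F] {f : E × ℝ → F}
    {y : E} {r : ℝ} (hf : DifferentiableAt ℝ f (y, r)) :
    HasFDerivAt (fun x => f (x, r)) (fderiv ℝ f (y, r) ∘L .inl ℝ E ℝ) y :=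
  hf.hasFDerivAt.comp y (hasFDerivAt_prodMk_left y r)

theorem hasDerivAt_ray {F : Type*} [NormedAddCommGroup F] [NormedSpace ℝ F] {f : E × ℝ → F}
    {y : E} {r : ℝ} (hf : DifferentiableAt ℝ f (y, r)) :
    HasDerivAt (fun t => f (y, t)) (fderiv ℝ f (y, r) (0, 1)) r :=
  hf.hasFDerivAt.comp_hasDerivAt r (hasFDerivAt_prodMk_right y r).hasDerivAt

theorem slice_mem {F : Type*} {T : Set F} {y : F} (hy : y ∈ T) :
    (y, (1 : ℝ)) ∈ T ×ˢ Set.Ioi (0 : ℝ) :=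
  ⟨hy, Set.mem_Ioi.2 one_pos⟩

namespace IsLocalKahlerCone

variable {T : Set E} {G : E → E →L[ℝ] E →L[ℝ] ℝ} {J : E × ℝ → E × ℝ →L[ℝ] E × ℝ}
  (h : IsLocalKahlerCone T G J)
include h

theorem differentiableAt_J {z : E × ℝ} (hz : z ∈ T ×ˢ Set.Ioi 0) : DifferentiableAt ℝ J z :=
  (h.smooth_J.contDiffAt ((h.isOpen.prod isOpen_Ioi).mem_nhds hz)).differentiableAt (by simp)

theorem lieEnd_J_euler {z : E × ℝ} (hz : z ∈ T ×ˢ Set.Ioi 0) :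
    lieEnd (fun x => J x (eulerMap E x)) J z = 0 := by
  refine ContinuousLinearMap.ext fun v => ?_
  have hlie := congrArg (fun A : E × ℝ →L[ℝ] E × ℝ => A v) (h.lie_euler z hz)
  simp only [lieEnd_apply_eq_lieBracket (h.differentiableAt_J hz), zero_apply, sub_eq_zero] at hlie
  have hnijenhuis :=
    h.nijenhuis z hz (eulerMap E) (fun _ => v) (eulerMap E).contDiff contDiff_const
  rw [hlie, h.J_sq z hz, sub_neg_eq_add, add_sub_cancel_right] at hnijenhuis
  rw [lieEnd_apply_eq_lieBracket (h.differentiableAt_J hz), hnijenhuis, zero_apply]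

theorem smooth_J_slice : ContDiffOn ℝ ∞ (fun y => J (y, 1)) T :=
  h.smooth_J.comp (contDiff_id.prodMk contDiff_const).contDiffOn
    fun _ hy => ⟨hy, Set.mem_Ioi.2 one_pos⟩

theorem differentiableAt_coneForm_J {z : E × ℝ} (hz : z ∈ T ×ˢ Set.Ioi 0) (v w : E × ℝ) :
    DifferentiableAt ℝ (fun x => coneForm G x (J x v) w) z :=
  differentiableAt_coneForm ((h.smooth_metric.contDiffAt (h.isOpen.mem_nhds hz.1)).differentiableAt
    (by simp)) ((h.differentiableAt_J hz).clm_apply (differentiableAt_const v)) w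

variable {y : E} (hy : y ∈ T)
include hy

theorem J_euler_slice : J (y, 1) (0, 1) = (sliceReeb J y, 0) := by
  have hskew := h.skew _ (slice_mem hy) (0, 1) (0, 1)
  simp only [coneForm_apply, map_zero, zero_apply] at hskew
  exact Prod.ext rfl (by simp only; linarith)

theorem J_reeb_slice : J (y, 1) (sliceReeb J y, 0) = (0, -1) := by
  rw [← h.J_euler_slice hy, h.J_sq _ (slice_mem hy)]
  simp

theorem J_slice (v : E) : J (y, 1) (v, 0) =
    (sliceEnd J y v, 0) - G y (sliceReeb J y) v • ((0, 1) : E × ℝ) := by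
  have hskew := h.skew _ (slice_mem hy) (v, 0) (0, 1)
  simp only [coneForm_apply, h.J_euler_slice hy] at hskew
  refine Prod.ext (by simp [sliceEnd_apply]) ?_
  simpa [h.symm y hy v] using hskew

theorem fderiv_J_euler_radial :
    fderiv ℝ (fun x => J x (eulerMap E x)) (y, 1) (0, 1) = 0 := by
  have hlie := congrArg (fun A : E × ℝ →L[ℝ] E × ℝ => A (0, 1)) (h.lie_euler _ (slice_mem hy))
  rw [fderiv_clm_apply_apply (h.differentiableAt_J (slice_mem hy))
    (eulerMap E).differentiableAt]
  simpa [lieEnd_apply, h.J_euler_slice hy, Prod.mk_zero_zero] using hlie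

theorem fderiv_J_radial (v : E) :
    fderiv ℝ J (y, 1) (0, 1) (v, 0) = (0, -G y (sliceReeb J y) v) := by
  have hlie := congrArg (fun A : E × ℝ →L[ℝ] E × ℝ => A (v, 0)) (h.lie_euler _ (slice_mem hy))
  simpa [lieEnd_apply, h.J_slice hy, Prod.mk_zero_zero, sub_eq_zero] using hlie

theorem differentiableAt_sliceReeb : DifferentiableAt ℝ (sliceReeb J) y :=
  ((h.smooth_J_slice.contDiffAt (h.isOpen.mem_nhds hy)).differentiableAt (by simp)).clm_apply
    (differentiableAt_const _) |>.fst

theorem fderiv_J_euler_slice (v : E) :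
    fderiv ℝ (fun x => J x (eulerMap E x)) (y, 1) (v, 0) = (fderiv ℝ (sliceReeb J) y v, 0) := by
  have hslice := hasFDerivAt_slice
    ((h.differentiableAt_J (slice_mem hy)).clm_apply (eulerMap E).differentiableAt)
  have hvalue : (fun x => J (x, 1) (eulerMap E (x, 1))) =ᶠ[𝓝 y] fun x => (sliceReeb J x, 0) := by
    filter_upwards [h.isOpen.mem_nhds hy] with x hx using h.J_euler_slice hx
  have hpair := (h.differentiableAt_sliceReeb hy).hasFDerivAt.prodMk (hasFDerivAt_const (0 : ℝ) y)
  exact congrArg (fun A : E →L[ℝ] E × ℝ => A v)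
    ((hslice.congr_of_eventuallyEq hvalue.symm).unique hpair)

theorem fderiv_sliceEnd (v w : E) :
    fderiv ℝ (sliceEnd J) y v w = (fderiv ℝ J (y, 1) (v, 0) (w, 0)).1 := by
  have hJ := hasFDerivAt_slice (h.differentiableAt_J (slice_mem hy))
  have hEnd := (hasFDerivAt_const (ContinuousLinearMap.fst ℝ E ℝ) y).clm_comp
    (hJ.clm_comp (hasFDerivAt_const (ContinuousLinearMap.inl ℝ E ℝ) y))
  rw [show fderiv ℝ (sliceEnd J) y = _ from hEnd.fderiv]
  simp

theorem lieEnd_reeb : lieEnd (sliceReeb J) (sliceEnd J) y = 0 := by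
  ext v
  have hlie := congrArg (fun A : E × ℝ →L[ℝ] E × ℝ => (A (v, 0)).1)
    (h.lieEnd_J_euler (slice_mem hy))
  simp only [lieEnd_apply, h.J_slice hy, map_sub, map_smul, h.fderiv_J_euler_slice hy,
    h.fderiv_J_euler_radial hy, smul_zero, sub_zero] at hlie
  simpa [lieEnd_apply, h.fderiv_sliceEnd hy, h.J_euler_slice hy] using hlie

theorem fderiv_coneForm_radial (v w : E) :
    fderiv ℝ (fun x => coneForm G x (J x (v, 0)) (w, 0)) (y, 1) (0, 1) =
      2 * G y (sliceEnd J y v) w := by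
  have hJ : HasDerivAt (fun t => J (y, t) (v, 0)) (0, -G y (sliceReeb J y) v) 1 := by
    have hray := (hasDerivAt_ray (h.differentiableAt_J (slice_mem hy))).clm_apply
      (hasDerivAt_const 1 (v, (0 : ℝ)))
    simpa [h.fderiv_J_radial hy] using hray
  have hvalue : HasDerivAt (fun t : ℝ => t ^ 2 * G y (J (y, t) (v, 0)).1 w)
      (2 * G y (sliceEnd J y v) w) 1 := by
    have hG := (((G y).flip w) ∘L (.fst ℝ E ℝ)).hasFDerivAt.comp_hasDerivAt 1 hJ
    simpa [sliceEnd_apply, Function.comp_def] using (hasDerivAt_pow 2 (1 : ℝ)).fun_mul hG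
  rw [← (hasDerivAt_ray (h.differentiableAt_coneForm_J (slice_mem hy) _ _)).deriv]
  simpa [coneForm_apply] using hvalue.deriv

theorem fderiv_contactForm_apply (v w : E) :
    fderiv ℝ (fun x => G x (sliceReeb J x) w) y v =
      fderiv ℝ (fun x => G x (sliceReeb J x)) y v w := by
  have hη : DifferentiableAt ℝ (fun x => G x (sliceReeb J x)) y :=
    ((h.smooth_metric.contDiffAt (h.isOpen.mem_nhds hy)).differentiableAt (by simp)).clm_apply
      (h.differentiableAt_sliceReeb hy)
  simp [fderiv_clm_apply_apply hη (differentiableAt_const w)]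

theorem fderiv_coneForm_slice (v w : E) :
    fderiv ℝ (fun x => coneForm G x (J x (w, 0)) (0, 1)) (y, 1) (v, 0) =
      -fderiv ℝ (fun x => G x (sliceReeb J x)) y v w := by
  have hvalue : (fun x => coneForm G (x, 1) (J (x, 1) (w, 0)) (0, 1)) =ᶠ[𝓝 y]
      fun x => -G x (sliceReeb J x) w := by
    filter_upwards [h.isOpen.mem_nhds hy] with x hx
    simp [coneForm_apply, h.J_slice hx]
  have hslice := hasFDerivAt_slice (h.differentiableAt_coneForm_J (slice_mem hy) (w, 0) (0, 1))
  rw [← h.fderiv_contactForm_apply hy]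
  simpa [hvalue.fderiv_eq] using congrArg (fun A : E →L[ℝ] ℝ => A v) hslice.fderiv.symm

theorem fderiv_coneForm_euler_slice (v w : E) :
    fderiv ℝ (fun x => coneForm G x (J x (0, 1)) (w, 0)) (y, 1) (v, 0) =
      fderiv ℝ (fun x => G x (sliceReeb J x)) y v w := by
  have hvalue : (fun x => coneForm G (x, 1) (J (x, 1) (0, 1)) (w, 0)) =ᶠ[𝓝 y]
      fun x => G x (sliceReeb J x) w := by
    filter_upwards [h.isOpen.mem_nhds hy] with x hx
    simp [coneForm_apply, h.J_euler_slice hx]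
  have hslice := hasFDerivAt_slice (h.differentiableAt_coneForm_J (slice_mem hy) (0, 1) (w, 0))
  rw [← h.fderiv_contactForm_apply hy]
  simpa [hvalue.fderiv_eq] using congrArg (fun A : E →L[ℝ] ℝ => A v) hslice.fderiv.symm

theorem contact (v w : E) :
    2 * G y (sliceEnd J y v) w = fderiv ℝ (fun x => G x (sliceReeb J x)) y v w -
      fderiv ℝ (fun x => G x (sliceReeb J x)) y w v := by
  have hclosed := h.closed _ (slice_mem hy) (0, 1) (v, 0) (w, 0)
  rw [h.fderiv_coneForm_radial hy, h.fderiv_coneForm_slice hy,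
    h.fderiv_coneForm_euler_slice hy] at hclosed
  linarith

omit hy in
theorem isLocalSasakian : IsLocalSasakian T G (sliceReeb J) (sliceEnd J) where
  isOpen := h.isOpen
  smooth_metric := h.smooth_metric
  smooth_reeb := (h.smooth_J_slice.clm_apply contDiffOn_const).fst
  smooth_Φ := contDiffOn_const.clm_comp (h.smooth_J_slice.clm_comp contDiffOn_const)
  symm := h.symm
  pos := h.pos
  skew y hy v w := by
    simpa [coneForm_apply, sliceEnd_apply] using h.skew _ (slice_mem hy) (v, 0) (w, 0)
  unit y hy := by
    simpa [h.J_reeb_slice hy, eq_comm] using congrArg Prod.snd (h.J_slice hy (sliceReeb J y))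
  Φ_reeb y hy := by rw [sliceEnd_apply, h.J_reeb_slice hy]
  Φ_sq y hy v := by
    have hsq := congrArg Prod.fst (h.J_sq _ (slice_mem hy) (v, 0))
    rw [h.J_slice hy v, map_sub, map_smul, h.J_slice hy, h.J_euler_slice hy] at hsq
    simpa [sub_eq_iff_eq_add] using hsq
  contact _ hy := h.contact hy
  lie_Φ _ hy := h.lieEnd_reeb hy

end IsLocalKahlerCone

end LocalKahlerCone

/-! ### Passing to charts -/

section Chart

open VectorField

theorem forall_of_forall_chart {E H M : Type*} [NormedAddCommGroup E] [NormedSpace ℝ E]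
    [TopologicalSpace H] (I : ModelWithCorners ℝ E H) [TopologicalSpace M] [ChartedSpace H M]
    {P : M → Prop} (h : ∀ c, ∀ y ∈ (extChartAt I c).target, P ((extChartAt I c).symm y)) (p : M) :
    P p :=
  extChartAt_to_inv (I := I) p ▸ h p _ (mem_extChartAt_target p)

variable {E : Type*} [NormedAddCommGroup E] [NormedSpace ℝ E]
  {H : Type*} [TopologicalSpace H] {I : ModelWithCorners ℝ E H}
  {M : Type*} [TopologicalSpace M] [ChartedSpace H M] [IsManifold I ∞ M]

/-- The differential of the inverse of the chart at `c`, at the point with coordinates `y`. -/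
noncomputable def chartDeriv (I : ModelWithCorners ℝ E H) (c : M) (y : E) :
    E →L[ℝ] TangentSpace I ((extChartAt I c).symm y) :=
  mfderiv 𝓘(ℝ, E) I (extChartAt I c).symm y

/-- The differential of the chart at `c`, at the point with coordinates `y`. -/
noncomputable def chartDerivInv (I : ModelWithCorners ℝ E H) (c : M) (y : E) :
    TangentSpace I ((extChartAt I c).symm y) →L[ℝ] E :=
  mfderiv I 𝓘(ℝ, E) (extChartAt I c) ((extChartAt I c).symm y)

/-- The components in the chart at `c` of a vector field on a manifold. -/
noncomputable def fieldInChart (I : ModelWithCorners ℝ E H) (c : M) (V : ∀ x : M, TangentSpace I x)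
    (y : E) : E :=
  chartDerivInv I c y (V ((extChartAt I c).symm y))

/-- The vector field on a manifold given in the chart at `c` by `X`. -/
noncomputable def chartField (I : ModelWithCorners ℝ E H) (c : M) (X : E → E) (x : M) :
    TangentSpace I x :=
  mpullback I 𝓘(ℝ, E) (extChartAt I c) (fun y => (X y : TangentSpace 𝓘(ℝ, E) y)) x

variable [I.Boundaryless] {c : M} {y : E}

theorem contMDiffAt_chart_symm (hy : y ∈ (extChartAt I c).target) :
    ContMDiffAt 𝓘(ℝ, E) I ∞ (extChartAt I c).symm y :=
  (contMDiffOn_extChartAt_symm c).contMDiffAt ((isOpen_extChartAt_target c).mem_nhds hy)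

theorem chartDeriv_chartDerivInv (hy : y ∈ (extChartAt I c).target)
    (v : TangentSpace I ((extChartAt I c).symm y)) :
    chartDeriv I c y (chartDerivInv I c y v) = v := by
  have hcomp := mfderivWithin_extChartAt_symm_comp_mfderiv_extChartAt (I := I) hy
  rw [I.range_eq_univ, mfderivWithin_univ] at hcomp
  exact congrArg (fun L => L v) hcomp

theorem chartDerivInv_chartDeriv (hy : y ∈ (extChartAt I c).target) (v : E) :
    chartDerivInv I c y (chartDeriv I c y v) = v := by
  have hcomp := mfderiv_extChartAt_comp_mfderivWithin_extChartAt_symm (I := I) hy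
  rw [I.range_eq_univ, mfderivWithin_univ] at hcomp
  exact congrArg (fun L => L v) hcomp

theorem chartDeriv_injective (hy : y ∈ (extChartAt I c).target) :
    Function.Injective (chartDeriv I c y) :=
  Function.LeftInverse.injective (chartDerivInv_chartDeriv hy)

theorem chartDeriv_fieldInChart (hy : y ∈ (extChartAt I c).target)
    (V : ∀ x : M, TangentSpace I x) :
    chartDeriv I c y (fieldInChart I c V y) = V ((extChartAt I c).symm y) :=
  chartDeriv_chartDerivInv hy _

theorem mpullback_chart_symm (hy : y ∈ (extChartAt I c).target)
    (V : ∀ x : M, TangentSpace I x) :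
    mpullback 𝓘(ℝ, E) I (extChartAt I c).symm V y = fieldInChart I c V y := by
  have h : (mfderiv 𝓘(ℝ, E) I (extChartAt I c).symm y).inverse = chartDerivInv I c y :=
    ContinuousLinearMap.inverse_eq
      (ContinuousLinearMap.ext fun v => chartDeriv_chartDerivInv (I := I) hy v)
      (ContinuousLinearMap.ext fun v => chartDerivInv_chartDeriv (I := I) hy v)
  exact congrArg (fun L : TangentSpace I ((extChartAt I c).symm y) →L[ℝ] E => L (V _)) h

theorem chartField_apply (hy : y ∈ (extChartAt I c).target) (X : E → E) :
    chartField I c X ((extChartAt I c).symm y) = chartDeriv I c y (X y) := by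
  have h : (mfderiv I 𝓘(ℝ, E) (extChartAt I c) ((extChartAt I c).symm y)).inverse =
      chartDeriv I c y :=
    ContinuousLinearMap.inverse_eq
      (ContinuousLinearMap.ext fun v => chartDerivInv_chartDeriv (I := I) hy v)
      (ContinuousLinearMap.ext fun v => chartDeriv_chartDerivInv (I := I) hy v)
  have h2 := congrArg (fun L : E →L[ℝ] TangentSpace I ((extChartAt I c).symm y) =>
    L (X (extChartAt I c ((extChartAt I c).symm y)))) h
  refine h2.trans ?_
  rw [(extChartAt I c).right_inv hy]

theorem fieldInChart_chartField (hy : y ∈ (extChartAt I c).target) (X : E → E) :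
    fieldInChart I c (chartField I c X) y = X y := by
  apply chartDeriv_injective (I := I) hy
  rw [chartDeriv_fieldInChart hy, chartField_apply hy]

omit [I.Boundaryless] in
theorem contMDiffAt_chartField [CompleteSpace E] (hy : y ∈ (extChartAt I c).target) {X : E → E}
    (hX : ContDiffAt ℝ ∞ X y) :
    ContMDiffAt I I.tangent ∞ (fun x => (⟨x, chartField I c X x⟩ : TangentBundle I M))
      ((extChartAt I c).symm y) := by
  have hs : (extChartAt I c).symm y ∈ (extChartAt I c).source := (extChartAt I c).map_target hy
  refine ContMDiffAt.mpullback_vectorField_preimage (n := ∞) ?_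
    (contMDiffAt_extChartAt' (by rwa [← extChartAt_source I])) (isInvertible_mfderiv_extChartAt hs)
    (by simp)
  rw [(extChartAt I c).right_inv hy]
  exact contMDiffAt_vectorSpace_iff_contDiffAt.2 hX

theorem contDiffAt_fieldInChart [CompleteSpace E] (hy : y ∈ (extChartAt I c).target)
    {V : ∀ x : M, TangentSpace I x}
    (hV : ContMDiffAt I I.tangent ∞ (fun x => (⟨x, V x⟩ : TangentBundle I M))
      ((extChartAt I c).symm y)) :
    ContDiffAt ℝ ∞ (fieldInChart I c V) y := by
  have hi : (mfderiv 𝓘(ℝ, E) I (extChartAt I c).symm y).IsInvertible := by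
    have := isInvertible_mfderivWithin_extChartAt_symm (I := I) hy
    rwa [I.range_eq_univ, mfderivWithin_univ] at this
  have h := contMDiffAt_vectorSpace_iff_contDiffAt.1
    (ContMDiffAt.mpullback_vectorField_preimage (n := ∞) hV (contMDiffAt_chart_symm hy) hi
      (by simp))
  refine h.congr_of_eventuallyEq ?_
  filter_upwards [(isOpen_extChartAt_target c).mem_nhds hy] with z hz
  exact (mpullback_chart_symm hz V).symm

theorem mlieBracket_vectorSpace (X Y : ∀ y : E, TangentSpace 𝓘(ℝ, E) y) (y : E) :
    mlieBracket 𝓘(ℝ, E) X Y y = lieBracket ℝ X Y y := by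
  rw [← mlieBracketWithin_univ, mlieBracketWithin_eq_lieBracketWithin]
  exact congrFun lieBracketWithin_univ y

theorem mlieBracket_chart [CompleteSpace E] (hy : y ∈ (extChartAt I c).target)
    {V W : ∀ x : M, TangentSpace I x}
    (hV : ContMDiffAt I I.tangent ∞ (fun x => (⟨x, V x⟩ : TangentBundle I M))
      ((extChartAt I c).symm y))
    (hW : ContMDiffAt I I.tangent ∞ (fun x => (⟨x, W x⟩ : TangentBundle I M))
      ((extChartAt I c).symm y)) {X Y : E → E}
    (hX : ∀ z ∈ (extChartAt I c).target, fieldInChart I c V z = X z)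
    (hY : ∀ z ∈ (extChartAt I c).target, fieldInChart I c W z = Y z) :
    mlieBracket I V W ((extChartAt I c).symm y) =
      chartDeriv I c y (lieBracket ℝ X Y y) := by
  have : IsManifold I (minSmoothness ℝ 2) M :=
    IsManifold.of_le (n := ∞) (by simp; norm_cast)
  have h := mpullback_mlieBracket (I := 𝓘(ℝ, E)) (I' := I) (n := ∞)
    (hV.mdifferentiableAt (by simp)) (hW.mdifferentiableAt (by simp))
    (contMDiffAt_chart_symm hy) (by simp; norm_cast)
  rw [← chartDeriv_fieldInChart (I := I) hy (mlieBracket I V W), ← mpullback_chart_symm hy, h]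
  congr 1
  have hT := (isOpen_extChartAt_target (I := I) c).mem_nhds hy
  have hX' : mpullback 𝓘(ℝ, E) I (extChartAt I c).symm V =ᶠ[nhds y] X := by
    filter_upwards [hT] with z hz
    exact (mpullback_chart_symm hz V).trans (hX z hz)
  have hY' : mpullback 𝓘(ℝ, E) I (extChartAt I c).symm W =ᶠ[nhds y] Y := by
    filter_upwards [hT] with z hz
    exact (mpullback_chart_symm hz W).trans (hY z hz)
  exact (hX'.mlieBracket_vectorField_eq hY').trans (mlieBracket_vectorSpace X Y y)

theorem fderiv_comp_chart_symm {F : Type*} [NormedAddCommGroup F] [NormedSpace ℝ F]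
    (hy : y ∈ (extChartAt I c).target) {f : M → F}
    (hf : MDifferentiableAt I 𝓘(ℝ, F) f ((extChartAt I c).symm y)) (v : E) :
    fderiv ℝ (fun z => f ((extChartAt I c).symm z)) y v =
      mfderiv I 𝓘(ℝ, F) f ((extChartAt I c).symm y) (chartDeriv I c y v) := by
  have h := mfderiv_comp (I := 𝓘(ℝ, E)) (I' := I) (I'' := 𝓘(ℝ, F)) y hf
    ((contMDiffAt_chart_symm (I := I) hy).mdifferentiableAt (by simp))
  rw [mfderiv_eq_fderiv] at h
  exact congrArg (fun L : E →L[ℝ] F => L v) h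

omit [I.Boundaryless] in
theorem mdifferentiableAt_of_comp_chart_symm {F : Type*} [NormedAddCommGroup F] [NormedSpace ℝ F]
    (hy : y ∈ (extChartAt I c).target) {f : M → F}
    (hf : DifferentiableAt ℝ (fun z => f ((extChartAt I c).symm z)) y) :
    MDifferentiableAt I 𝓘(ℝ, F) f ((extChartAt I c).symm y) := by
  have hs := (extChartAt I c).map_target hy
  have hchart : MDifferentiableAt I 𝓘(ℝ, E) (extChartAt I c) ((extChartAt I c).symm y) :=
    (contMDiffAt_extChartAt' (n := ∞) (by rwa [← extChartAt_source I])).mdifferentiableAt (by simp)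
  have hf' : MDifferentiableAt 𝓘(ℝ, E) 𝓘(ℝ, F) (fun z => f ((extChartAt I c).symm z))
      (extChartAt I c ((extChartAt I c).symm y)) := by
    rw [(extChartAt I c).right_inv hy]
    exact hf.mdifferentiableAt
  refine (hf'.comp _ hchart).congr_of_eventuallyEq ?_
  filter_upwards [(isOpen_extChartAt_source (I := I) c).mem_nhds hs] with x hx
  rw [Function.comp_apply, (extChartAt I c).left_inv hx]

end Chart

section ConeChart

theorem posReals_extChartAt_source (r : posReals) : (extChartAt 𝓘(ℝ, ℝ) r).source = Set.univ := by
  rw [extChartAt_source]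
  change ((chartAt ℝ (r : ℝ)).subtypeRestr ⟨r⟩).source = _
  rw [OpenPartialHomeomorph.subtypeRestr_source, chartAt_self_eq]
  rfl

theorem posReals_extChartAt_target (r : posReals) :
    (extChartAt 𝓘(ℝ, ℝ) r).target = Set.Ioi 0 := by
  refine Set.Subset.antisymm (fun t ht => ?_) fun t ht => ?_
  · have hval : (((extChartAt 𝓘(ℝ, ℝ) r).symm t : posReals) : ℝ) = t :=
      (extChartAt 𝓘(ℝ, ℝ) r).right_inv ht
    exact hval ▸ ((extChartAt 𝓘(ℝ, ℝ) r).symm t).2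
  · exact (extChartAt 𝓘(ℝ, ℝ) r).map_source (x := ⟨t, ht⟩)
      (by rw [posReals_extChartAt_source]; trivial)

theorem posReals_extChartAt_symm (r : posReals) {t : ℝ} (ht : 0 < t) :
    (extChartAt 𝓘(ℝ, ℝ) r).symm t = ⟨t, ht⟩ :=
  (extChartAt 𝓘(ℝ, ℝ) r).left_inv (x := ⟨t, ht⟩) (by rw [posReals_extChartAt_source]; trivial)

theorem posReals_chartDeriv (r : posReals) {t : ℝ} (ht : 0 < t) (a : ℝ) :
    chartDeriv 𝓘(ℝ, ℝ) r t a = a := by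
  have hdiff : MDifferentiableAt 𝓘(ℝ, ℝ) 𝓘(ℝ, ℝ) (extChartAt 𝓘(ℝ, ℝ) r).symm t :=
    (contMDiffAt_chart_symm ((posReals_extChartAt_target r).ge ht)).mdifferentiableAt (by simp)
  have hid : writtenInExtChartAt 𝓘(ℝ, ℝ) 𝓘(ℝ, ℝ) t (extChartAt 𝓘(ℝ, ℝ) r).symm =ᶠ[𝓝 t] id := by
    filter_upwards [Ioi_mem_nhds ht] with s hs
    simp only [writtenInExtChartAt, extChartAt_model_space_eq_id, PartialEquiv.refl_symm,
      PartialEquiv.refl_coe, Function.comp_id, Function.comp_apply, id]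
    change (((extChartAt 𝓘(ℝ, ℝ) r).symm s : posReals) : ℝ) = s
    rw [posReals_extChartAt_symm r hs]
  rw [chartDeriv, hdiff.mfderiv, ModelWithCorners.range_eq_univ, fderivWithin_univ]
  exact congrArg (fun L : ℝ →L[ℝ] ℝ => L a) ((hid.fderiv_eq (𝕜 := ℝ)).trans fderiv_id)

variable {n : ℕ} {S : Type*} [TopologicalSpace S] [ChartedSpace (EuclideanSpace ℝ (Fin n)) S]

local notation "𝔼" => EuclideanSpace ℝ (Fin n)

theorem cone_extChartAt_target (c : S) :
    (extChartAt (coneModel n) (atOne c)).target = (extChartAt (𝓡 n) c).target ×ˢ Set.Ioi 0 := by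
  rw [extChartAt_prod, PartialEquiv.prod_target]
  exact congrArg _ (posReals_extChartAt_target _)

theorem cone_extChartAt_symm (c : S) {z : 𝔼 × ℝ} (hz : 0 < z.2) :
    (extChartAt (coneModel n) (atOne c)).symm z = ((extChartAt (𝓡 n) c).symm z.1, ⟨z.2, hz⟩) := by
  rw [← posReals_extChartAt_symm (atOne c).2 hz]
  rfl

theorem cone_extChartAt_symm_slice (c : S) (y : 𝔼) :
    (extChartAt (coneModel n) (atOne c)).symm (y, 1) = atOne ((extChartAt (𝓡 n) c).symm y) :=
  cone_extChartAt_symm c (z := (y, 1)) one_pos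

variable [IsManifold (𝓡 n) ∞ S]

theorem cone_chartDeriv {c : S} {z : 𝔼 × ℝ}
    (hz : z ∈ (extChartAt (𝓡 n) c).target ×ˢ Set.Ioi (0 : ℝ)) (v : 𝔼 × ℝ) :
    chartDeriv (coneModel n) (atOne c) z v =
      coneVec ((extChartAt (coneModel n) (atOne c)).symm z) (chartDeriv (𝓡 n) c z.1 v.1) v.2 := by
  have hbase : MDifferentiableAt 𝓘(ℝ, 𝔼) (𝓡 n) (extChartAt (𝓡 n) c).symm z.1 :=
    (contMDiffAt_chart_symm hz.1).mdifferentiableAt (by simp)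
  have hradial : MDifferentiableAt 𝓘(ℝ, ℝ) 𝓘(ℝ, ℝ) (extChartAt 𝓘(ℝ, ℝ) (atOne c).2).symm z.2 :=
    (contMDiffAt_chart_symm ((posReals_extChartAt_target _).ge hz.2)).mdifferentiableAt (by simp)
  have hprod : chartDeriv (coneModel n) (atOne c) z v =
      mfderiv (𝓘(ℝ, 𝔼).prod 𝓘(ℝ, ℝ)) (coneModel n)
        (Prod.map (extChartAt (𝓡 n) c).symm (extChartAt 𝓘(ℝ, ℝ) (atOne c).2).symm) z v := by
    rw [chartDeriv, modelWithCornersSelf_prod, ← chartedSpaceSelf_prod]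
    rfl
  have hmap := congrArg (fun L => L v) (mfderiv_prodMap (p := z) hbase hradial)
  refine hprod.trans (hmap.trans ?_)
  refine Prod.ext rfl ?_
  exact posReals_chartDeriv _ hz.2 v.2

end ConeChart

section MetricInChart

variable {n : ℕ} {S : Type*} [TopologicalSpace S] [ChartedSpace (EuclideanSpace ℝ (Fin n)) S]
  [IsManifold (𝓡 n) ∞ S]

local notation "𝔼" => EuclideanSpace ℝ (Fin n)

/-- The components in the chart at `c` of a Riemannian metric, as a field of bilinear forms. -/
noncomputable def metricInChart (g : Metric n S) (c : S) (y : EuclideanSpace ℝ (Fin n)) :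
    EuclideanSpace ℝ (Fin n) →L[ℝ] EuclideanSpace ℝ (Fin n) →L[ℝ] ℝ :=
  ContinuousLinearMap.bilinearComp
    (@id (𝔼 →L[ℝ] 𝔼 →L[ℝ] ℝ) (g.inner ((extChartAt (𝓡 n) c).symm y)))
    (@id (𝔼 →L[ℝ] 𝔼) (chartDeriv (𝓡 n) c y)) (@id (𝔼 →L[ℝ] 𝔼) (chartDeriv (𝓡 n) c y))

theorem metricInChart_apply (g : Metric n S) (c : S) (y v w : 𝔼) :
    metricInChart g c y v w = g.inner ((extChartAt (𝓡 n) c).symm y)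
      (chartDeriv (𝓡 n) c y v) (chartDeriv (𝓡 n) c y w) := rfl

theorem gram_eq_gramMatrix (g : Metric n S) (c : S) (y : 𝔼) :
    gram g c y = gramMatrix (EuclideanSpace.basisFun (Fin n) ℝ).toBasis (metricInChart g c y) := by
  ext i j
  rw [gramMatrix_apply, OrthonormalBasis.coe_toBasis, EuclideanSpace.basisFun_apply,
    EuclideanSpace.basisFun_apply]
  rfl

theorem contDiffOn_metricInChart (g : Metric n S) (c : S) :
    ContDiffOn ℝ ∞ (metricInChart g c) (extChartAt (𝓡 n) c).target := by
  refine contDiffOn_clm_apply.2 fun v => contDiffOn_clm_apply.2 fun w y hy => ?_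
  have hsymm : ContMDiffAt 𝓘(ℝ, 𝔼) (𝓡 n) ∞ (extChartAt (𝓡 n) c).symm y :=
    contMDiffAt_chart_symm hy
  have hfield : ∀ v : 𝔼, ContMDiffAt 𝓘(ℝ, 𝔼) (𝓡 n).tangent ∞ (fun z =>
      (⟨(extChartAt (𝓡 n) c).symm z, chartField (𝓡 n) c (fun _ => v)
        ((extChartAt (𝓡 n) c).symm z)⟩ : TangentBundle (𝓡 n) S)) y := fun v =>
    ContMDiffAt.comp y (contMDiffAt_chartField hy contDiffAt_const) hsymm
  have hmetric : ContMDiffAt 𝓘(ℝ, 𝔼) ((𝓡 n).prod 𝓘(ℝ, 𝔼 →L[ℝ] 𝔼 →L[ℝ] ℝ)) ∞ (fun z =>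
      Bundle.TotalSpace.mk' (𝔼 →L[ℝ] 𝔼 →L[ℝ] ℝ)
        (E := fun p : S => TangentSpace (𝓡 n) p →L[ℝ] TangentSpace (𝓡 n) p →L[ℝ] ℝ)
        ((extChartAt (𝓡 n) c).symm z) (g.inner ((extChartAt (𝓡 n) c).symm z))) y :=
    ContMDiffAt.comp y (g.contMDiff _) hsymm
  have hpair := ContMDiffAt.clm_bundle_apply₂ (F₁ := 𝔼) (F₂ := 𝔼) (E₃ := Bundle.Trivial S ℝ)
    hmetric (hfield v) (hfield w)
  rw [Bundle.contMDiffAt_totalSpace] at hpair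
  refine ((contMDiffAt_iff_contDiffAt.1 hpair.2).congr_of_eventuallyEq ?_).contDiffWithinAt
  filter_upwards [(isOpen_extChartAt_target c).mem_nhds hy] with z hz
  simp only [chartField_apply hz, metricInChart_apply]
  rfl

theorem metricInChart_symm (g : Metric n S) (c : S) (y v w : 𝔼) :
    metricInChart g c y v w = metricInChart g c y w v := g.symm _ _ _

theorem metricInChart_pos (g : Metric n S) {c : S} {y : 𝔼} (hy : y ∈ (extChartAt (𝓡 n) c).target)
    (v : 𝔼) (hv : v ≠ 0) : 0 < metricInChart g c y v v :=
  g.pos _ _ fun h => hv (chartDeriv_injective (I := 𝓡 n) hy (h.trans (map_zero _).symm))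

theorem coneMetric_chartDeriv (g : Metric n S) {c : S} {z : 𝔼 × ℝ}
    (hz : z ∈ (extChartAt (𝓡 n) c).target ×ˢ Set.Ioi (0 : ℝ)) (v w : 𝔼 × ℝ) :
    coneMetric g ((extChartAt (coneModel n) (atOne c)).symm z)
      (chartDeriv (coneModel n) (atOne c) z v) (chartDeriv (coneModel n) (atOne c) z w) =
      coneForm (metricInChart g c) z v w := by
  rw [cone_chartDeriv hz, cone_chartDeriv hz, coneMetric, coneForm_apply]
  rw [cone_extChartAt_symm c (Set.mem_Ioi.1 hz.2)]
  rfl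

theorem chartDeriv_euler {c : S} {z : 𝔼 × ℝ}
    (hz : z ∈ (extChartAt (𝓡 n) c).target ×ˢ Set.Ioi (0 : ℝ)) :
    chartDeriv (coneModel n) (atOne c) z (eulerMap 𝔼 z) =
      euler n ((extChartAt (coneModel n) (atOne c)).symm z) := by
  rw [cone_chartDeriv hz, euler, cone_extChartAt_symm c (Set.mem_Ioi.1 hz.2), eulerMap_apply,
    map_zero]

theorem smoothFieldAt_euler {c : S} {z : 𝔼 × ℝ}
    (hz : z ∈ (extChartAt (𝓡 n) c).target ×ˢ Set.Ioi (0 : ℝ)) :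
    SmoothFieldAt (euler n) ((extChartAt (coneModel n) (atOne c)).symm z) := by
  rw [← cone_extChartAt_target] at hz
  refine (contMDiffAt_chartField (I := coneModel n) hz
    (eulerMap 𝔼).contDiff.contDiffAt).congr_of_eventuallyEq ?_
  filter_upwards [(isOpen_extChartAt_source (I := coneModel n) (atOne c)).mem_nhds
    ((extChartAt (coneModel n) (atOne c)).map_target hz)] with x hx
  have hx' := (extChartAt (coneModel n) (atOne c)).map_source hx
  rw [← (extChartAt (coneModel n) (atOne c)).left_inv hx, chartField_apply hx',
    chartDeriv_euler (by rwa [← cone_extChartAt_target])]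

end MetricInChart

namespace SasakianStructure

variable {m : ℕ} {S : Type*} [TopologicalSpace S]
    [ChartedSpace (EuclideanSpace ℝ (Fin (2 * m + 1))) S] [IsManifold (𝓡 (2 * m + 1)) ∞ S]
    (𝓢 : SasakianStructure m S)

local notation "𝔼" => EuclideanSpace ℝ (Fin (2 * m + 1))
local notation "𝕀" => coneModel (2 * m + 1)

/-- The complex structure of the cone in the product chart at `(c, 1)`. -/
noncomputable def JInChart (c : S) (z : EuclideanSpace ℝ (Fin (2 * m + 1)) × ℝ) :
    EuclideanSpace ℝ (Fin (2 * m + 1)) × ℝ →L[ℝ] EuclideanSpace ℝ (Fin (2 * m + 1)) × ℝ :=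
  (chartDerivInv 𝕀 (atOne c) z : 𝔼 × ℝ →L[ℝ] 𝔼 × ℝ).comp
    ((𝓢.J ((extChartAt 𝕀 (atOne c)).symm z) : 𝔼 × ℝ →L[ℝ] 𝔼 × ℝ).comp
      (chartDeriv 𝕀 (atOne c) z : 𝔼 × ℝ →L[ℝ] 𝔼 × ℝ))

theorem smoothFieldAt_J {V : ∀ x : Cone S, TangentSpace 𝕀 x} {x : Cone S}
    (hV : SmoothFieldAt V x) : SmoothFieldAt (fun x => 𝓢.J x (V x)) x :=
  ContMDiffAt.clm_bundle_apply (F₁ := 𝔼 × ℝ) (F₂ := 𝔼 × ℝ) (b := fun x => x) (𝓢.smooth_J x) hV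

section

variable {c : S} {z : EuclideanSpace ℝ (Fin (2 * m + 1)) × ℝ}
  (hz : z ∈ (extChartAt (coneModel (2 * m + 1)) (atOne c)).target)
include hz

theorem chartDeriv_JInChart (v : 𝔼 × ℝ) :
    chartDeriv 𝕀 (atOne c) z (𝓢.JInChart c z v) = 𝓢.J _ (chartDeriv 𝕀 (atOne c) z v) :=
  chartDeriv_chartDerivInv hz _

theorem fieldInChart_J_chartField (X : 𝔼 × ℝ → 𝔼 × ℝ) :
    fieldInChart 𝕀 (atOne c) (fun x => 𝓢.J x (chartField 𝕀 (atOne c) X x)) z =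
      𝓢.JInChart c z (X z) := by
  apply chartDeriv_injective (I := 𝕀) hz
  rw [chartDeriv_JInChart 𝓢 hz, chartDeriv_fieldInChart hz, chartField_apply hz]

theorem contDiffAt_JInChart : ContDiffAt ℝ ∞ (𝓢.JInChart c) z := by
  refine ContDiffOn.contDiffAt (contDiffOn_clm_apply.2 fun v w hw => ?_)
    ((isOpen_extChartAt_target (I := 𝕀) (atOne c)).mem_nhds hz)
  refine ((contDiffAt_fieldInChart (I := 𝕀) hw (𝓢.smoothFieldAt_J (contMDiffAt_chartField (I := 𝕀)
    hw (contDiffAt_const (c := v))))).congr_of_eventuallyEq ?_).contDiffWithinAt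
  filter_upwards [(isOpen_extChartAt_target (I := 𝕀) (atOne c)).mem_nhds hw] with x hx
  rw [fieldInChart_J_chartField 𝓢 hx]

theorem JInChart_sq (v : 𝔼 × ℝ) : 𝓢.JInChart c z (𝓢.JInChart c z v) = -v := by
  apply chartDeriv_injective (I := 𝕀) hz
  rw [chartDeriv_JInChart 𝓢 hz, chartDeriv_JInChart 𝓢 hz, 𝓢.J_sq, map_neg]

theorem coneMetric_J_chartDeriv (v w : 𝔼 × ℝ) :
    coneMetric 𝓢.g ((extChartAt 𝕀 (atOne c)).symm z) (𝓢.J _ (chartDeriv 𝕀 (atOne c) z v))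
      (chartDeriv 𝕀 (atOne c) z w) = coneForm (metricInChart 𝓢.g c) z (𝓢.JInChart c z v) w := by
  rw [← chartDeriv_JInChart 𝓢 hz, coneMetric_chartDeriv _ (by rwa [← cone_extChartAt_target])]

theorem JInChart_skew (v w : 𝔼 × ℝ) :
    coneForm (metricInChart 𝓢.g c) z (𝓢.JInChart c z v) w =
      -coneForm (metricInChart 𝓢.g c) z v (𝓢.JInChart c z w) := by
  have hz' := hz
  rw [cone_extChartAt_target] at hz'
  have hherm := 𝓢.hermitian ((extChartAt 𝕀 (atOne c)).symm z)
    (chartDeriv 𝕀 (atOne c) z (𝓢.JInChart c z v)) (chartDeriv 𝕀 (atOne c) z w)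
  rw [← chartDeriv_JInChart 𝓢 hz, ← chartDeriv_JInChart 𝓢 hz, JInChart_sq 𝓢 hz,
    coneMetric_chartDeriv _ hz', coneMetric_chartDeriv _ hz', map_neg, neg_apply] at hherm
  exact hherm.symm

theorem lieEnd_euler_JInChart : lieEnd (eulerMap 𝔼) (𝓢.JInChart c) z = 0 := by
  have hz' := hz
  rw [cone_extChartAt_target] at hz'
  refine ContinuousLinearMap.ext fun v => ?_
  have hfield : SmoothFieldAt (chartField 𝕀 (atOne c) fun _ => v) _ :=
    contMDiffAt_chartField (I := 𝕀) hz contDiffAt_const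
  have heuler : ∀ w ∈ (extChartAt 𝕀 (atOne c)).target,
      fieldInChart 𝕀 (atOne c) (euler (2 * m + 1)) w = eulerMap 𝔼 w := fun w hw => by
    apply chartDeriv_injective (I := 𝕀) hw
    rw [chartDeriv_fieldInChart hw, chartDeriv_euler (by rwa [← cone_extChartAt_target])]
  have hlie := 𝓢.lie_euler_J _ _ hfield
  rw [mlieBracket_chart hz (smoothFieldAt_euler hz') (𝓢.smoothFieldAt_J hfield) heuler
      (fun w hw => 𝓢.fieldInChart_J_chartField hw _),
    mlieBracket_chart hz (smoothFieldAt_euler hz') hfield heuler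
      (fun w hw => fieldInChart_chartField hw _), ← chartDeriv_JInChart 𝓢 hz] at hlie
  rw [lieEnd_apply_eq_lieBracket ((𝓢.contDiffAt_JInChart hz).differentiableAt (by simp)),
    chartDeriv_injective hz hlie, sub_self, zero_apply]

theorem nijenhuis_JInChart {X Y : 𝔼 × ℝ → 𝔼 × ℝ} (hX : ContDiff ℝ ∞ X) (hY : ContDiff ℝ ∞ Y) :
    VectorField.lieBracket ℝ (fun x => 𝓢.JInChart c x (X x)) (fun x => 𝓢.JInChart c x (Y x)) z
      - 𝓢.JInChart c z (VectorField.lieBracket ℝ (fun x => 𝓢.JInChart c x (X x)) Y z)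
      - 𝓢.JInChart c z (VectorField.lieBracket ℝ X (fun x => 𝓢.JInChart c x (Y x)) z)
      - VectorField.lieBracket ℝ X Y z = 0 := by
  have hXs : SmoothFieldAt (chartField 𝕀 (atOne c) X) _ :=
    contMDiffAt_chartField (I := 𝕀) hz hX.contDiffAt
  have hYs : SmoothFieldAt (chartField 𝕀 (atOne c) Y) _ :=
    contMDiffAt_chartField (I := 𝕀) hz hY.contDiffAt
  have hJ : ∀ X : 𝔼 × ℝ → 𝔼 × ℝ, ∀ w ∈ (extChartAt 𝕀 (atOne c)).target,
      fieldInChart 𝕀 (atOne c) (fun x => 𝓢.J x (chartField 𝕀 (atOne c) X x)) w =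
        𝓢.JInChart c w (X w) := fun X w hw => 𝓢.fieldInChart_J_chartField hw X
  have hC : ∀ X : 𝔼 × ℝ → 𝔼 × ℝ, ∀ w ∈ (extChartAt 𝕀 (atOne c)).target,
      fieldInChart 𝕀 (atOne c) (chartField 𝕀 (atOne c) X) w = X w := fun X w hw =>
    fieldInChart_chartField hw X
  have h := 𝓢.integrable _ _ _ hXs hYs
  rw [mlieBracket_chart hz (𝓢.smoothFieldAt_J hXs) (𝓢.smoothFieldAt_J hYs) (hJ X) (hJ Y),
    mlieBracket_chart hz (𝓢.smoothFieldAt_J hXs) hYs (hJ X) (hC Y),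
    mlieBracket_chart hz hXs (𝓢.smoothFieldAt_J hYs) (hC X) (hJ Y),
    mlieBracket_chart hz hXs hYs (hC X) (hC Y),
    ← chartDeriv_JInChart 𝓢 hz, ← chartDeriv_JInChart 𝓢 hz, ← map_sub, ← map_sub, ← map_sub] at h
  exact chartDeriv_injective hz (h.trans (map_zero _).symm)

theorem dirDeriv_coneMetric_J (v₁ v₂ v₃ : 𝔼 × ℝ) :
    dirDeriv (fun x => coneMetric 𝓢.g x (𝓢.J x (chartField 𝕀 (atOne c) (fun _ => v₂) x))
        (chartField 𝕀 (atOne c) (fun _ => v₃) x)) ((extChartAt 𝕀 (atOne c)).symm z)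
      (chartField 𝕀 (atOne c) (fun _ => v₁) ((extChartAt 𝕀 (atOne c)).symm z)) =
      fderiv ℝ (fun x => coneForm (metricInChart 𝓢.g c) x (𝓢.JInChart c x v₂) v₃) z v₁ := by
  have hlocal : (fun x => coneMetric 𝓢.g ((extChartAt 𝕀 (atOne c)).symm x)
      (𝓢.J _ (chartField 𝕀 (atOne c) (fun _ => v₂) ((extChartAt 𝕀 (atOne c)).symm x)))
      (chartField 𝕀 (atOne c) (fun _ => v₃) ((extChartAt 𝕀 (atOne c)).symm x))) =ᶠ[𝓝 z]
      fun x => coneForm (metricInChart 𝓢.g c) x (𝓢.JInChart c x v₂) v₃ := by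
    filter_upwards [(isOpen_extChartAt_target (I := 𝕀) (atOne c)).mem_nhds hz] with x hx
    rw [chartField_apply hx, chartField_apply hx, coneMetric_J_chartDeriv 𝓢 hx]
  have hz' := hz
  rw [cone_extChartAt_target] at hz'
  have hdiff := differentiableAt_coneForm
    (((contDiffOn_metricInChart 𝓢.g c).contDiffAt
      ((isOpen_extChartAt_target c).mem_nhds hz'.1)).differentiableAt (by simp))
    (((𝓢.contDiffAt_JInChart hz).differentiableAt (by simp)).clm_apply
      (differentiableAt_const v₂)) v₃
  have hmdiff := mdifferentiableAt_of_comp_chart_symm (I := 𝕀) hz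
    (f := fun x => coneMetric 𝓢.g x (𝓢.J x (chartField 𝕀 (atOne c) (fun _ => v₂) x))
      (chartField 𝕀 (atOne c) (fun _ => v₃) x)) (hdiff.congr_of_eventuallyEq hlocal)
  rw [chartField_apply hz, ← hlocal.fderiv_eq]
  exact (fderiv_comp_chart_symm hz hmdiff v₁).symm

theorem closed_JInChart (v₁ v₂ v₃ : 𝔼 × ℝ) :
    fderiv ℝ (fun x => coneForm (metricInChart 𝓢.g c) x (𝓢.JInChart c x v₂) v₃) z v₁
      + fderiv ℝ (fun x => coneForm (metricInChart 𝓢.g c) x (𝓢.JInChart c x v₃) v₁) z v₂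
      + fderiv ℝ (fun x => coneForm (metricInChart 𝓢.g c) x (𝓢.JInChart c x v₁) v₂) z v₃ = 0 := by
  have hsmooth : ∀ v : 𝔼 × ℝ, SmoothFieldAt (chartField 𝕀 (atOne c) fun _ => v)
      ((extChartAt 𝕀 (atOne c)).symm z) := fun v =>
    contMDiffAt_chartField (I := 𝕀) hz contDiffAt_const
  have hbracket : ∀ v w : 𝔼 × ℝ, VectorField.mlieBracket 𝕀 (chartField 𝕀 (atOne c) fun _ => v)
      (chartField 𝕀 (atOne c) fun _ => w) ((extChartAt 𝕀 (atOne c)).symm z) =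
      chartDeriv 𝕀 (atOne c) z 0 := fun v w => by
    rw [mlieBracket_chart hz (hsmooth v) (hsmooth w) (fun x hx => fieldInChart_chartField hx _)
      fun x hx => fieldInChart_chartField hx _]
    simp [VectorField.lieBracket_eq]
  have h := 𝓢.closed _ _ _ _ (hsmooth v₁) (hsmooth v₂) (hsmooth v₃)
  rw [hbracket, hbracket, hbracket, dirDeriv_coneMetric_J 𝓢 hz, dirDeriv_coneMetric_J 𝓢 hz,
    dirDeriv_coneMetric_J 𝓢 hz, chartField_apply hz, chartField_apply hz, chartField_apply hz,
    coneMetric_J_chartDeriv 𝓢 hz, coneMetric_J_chartDeriv 𝓢 hz,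
    coneMetric_J_chartDeriv 𝓢 hz] at h
  simpa only [map_zero, zero_apply, sub_zero] using h

end

theorem isLocalKahlerCone (c : S) :
    IsLocalKahlerCone (extChartAt (𝓡 (2 * m + 1)) c).target (metricInChart 𝓢.g c)
      (𝓢.JInChart c) where
  isOpen := isOpen_extChartAt_target c
  smooth_metric := contDiffOn_metricInChart 𝓢.g c
  smooth_J _ hz :=
    (𝓢.contDiffAt_JInChart ((cone_extChartAt_target c).ge hz)).contDiffWithinAt
  symm _ _ := metricInChart_symm 𝓢.g c _
  pos _ hy := metricInChart_pos 𝓢.g hy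
  J_sq _ hz := 𝓢.JInChart_sq ((cone_extChartAt_target c).ge hz)
  skew _ hz := 𝓢.JInChart_skew ((cone_extChartAt_target c).ge hz)
  lie_euler _ hz := 𝓢.lieEnd_euler_JInChart ((cone_extChartAt_target c).ge hz)
  nijenhuis _ hz _ _ := 𝓢.nijenhuis_JInChart ((cone_extChartAt_target c).ge hz)
  closed _ hz := 𝓢.closed_JInChart ((cone_extChartAt_target c).ge hz)

/-- The Reeb field in the chart at `c`. -/
noncomputable def reebInChart (c : S) : 𝔼 → 𝔼 :=
  sliceReeb (𝓢.JInChart c)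

/-- The transverse complex structure, extended by zero along the Reeb field, in the chart at
`c`. -/
noncomputable def transverseJInChart (c : S) : 𝔼 → 𝔼 →L[ℝ] 𝔼 :=
  sliceEnd (𝓢.JInChart c)

theorem isLocalSasakian (c : S) :
    IsLocalSasakian (extChartAt (𝓡 (2 * m + 1)) c).target (metricInChart 𝓢.g c)
      (𝓢.reebInChart c) (𝓢.transverseJInChart c) :=
  (𝓢.isLocalKahlerCone c).isLocalSasakian

variable {c : S} {y : EuclideanSpace ℝ (Fin (2 * m + 1))}
  (hy : y ∈ (extChartAt (𝓡 (2 * m + 1)) c).target)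
include hy

theorem chartDeriv_reebInChart :
    chartDeriv (𝓡 (2 * m + 1)) c y (𝓢.reebInChart c y) =
      𝓢.reeb ((extChartAt (𝓡 (2 * m + 1)) c).symm y) := by
  have hz := slice_mem hy
  have hJ := 𝓢.chartDeriv_JInChart ((cone_extChartAt_target c).ge hz) (eulerMap 𝔼 (y, 1))
  rw [chartDeriv_euler hz, cone_chartDeriv hz] at hJ
  let F : Cone S → 𝔼 := fun x => baseComp (𝓢.J x (euler (2 * m + 1) x))
  exact (congrArg baseComp hJ).trans (congrArg F (cone_extChartAt_symm_slice c y))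

theorem chartDeriv_transverseJInChart (v : 𝔼) :
    chartDeriv (𝓡 (2 * m + 1)) c y (𝓢.transverseJInChart c y v) =
      𝓢.transverseJ _ (chartDeriv (𝓡 (2 * m + 1)) c y v) := by
  have hz := slice_mem hy
  have hJ := 𝓢.chartDeriv_JInChart ((cone_extChartAt_target c).ge hz) (v, 0)
  rw [cone_chartDeriv hz, cone_chartDeriv hz] at hJ
  let F : Cone S → 𝔼 := fun x =>
    baseComp (𝓢.J x (coneVec x (chartDeriv (𝓡 (2 * m + 1)) c y v : 𝔼) 0))
  exact (congrArg baseComp hJ).trans (congrArg F (cone_extChartAt_symm_slice c y))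

end SasakianStructure

/-! ### Divergence and integration on the manifold -/

section Density

theorem contDiffOn_divergence {E : Type*} [NormedAddCommGroup E] [NormedSpace ℝ E]
    [FiniteDimensional ℝ E] {ρ : E → ℝ} {X : E → E} {T : Set E} (hT : IsOpen T)
    (hρ : ContDiffOn ℝ ∞ ρ T) (h0 : ∀ y ∈ T, ρ y ≠ 0) (hX : ContDiffOn ℝ ∞ X T) :
    ContDiffOn ℝ ∞ (divergence ρ X) T := by
  let tr : (E →L[ℝ] E) →L[ℝ] ℝ :=
    LinearMap.toContinuousLinearMap (LinearMap.trace ℝ E ∘ₗ ContinuousLinearMap.coeLM ℝ)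
  exact (((hρ.log h0).fderiv_of_isOpen hT (by simp)).clm_apply hX).add
    (tr.contDiff.comp_contDiffOn (hX.fderiv_of_isOpen hT (by simp)))

variable {n : ℕ} {S : Type*} [TopologicalSpace S] [ChartedSpace (EuclideanSpace ℝ (Fin n)) S]
  [IsManifold (𝓡 n) ∞ S] (g : Metric n S) {c : S} {y : EuclideanSpace ℝ (Fin n)}

theorem posDef_gram (hy : y ∈ (extChartAt (𝓡 n) c).target) : (gram g c y).PosDef := by
  rw [gram_eq_gramMatrix]
  exact posDef_gramMatrix _ (metricInChart_symm g c y) (metricInChart_pos g hy)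

theorem density_pos (hy : y ∈ (extChartAt (𝓡 n) c).target) : 0 < density g c y :=
  Real.sqrt_pos.2 (posDef_gram g hy).det_pos

theorem density_sq (hy : y ∈ (extChartAt (𝓡 n) c).target) :
    density g c y ^ 2 =
      (gramMatrix (EuclideanSpace.basisFun (Fin n) ℝ).toBasis (metricInChart g c y)).det := by
  rw [density, Real.sq_sqrt (posDef_gram g hy).det_pos.le, gram_eq_gramMatrix]

theorem contDiffOn_gram (c : S) (i j : Fin n) :
    ContDiffOn ℝ ∞ (fun y => gram g c y i j) (extChartAt (𝓡 n) c).target := by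
  simp only [gram_eq_gramMatrix, gramMatrix_apply]
  exact ((contDiffOn_metricInChart g c).clm_apply contDiffOn_const).clm_apply contDiffOn_const

theorem contDiffOn_density (c : S) :
    ContDiffOn ℝ ∞ (density g c) (extChartAt (𝓡 n) c).target :=
  (contDiff_det.comp_contDiffOn (contDiffOn_pi.2 fun i =>
    contDiffOn_pi.2 fun j => contDiffOn_gram g c i j)).sqrt fun _ hy =>
      (posDef_gram g hy).det_pos.ne'

end Density

section Transition

variable {n : ℕ} {S : Type*} [TopologicalSpace S] [ChartedSpace (EuclideanSpace ℝ (Fin n)) S]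

local notation "𝔼" => EuclideanSpace ℝ (Fin n)

/-- The transition map from the chart at `c` to the chart at `c'`. -/
noncomputable def transition (c c' : S) (y : EuclideanSpace ℝ (Fin n)) :
    EuclideanSpace ℝ (Fin n) :=
  extChartAt (𝓡 n) c' ((extChartAt (𝓡 n) c).symm y)

/-- The part of the coordinate range of the chart at `c` that lies in the domain of the chart at
`c'`. -/
def overlap (n : ℕ) {S : Type*} [TopologicalSpace S] [ChartedSpace (EuclideanSpace ℝ (Fin n)) S]
    (c c' : S) : Set (EuclideanSpace ℝ (Fin n)) :=
  (extChartAt (𝓡 n) c).target ∩ (extChartAt (𝓡 n) c).symm ⁻¹' (extChartAt (𝓡 n) c').source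

variable {c c' : S} {y : EuclideanSpace ℝ (Fin n)}

theorem isOpen_overlap (c c' : S) : IsOpen (overlap n c c') :=
  (continuousOn_extChartAt_symm c).isOpen_inter_preimage (isOpen_extChartAt_target c)
    (isOpen_extChartAt_source c')

theorem transition_mem (hy : y ∈ overlap n c c') : transition c c' y ∈ overlap n c' c := by
  refine ⟨(extChartAt (𝓡 n) c').map_source hy.2, ?_⟩
  rw [Set.mem_preimage, transition, (extChartAt (𝓡 n) c').left_inv hy.2]
  exact (extChartAt (𝓡 n) c).map_target hy.1

theorem chart_symm_transition (hy : y ∈ overlap n c c') :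
    (extChartAt (𝓡 n) c').symm (transition c c' y) = (extChartAt (𝓡 n) c).symm y :=
  (extChartAt (𝓡 n) c').left_inv hy.2

theorem transition_transition (hy : y ∈ overlap n c c') :
    transition c' c (transition c c' y) = y := by
  rw [transition, chart_symm_transition hy, (extChartAt (𝓡 n) c).right_inv hy.1]

theorem injOn_transition (c c' : S) : Set.InjOn (transition c c') (overlap n c c') :=
  Set.LeftInvOn.injOn (f₁' := transition c' c) fun _ hy => transition_transition hy

theorem image_transition (c c' : S) : transition c c' '' overlap n c c' = overlap n c' c :=
  Set.Subset.antisymm (Set.image_subset_iff.2 fun _ hy => transition_mem hy) fun y hy =>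
    ⟨transition c' c y, transition_mem hy, transition_transition hy⟩

variable [IsManifold (𝓡 n) ∞ S]

theorem contDiffAt_transition (hy : y ∈ overlap n c c') : ContDiffAt ℝ ∞ (transition c c') y := by
  have hchart : ContMDiffAt (𝓡 n) 𝓘(ℝ, 𝔼) ∞ (extChartAt (𝓡 n) c')
      ((extChartAt (𝓡 n) c).symm y) :=
    contMDiffAt_extChartAt' (by rw [← extChartAt_source (𝓡 n)]; exact hy.2)
  exact (ContMDiffAt.comp y hchart (contMDiffAt_chart_symm hy.1)).contDiffAt

theorem differentiableAt_transition (hy : y ∈ overlap n c c') :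
    DifferentiableAt ℝ (transition c c') y :=
  (contDiffAt_transition hy).differentiableAt (by simp)

theorem chartDeriv_transition (hy : y ∈ overlap n c c') (v : 𝔼) :
    @id 𝔼 (chartDeriv (𝓡 n) c y v) =
      chartDeriv (𝓡 n) c' (transition c c' y) (fderiv ℝ (transition c c') y v) := by
  have hcomp := mfderiv_comp (I := 𝓘(ℝ, 𝔼)) (I' := 𝓘(ℝ, 𝔼)) (I'' := 𝓡 n) y
    (g := (extChartAt (𝓡 n) c').symm) (f := transition c c')
    ((contMDiffAt_chart_symm (I := 𝓡 n) (transition_mem hy).1).mdifferentiableAt (by simp))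
    (differentiableAt_transition hy).mdifferentiableAt
  rw [mfderiv_eq_fderiv] at hcomp
  have hsymm : (extChartAt (𝓡 n) c).symm =ᶠ[𝓝 y]
      (extChartAt (𝓡 n) c').symm ∘ transition c c' := by
    filter_upwards [(isOpen_overlap c c').mem_nhds hy] with x hx
    exact (chart_symm_transition hx).symm
  exact congrArg (fun L : 𝔼 →L[ℝ] 𝔼 => L v) (hsymm.mfderiv_eq.trans hcomp)

theorem fderiv_transition_inverse (hy : y ∈ overlap n c c') :
    fderiv ℝ (transition c' c) (transition c c' y) ∘L fderiv ℝ (transition c c') y =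
      .id ℝ 𝔼 := by
  rw [← fderiv_comp y (differentiableAt_transition (transition_mem hy))
    (differentiableAt_transition hy)]
  have hid : transition c' c ∘ transition c c' =ᶠ[𝓝 y] id := by
    filter_upwards [(isOpen_overlap c c').mem_nhds hy] with x hx using transition_transition hx
  rw [hid.fderiv_eq, fderiv_id]

theorem metricInChart_transition (g : Metric n S) (hy : y ∈ overlap n c c') :
    metricInChart g c y = (metricInChart g c' (transition c c' y)).bilinearComp
      (fderiv ℝ (transition c c') y) (fderiv ℝ (transition c c') y) := by
  ext v w
  let G : S → 𝔼 →L[ℝ] 𝔼 →L[ℝ] ℝ := fun p => g.inner p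
  change G ((extChartAt (𝓡 n) c).symm y)
      (@id 𝔼 (chartDeriv (𝓡 n) c y v)) (@id 𝔼 (chartDeriv (𝓡 n) c y w)) = _
  rw [chartDeriv_transition hy, chartDeriv_transition hy, ← chart_symm_transition hy]
  rfl

theorem density_transition (g : Metric n S) (hy : y ∈ overlap n c c') :
    density g c y = |(fderiv ℝ (transition c c') y).det| * density g c' (transition c c' y) := by
  rw [density, density, gram_eq_gramMatrix, metricInChart_transition g hy,
    det_gramMatrix_bilinearComp, ← gram_eq_gramMatrix, mul_right_comm, ← sq,
    Real.sqrt_mul (sq_nonneg _), Real.sqrt_sq_eq_abs]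

theorem fieldInChart_transition (hy : y ∈ overlap n c c') (X : ∀ p : S, TangentSpace (𝓡 n) p) :
    fieldInChart (𝓡 n) c' X (transition c c' y) =
      fderiv ℝ (transition c c') y (fieldInChart (𝓡 n) c X y) := by
  apply chartDeriv_injective (I := 𝓡 n) (transition_mem hy).1
  rw [chartDeriv_fieldInChart (transition_mem hy).1]
  let F : S → 𝔼 := X
  have hpoint : F ((extChartAt (𝓡 n) c').symm (transition c c' y)) =
      F ((extChartAt (𝓡 n) c).symm y) := congrArg F (chart_symm_transition hy)
  refine Eq.trans hpoint (Eq.trans ?_ (chartDeriv_transition hy _))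
  exact (chartDeriv_fieldInChart hy.1 X).symm

/-- Smooth vector fields, by their components in the charts. -/
def IsSmoothField (X : ∀ p : S, TangentSpace (𝓡 n) p) : Prop :=
  ∀ c : S, ContDiffOn ℝ ∞ (fieldInChart (𝓡 n) c X) (extChartAt (𝓡 n) c).target

/-- The divergence of a vector field on a Riemannian manifold, computed at `p` in the chart
at `p`. -/
noncomputable def fieldDiv (g : Metric n S) (X : ∀ p : S, TangentSpace (𝓡 n) p) (p : S) : ℝ :=
  divergence (density g p) (fieldInChart (𝓡 n) p X) (extChartAt (𝓡 n) p p)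

theorem fieldDiv_chart (g : Metric n S) {X : ∀ p : S, TangentSpace (𝓡 n) p} (hX : IsSmoothField X)
    (hy : y ∈ (extChartAt (𝓡 n) c).target) :
    fieldDiv g X ((extChartAt (𝓡 n) c).symm y) =
      divergence (density g c) (fieldInChart (𝓡 n) c X) y := by
  set c' := (extChartAt (𝓡 n) c).symm y
  have hoverlap : y ∈ overlap n c c' := ⟨hy, mem_extChartAt_source c'⟩
  have htarget := (transition_mem hoverlap).1
  have hnhds {c : S} {y : 𝔼} (h : y ∈ (extChartAt (𝓡 n) c).target) :=
    (isOpen_extChartAt_target c).mem_nhds h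
  have hX_diff {c : S} {y : 𝔼} (h : y ∈ (extChartAt (𝓡 n) c).target) :=
    ((hX c).contDiffAt (hnhds h)).differentiableAt (by simp)
  refine (divergence_pullback ((contDiffAt_transition hoverlap).of_le (by norm_cast))
    (fderiv_transition_inverse hoverlap) (hX_diff hy) (hX_diff htarget) ?_
    (((contDiffOn_density g c').contDiffAt (hnhds htarget)).differentiableAt (by simp))
    (density_pos g htarget).ne' ?_).symm
  · filter_upwards [(isOpen_overlap c c').mem_nhds hoverlap] with x hx
    exact (fieldInChart_transition hx X).symm
  · filter_upwards [(isOpen_overlap c c').mem_nhds hoverlap] with x hx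
    exact density_transition g hx

end Transition

section ChartwiseSmooth

variable {E : Type*} [NormedAddCommGroup E] [NormedSpace ℝ E]
  {H : Type*} [TopologicalSpace H] {I : ModelWithCorners ℝ E H}
  {M : Type*} [TopologicalSpace M] [ChartedSpace H M]

theorem continuousOn_comp_chart_symm {F : Type*} [TopologicalSpace F] {f : M → F}
    (hf : Continuous f) (c : M) :
    ContinuousOn (fun y => f ((extChartAt I c).symm y)) (extChartAt I c).target :=
  hf.comp_continuousOn (continuousOn_extChartAt_symm c)

variable {F : Type*} [NormedAddCommGroup F] [NormedSpace ℝ F] {f : M → F}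

theorem contMDiff_of_charts [I.Boundaryless]
    (h : ∀ c : M, ContDiffOn ℝ ∞ (fun y => f ((extChartAt I c).symm y)) (extChartAt I c).target) :
    ContMDiff I 𝓘(ℝ, F) ∞ f := by
  intro p
  have hcomp : ContMDiffAt I 𝓘(ℝ, F) ∞
      ((fun y => f ((extChartAt I p).symm y)) ∘ extChartAt I p) p :=
    ContMDiffAt.comp p ((h p).contDiffAt (extChartAt_target_mem_nhds p)).contMDiffAt
      contMDiffAt_extChartAt
  refine hcomp.congr_of_eventuallyEq ?_
  filter_upwards [extChartAt_source_mem_nhds (I := I) p] with q hq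
  exact (congrArg f ((extChartAt I p).left_inv hq)).symm

theorem contDiffOn_comp_chart_symm [IsManifold I ∞ M] (hf : ContMDiff I 𝓘(ℝ, F) ∞ f)
    (c : M) :
    ContDiffOn ℝ ∞ (fun y => f ((extChartAt I c).symm y)) (extChartAt I c).target :=
  (hf.comp_contMDiffOn (contMDiffOn_extChartAt_symm c)).contDiffOn

end ChartwiseSmooth

section Integration

open MeasureTheory

variable {n : ℕ} {S : Type*} [TopologicalSpace S] [ChartedSpace (EuclideanSpace ℝ (Fin n)) S]

local notation "𝔼" => EuclideanSpace ℝ (Fin n)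

/-- The coordinates, in the chart at `c`, of the support of a function. -/
def chartSupport (n : ℕ) {S : Type*} [TopologicalSpace S]
    [ChartedSpace (EuclideanSpace ℝ (Fin n)) S] (c : S) (f : S → ℂ) :
    Set (EuclideanSpace ℝ (Fin n)) :=
  extChartAt (𝓡 n) c '' tsupport f

theorem isCompact_chartSupport [CompactSpace S] {c : S} {f : S → ℂ}
    (hs : tsupport f ⊆ (extChartAt (𝓡 n) c).source) : IsCompact (chartSupport n c f) :=
  (isClosed_tsupport f).isCompact.image_of_continuousOn ((continuousOn_extChartAt c).mono hs)

theorem chartSupport_subset {c : S} {f : S → ℂ} (hs : tsupport f ⊆ (extChartAt (𝓡 n) c).source) :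
    chartSupport n c f ⊆ (extChartAt (𝓡 n) c).target :=
  ((extChartAt (𝓡 n) c).mapsTo.mono_left hs).image_subset

theorem notMem_tsupport_of_notMem_chartSupport {c : S} {f : S → ℂ} {y : 𝔼}
    (hy : y ∈ (extChartAt (𝓡 n) c).target) (h : y ∉ chartSupport n c f) :
    (extChartAt (𝓡 n) c).symm y ∉ tsupport f := fun hmem =>
  h ⟨_, hmem, (extChartAt (𝓡 n) c).right_inv hy⟩

variable [IsManifold (𝓡 n) ∞ S] (g : Metric n S) {c c' : S} {f : S → ℂ}

/-- The integral of a function over the domain of the chart at `c`. -/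
noncomputable def chartIntegral (g : Metric n S) (c : S) (f : S → ℂ) : ℂ :=
  ∫ y in (extChartAt (𝓡 n) c).target, (density g c y : ℂ) * f ((extChartAt (𝓡 n) c).symm y)

theorem integrableOn_chart [CompactSpace S] (hs : tsupport f ⊆ (extChartAt (𝓡 n) c).source)
    (hf : Continuous f) :
    IntegrableOn (fun y => (density g c y : ℂ) * f ((extChartAt (𝓡 n) c).symm y))
      (extChartAt (𝓡 n) c).target := by
  have hcont : ContinuousOn (fun y => (density g c y : ℂ) * f ((extChartAt (𝓡 n) c).symm y))
      (extChartAt (𝓡 n) c).target :=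
    (Complex.continuous_ofReal.comp_continuousOn (contDiffOn_density g c).continuousOn).mul
      (continuousOn_comp_chart_symm hf c)
  refine ((hcont.mono (chartSupport_subset hs)).integrableOn_compact
    (isCompact_chartSupport hs)).of_forall_sdiff_eq_zero
    (isOpen_extChartAt_target c).measurableSet fun y hy => ?_
  rw [image_eq_zero_of_notMem_tsupport (notMem_tsupport_of_notMem_chartSupport hy.1 hy.2), mul_zero]

theorem chartIntegral_eq_setIntegral_overlap (c : S)
    (hs' : Function.support f ⊆ (extChartAt (𝓡 n) c').source) :
    chartIntegral g c f = ∫ y in overlap n c c',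
      (density g c y : ℂ) * f ((extChartAt (𝓡 n) c).symm y) := by
  refine setIntegral_eq_of_subset_of_forall_sdiff_eq_zero
    (isOpen_extChartAt_target c).measurableSet Set.inter_subset_left fun y hy => ?_
  rw [Function.notMem_support.1 fun h => hy.2 ⟨hy.1, hs' h⟩, mul_zero]

theorem chartIntegral_eq_chartIntegral (hs : Function.support f ⊆ (extChartAt (𝓡 n) c).source)
    (hs' : Function.support f ⊆ (extChartAt (𝓡 n) c').source) :
    chartIntegral g c f = chartIntegral g c' f := by
  rw [chartIntegral_eq_setIntegral_overlap g c hs', chartIntegral_eq_setIntegral_overlap g c' hs,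
    ← image_transition c c',
    integral_image_eq_integral_abs_det_fderiv_smul volume (isOpen_overlap c c').measurableSet
      (fun y hy => (differentiableAt_transition hy).hasFDerivAt.hasFDerivWithinAt)
      (injOn_transition c c')]
  refine setIntegral_congr_fun (isOpen_overlap c c').measurableSet fun y hy => ?_
  simp only [chart_symm_transition hy, density_transition g hy, Complex.real_smul]
  push_cast
  ring

theorem chartIntegral_sum [CompactSpace S] {ι : Type*} (s : Finset ι) {f : ι → S → ℂ}
    (hs : ∀ i ∈ s, tsupport (f i) ⊆ (extChartAt (𝓡 n) c).source)
    (hf : ∀ i ∈ s, Continuous (f i)) :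
    chartIntegral g c (fun p => ∑ i ∈ s, f i p) = ∑ i ∈ s, chartIntegral g c (f i) := by
  simp only [chartIntegral]
  rw [← integral_finsetSum s fun i hi => integrableOn_chart g (hs i hi) (hf i hi)]
  simp only [Finset.mul_sum]

theorem chartIntegral_ofReal (F : S → ℝ) :
    chartIntegral g c (fun p => (F p : ℂ)) =
      ((∫ y in (extChartAt (𝓡 n) c).target,
        density g c y * F ((extChartAt (𝓡 n) c).symm y) : ℝ) : ℂ) := by
  rw [chartIntegral, ← integral_complex_ofReal]
  simp only [Complex.ofReal_mul]

theorem density_mul_nonneg {F : S → ℝ} (h0 : ∀ p, 0 ≤ F p) :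
    ∀ y ∈ (extChartAt (𝓡 n) c).target, 0 ≤ density g c y * F ((extChartAt (𝓡 n) c).symm y) :=
  fun _ hy => mul_nonneg (density_pos g hy).le (h0 _)

theorem eq_zero_of_chartIntegral_ofReal_eq_zero [CompactSpace S] {F : S → ℝ} (hF : Continuous F)
    (h0 : ∀ p, 0 ≤ F p) (hs : tsupport (fun p => (F p : ℂ)) ⊆ (extChartAt (𝓡 n) c).source)
    (h : chartIntegral g c (fun p => (F p : ℂ)) = 0) (p : S) : F p = 0 := by
  have hmeas := (isOpen_extChartAt_target (I := 𝓡 n) c).measurableSet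
  have hint : IntegrableOn (fun y => density g c y * F ((extChartAt (𝓡 n) c).symm y))
      (extChartAt (𝓡 n) c).target :=
    (integrableOn_chart g hs (Complex.continuous_ofReal.comp hF)).re.congr
      (Filter.Eventually.of_forall fun y => by simp)
  rw [chartIntegral_ofReal, Complex.ofReal_eq_zero, setIntegral_eq_zero_iff_of_nonneg_ae
    ((ae_restrict_iff' hmeas).2 (Filter.Eventually.of_forall (density_mul_nonneg g h0))) hint] at h
  have hzero := Measure.eqOn_open_of_ae_eq h (isOpen_extChartAt_target c)
    ((contDiffOn_density g c).continuousOn.mul (continuousOn_comp_chart_symm hF c))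
    continuousOn_const
  by_contra hp
  have hsource : p ∈ (extChartAt (𝓡 n) c).source :=
    hs (subset_tsupport _ (Complex.ofReal_ne_zero.2 hp))
  have htarget := (extChartAt (𝓡 n) c).map_source hsource
  have hprod : density g c (extChartAt (𝓡 n) c p) * F p = 0 := by
    simpa only [(extChartAt (𝓡 n) c).left_inv hsource, Pi.zero_apply] using hzero htarget
  exact mul_ne_zero (density_pos g htarget).ne' hp hprod

variable [T2Space S] [CompactSpace S]

/-- The finitely many indices of the partition of unity. -/
noncomputable def partitionIndices (n : ℕ) (S : Type*) [TopologicalSpace S]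
    [ChartedSpace (EuclideanSpace ℝ (Fin n)) S] [IsManifold (𝓡 n) ∞ S]
    [T2Space S] [CompactSpace S] : Finset S :=
  ((chartPartition n S).locallyFinite.finite_nonempty_of_compact).toFinset

theorem mem_partitionIndices {c p : S} (h : chartPartition n S c p ≠ 0) :
    c ∈ partitionIndices n S := by
  rw [partitionIndices, Set.Finite.mem_toFinset]
  exact ⟨p, h⟩

theorem sum_partition (p : S) : ∑ c ∈ partitionIndices n S, chartPartition n S c p = 1 := by
  rw [← (chartPartition n S).sum_eq_one (Set.mem_univ p)]
  exact (finsum_eq_sum_of_support_subset _ fun c hc => mem_partitionIndices hc).symm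

/-- The summand, supported in the domain of the chart at `c`, of the decomposition of a function by
the partition of unity. -/
noncomputable def chartPart (n : ℕ) {S : Type*} [TopologicalSpace S]
    [ChartedSpace (EuclideanSpace ℝ (Fin n)) S] [IsManifold (𝓡 n) ∞ S]
    [T2Space S] [CompactSpace S] (c : S) (f : S → ℂ) (p : S) : ℂ :=
  (chartPartition n S c p : ℂ) * f p

theorem sum_chartPart (f : S → ℂ) (p : S) :
    ∑ c ∈ partitionIndices n S, chartPart n c f p = f p := by
  simp only [chartPart, ← Finset.sum_mul, ← Complex.ofReal_sum, sum_partition, Complex.ofReal_one,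
    one_mul]

theorem tsupport_chartPart (c : S) (f : S → ℂ) :
    tsupport (chartPart n c f) ⊆ (extChartAt (𝓡 n) c).source := by
  have hsupport : Function.support (chartPart n c f) ⊆ Function.support (chartPartition n S c) :=
    fun p hp h => hp (by simp [chartPart, h])
  rw [extChartAt_source]
  exact (closure_mono hsupport).trans (chartPartition_isSubordinate n S c)

theorem tsupport_chartPart_subset (c : S) (f : S → ℂ) : tsupport (chartPart n c f) ⊆ tsupport f :=
  closure_mono fun p hp h => hp (by simp [chartPart, h])

theorem contMDiff_chartPart (c : S) {f : S → ℂ} (hf : ContMDiff (𝓡 n) 𝓘(ℝ, ℂ) ∞ f) :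
    ContMDiff (𝓡 n) 𝓘(ℝ, ℂ) ∞ (chartPart n c f) :=
  ((chartPartition n S c).contMDiff.smul hf).congr fun _ => Complex.real_smul.symm

theorem continuous_chartPart (c : S) {f : S → ℂ} (hf : Continuous f) :
    Continuous (chartPart n c f) :=
  (Complex.continuous_ofReal.comp (chartPartition n S c).contMDiff.continuous).mul hf

theorem chartPart_eq_zero (hc : c ∉ partitionIndices n S) (f : S → ℂ) :
    chartPart n c f = fun _ => 0 := by
  funext p
  have hp : chartPartition n S c p = 0 := not_not.1 fun h => hc (mem_partitionIndices h)
  simp [chartPart, hp]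

theorem integral_eq_sum (f : S → ℂ) :
    integral g f = ∑ c ∈ partitionIndices n S, chartIntegral g c (chartPart n c f) := by
  have hpart : integral g f = ∑ᶠ c : S, chartIntegral g c (chartPart n c f) := by
    refine finsum_congr fun c => congrArg _ (funext fun y => ?_)
    simp only [chartPart]
    push_cast
    ring
  rw [hpart]
  refine finsum_eq_sum_of_support_subset _ fun c hc => not_not.1 fun hindex => hc ?_
  simp [chartPart_eq_zero hindex, chartIntegral]

theorem integral_sum {ι : Type*} (s : Finset ι) {f : ι → S → ℂ} (hf : ∀ i ∈ s, Continuous (f i)) :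
    integral g (fun p => ∑ i ∈ s, f i p) = ∑ i ∈ s, integral g (f i) := by
  simp only [integral_eq_sum]
  rw [Finset.sum_comm]
  refine Finset.sum_congr rfl fun c _ => ?_
  rw [← chartIntegral_sum g s (fun i _ => tsupport_chartPart c (f i))
    fun i hi => continuous_chartPart c (hf i hi)]
  refine congrArg _ (funext fun p => ?_)
  simp only [chartPart, Finset.mul_sum]

theorem integral_add {f₁ f₂ : S → ℂ} (hf₁ : Continuous f₁) (hf₂ : Continuous f₂) :
    integral g (fun p => f₁ p + f₂ p) = integral g f₁ + integral g f₂ := by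
  have hsum := integral_sum g Finset.univ (f := fun b : Bool => if b then f₁ else f₂)
    (by intro b _; cases b <;> simpa)
  simpa using hsum

theorem integral_const_mul (a : ℂ) (f : S → ℂ) :
    integral g (fun p => a * f p) = a * integral g f := by
  simp only [integral_eq_sum, Finset.mul_sum, chartIntegral, ← MeasureTheory.integral_const_mul,
    chartPart]
  refine Finset.sum_congr rfl fun c _ => congrArg _ (funext fun y => ?_)
  ring

theorem integral_eq_chartIntegral (hs : tsupport f ⊆ (extChartAt (𝓡 n) c).source)
    (hf : Continuous f) : integral g f = chartIntegral g c f := by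
  have hpart : chartIntegral g c f =
      chartIntegral g c (fun p => ∑ c' ∈ partitionIndices n S, chartPart n c' f p) :=
    congrArg _ (funext fun p => (sum_chartPart f p).symm)
  rw [integral_eq_sum, hpart,
    chartIntegral_sum g _ (fun c' _ => (tsupport_chartPart_subset c' f).trans hs)
      fun c' _ => continuous_chartPart c' hf]
  exact Finset.sum_congr rfl fun c' _ => chartIntegral_eq_chartIntegral g
    ((subset_tsupport _).trans (tsupport_chartPart c' f))
    ((subset_tsupport _).trans ((tsupport_chartPart_subset c' f).trans hs))

theorem eq_zero_of_integral_ofReal_eq_zero {F : S → ℝ} (hF : Continuous F) (h0 : ∀ p, 0 ≤ F p)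
    (h : integral g (fun p => (F p : ℂ)) = 0) (p : S) : F p = 0 := by
  let part : S → S → ℝ := fun c q => chartPartition n S c q * F q
  have hpart : ∀ c, chartPart n c (fun q => (F q : ℂ)) = fun q => (part c q : ℂ) := fun c =>
    funext fun q => (Complex.ofReal_mul _ _).symm
  have hpart_nonneg : ∀ c q, 0 ≤ part c q := fun c q =>
    mul_nonneg ((chartPartition n S).nonneg c q) (h0 q)
  simp only [integral_eq_sum, hpart, chartIntegral_ofReal] at h
  rw [← Complex.ofReal_sum, Complex.ofReal_eq_zero, Finset.sum_eq_zero_iff_of_nonneg fun c _ =>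
    setIntegral_nonneg (isOpen_extChartAt_target c).measurableSet
      (density_mul_nonneg g (hpart_nonneg c))] at h
  have hpart_zero : ∀ c ∈ partitionIndices n S, part c p = 0 := fun c hc =>
    eq_zero_of_chartIntegral_ofReal_eq_zero g
      ((chartPartition n S c).contMDiff.continuous.mul hF) (hpart_nonneg c)
      (hpart c ▸ tsupport_chartPart c _)
      ((chartIntegral_ofReal g _).trans (Complex.ofReal_eq_zero.2 (h c hc))) p
  rw [← one_mul (F p), ← sum_partition (n := n) p, Finset.sum_mul, Finset.sum_eq_zero hpart_zero]

theorem eq_zero_of_integral_mul_conj_eq_zero (hf : Continuous f)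
    (h : integral g (fun p => f p * (starRingEnd ℂ) (f p)) = 0) : f = 0 := by
  simp only [Complex.mul_conj] at h
  exact funext fun p => Complex.normSq_eq_zero.1 (eq_zero_of_integral_ofReal_eq_zero g
    (Complex.continuous_normSq.comp hf) (fun q => Complex.normSq_nonneg (f q)) h p)

end Integration

section LocalDivergenceTheorem

open MeasureTheory

theorem indicator_eq_zero_of_notMem {α β : Type*} [Zero β] {T K : Set α} {f : α → β}
    (h0 : ∀ y ∈ T, y ∉ K → f y = 0) {y : α} (hy : y ∉ K) : T.indicator f y = 0 :=
  Set.indicator_apply_eq_zero.2 fun hyT => h0 y hyT hy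

variable {E : Type*} [NormedAddCommGroup E] [NormedSpace ℝ E]
  {F : Type*} [NormedAddCommGroup F] [NormedSpace ℝ F]
  {T K : Set E} (hT : IsOpen T) (hK : IsCompact K) (hKT : K ⊆ T)

section Extension

variable {f : E → F}

theorem fderiv_indicator_apply (hT : IsOpen T) {y : E} (hy : y ∈ T) (v : E) :
    fderiv ℝ (T.indicator f) y v = fderiv ℝ f y v := by
  have hnhds : T.indicator f =ᶠ[𝓝 y] f := by
    filter_upwards [hT.mem_nhds hy] with x hx using Set.indicator_of_mem hx f
  rw [hnhds.fderiv_eq]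

variable (h0 : ∀ y ∈ T, y ∉ K → f y = 0)
include hT hK hKT h0

theorem contDiff_indicator {k : WithTop ℕ∞} (hf : ContDiffOn ℝ k f T) :
    ContDiff ℝ k (T.indicator f) := by
  refine contDiff_iff_contDiffAt.2 fun y => ?_
  by_cases hy : y ∈ K
  · refine (hf.contDiffAt (hT.mem_nhds (hKT hy))).congr_of_eventuallyEq ?_
    filter_upwards [hT.mem_nhds (hKT hy)] with x hx using Set.indicator_of_mem hx f
  · refine contDiffAt_const (c := 0) |>.congr_of_eventuallyEq ?_
    filter_upwards [hK.isClosed.isOpen_compl.mem_nhds hy] with x hx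
      using indicator_eq_zero_of_notMem h0 hx

variable [MeasurableSpace E] [BorelSpace E] {μ : Measure E} [μ.IsAddHaarMeasure]
  (hf : ContDiffOn ℝ ∞ f T) (v : E)
include hf

theorem integrable_fderiv_indicator :
    Integrable (fun y => fderiv ℝ (T.indicator f) y v) μ :=
  (((contDiff_indicator hT hK hKT h0 hf).continuous_fderiv (by simp)).clm_apply
    continuous_const).integrable_of_hasCompactSupport
      ((HasCompactSupport.intro hK fun _ hy => indicator_eq_zero_of_notMem h0 hy).fderiv_apply ℝ v)

theorem integrableOn_fderiv_apply : IntegrableOn (fun y => fderiv ℝ f y v) T μ :=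
  (integrable_fderiv_indicator hT hK hKT h0 hf v).integrableOn.congr_fun
    (fun _ hy => fderiv_indicator_apply hT hy v) hT.measurableSet

variable [FiniteDimensional ℝ E]

theorem setIntegral_fderiv_apply_eq_zero : ∫ y in T, fderiv ℝ f y v ∂μ = 0 := by
  have hsmooth := contDiff_indicator hT hK hKT h0 hf
  have hsupport : HasCompactSupport (T.indicator f) :=
    .intro hK fun _ hy => indicator_eq_zero_of_notMem h0 hy
  have hsupp : Function.support (T.indicator f) ⊆ K := fun y hy =>
    not_not.1 fun h => hy (indicator_eq_zero_of_notMem h0 h)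
  have hsubset : tsupport (T.indicator f) ⊆ T := (closure_minimal hsupp hK.isClosed).trans hKT
  have hoff : ∀ y ∉ T, fderiv ℝ (T.indicator f) y v = 0 := fun y hy => by
    rw [image_eq_zero_of_notMem_tsupport fun h => hy (hsubset (tsupport_fderiv_subset ℝ h)),
      zero_apply]
  have hparts := integral_smul_fderiv_eq_neg_fderiv_smul_of_integrable (μ := μ) (𝕜 := ℝ)
    (f := fun _ => (1 : ℝ)) (g := T.indicator f) (v := v) (by simp)
    (by simpa using integrable_fderiv_indicator hT hK hKT h0 hf v)
    (by simpa using hsmooth.continuous.integrable_of_hasCompactSupport hsupport)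
    (fun _ _ => differentiableAt_const _) (fun x _ => hsmooth.differentiable (by simp) x)
  calc ∫ y in T, fderiv ℝ f y v ∂μ = ∫ y in T, fderiv ℝ (T.indicator f) y v ∂μ :=
        setIntegral_congr_fun hT.measurableSet fun _ hy => (fderiv_indicator_apply hT hy v).symm
    _ = ∫ y, fderiv ℝ (T.indicator f) y v ∂μ := setIntegral_eq_integral_of_forall_compl_eq_zero hoff
    _ = 0 := by simpa using hparts

end Extension

variable {ρ : E → ℝ} {X : E → E} {f : E → F}

theorem density_smul_divergence_eq_sum_fderiv {ι : Type*} [Fintype ι] (e : Basis ι ℝ E) {y : E}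
    (hρ : DifferentiableAt ℝ ρ y) (h0 : ρ y ≠ 0) (hX : DifferentiableAt ℝ X y)
    (hf : DifferentiableAt ℝ f y) :
    ρ y • (fderiv ℝ f y (X y) + divergence ρ X y • f y) =
      ∑ i, fderiv ℝ (fun z => (ρ z * e.repr (X z) i) • f z) y (e i) := by
  have := Module.Finite.of_basis e
  have hcoord : ∀ i, DifferentiableAt ℝ (fun z => ρ z * e.repr (X z) i) y := fun i =>
    hρ.mul ((LinearMap.toContinuousLinearMap (e.coord i)).differentiableAt.comp y hX)
  have hterm : ∀ i, fderiv ℝ (fun z => (ρ z * e.repr (X z) i) • f z) y (e i) =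
      (ρ y * e.repr (X y) i) • fderiv ℝ f y (e i) +
        fderiv ℝ (fun z => ρ z * e.repr (X z) i) y (e i) • f y := fun i => by
    rw [fderiv_fun_smul (hcoord i) hf]
    simp
  have hfX : fderiv ℝ f y (X y) = ∑ i, e.repr (X y) i • fderiv ℝ f y (e i) := by
    simp only [← map_smul, ← map_sum, e.sum_repr]
  rw [Finset.sum_congr rfl fun i _ => hterm i, Finset.sum_add_distrib, ← Finset.sum_smul, hfX,
    divergence_eq_sum_fderiv_repr e hρ h0 hX, smul_add, smul_smul, mul_inv_cancel_left₀ h0,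
    Finset.smul_sum]
  simp only [mul_smul]

variable [FiniteDimensional ℝ E] [MeasurableSpace E] [BorelSpace E] {μ : Measure E}
  [μ.IsAddHaarMeasure]

include hT hK hKT in
theorem setIntegral_density_smul_divergence_eq_zero (hρ : ContDiffOn ℝ ∞ ρ T)
    (hρ0 : ∀ y ∈ T, ρ y ≠ 0) (hX : ContDiffOn ℝ ∞ X T) (hf : ContDiffOn ℝ ∞ f T)
    (h0 : ∀ y ∈ T, y ∉ K → f y = 0) :
    ∫ y in T, ρ y • (fderiv ℝ f y (X y) + divergence ρ X y • f y) ∂μ = 0 := by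
  let e := finBasis ℝ E
  have hsmooth : ∀ i, ContDiffOn ℝ ∞ (fun z => (ρ z * e.repr (X z) i) • f z) T := fun i =>
    (hρ.mul ((LinearMap.toContinuousLinearMap (e.coord i)).contDiff.comp_contDiffOn hX)).smul hf
  have hzero : ∀ i, ∀ y ∈ T, y ∉ K → (ρ y * e.repr (X y) i) • f y = 0 := fun i y hy hyK => by
    rw [h0 y hy hyK, smul_zero]
  refine (setIntegral_congr_fun hT.measurableSet fun y hy =>
    density_smul_divergence_eq_sum_fderiv e
      ((hρ.differentiableOn (by simp)).differentiableAt (hT.mem_nhds hy)) (hρ0 y hy)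
      ((hX.differentiableOn (by simp)).differentiableAt (hT.mem_nhds hy))
      ((hf.differentiableOn (by simp)).differentiableAt (hT.mem_nhds hy))).trans ?_
  rw [integral_finsetSum _ fun i _ =>
    integrableOn_fderiv_apply hT hK hKT (hzero i) (hsmooth i) (e i)]
  exact Finset.sum_eq_zero fun i _ =>
    setIntegral_fderiv_apply_eq_zero hT hK hKT (hzero i) (hsmooth i) (e i)

end LocalDivergenceTheorem

section DivergenceTheorem

open MeasureTheory

variable {n : ℕ} {S : Type*} [TopologicalSpace S] [ChartedSpace (EuclideanSpace ℝ (Fin n)) S]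
  [IsManifold (𝓡 n) ∞ S] (g : Metric n S) {X : ∀ p : S, TangentSpace (𝓡 n) p} {v : S → ℂ}

local notation "𝔼" => EuclideanSpace ℝ (Fin n)

theorem d_apply_field_chart (hv : ContMDiff (𝓡 n) 𝓘(ℝ, ℂ) ∞ v) {c : S} {y : 𝔼}
    (hy : y ∈ (extChartAt (𝓡 n) c).target) :
    d v ((extChartAt (𝓡 n) c).symm y) (X ((extChartAt (𝓡 n) c).symm y)) =
      fderiv ℝ (fun z => v ((extChartAt (𝓡 n) c).symm z)) y (fieldInChart (𝓡 n) c X y) := by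
  rw [fderiv_comp_chart_symm hy (hv.mdifferentiable (by simp) _), chartDeriv_fieldInChart hy]
  rfl

omit [IsManifold (𝓡 n) ∞ S] in
theorem d_finset_sum {ι : Type*} (s : Finset ι) {f : ι → S → ℂ}
    (hf : ∀ i ∈ s, ContMDiff (𝓡 n) 𝓘(ℝ, ℂ) ∞ (f i)) (p : S) :
    d (n := n) (∑ i ∈ s, f i) p = ∑ i ∈ s, d (f i) p := by
  induction s using Finset.cons_induction with
  | empty => exact mfderiv_const
  | cons a s ha ih =>
    have hs : ContMDiff (𝓡 n) 𝓘(ℝ, ℂ) ∞ (∑ i ∈ s, f i) := by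
      rw [Finset.sum_fn]
      exact contMDiff_finsetSum fun i hi => hf i (Finset.mem_cons_of_mem hi)
    rw [Finset.sum_cons, Finset.sum_cons, ← ih fun i hi => hf i (Finset.mem_cons_of_mem hi)]
    exact mfderiv_add ((hf a (Finset.mem_cons_self a s)).mdifferentiable (by simp) p)
      (hs.mdifferentiable (by simp) p)

theorem contMDiff_d_apply_field (hX : IsSmoothField X) (hv : ContMDiff (𝓡 n) 𝓘(ℝ, ℂ) ∞ v) :
    ContMDiff (𝓡 n) 𝓘(ℝ, ℂ) ∞ (fun p => d v p (X p)) :=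
  contMDiff_of_charts fun c =>
    (((contDiffOn_comp_chart_symm hv c).fderiv_of_isOpen (isOpen_extChartAt_target c)
      (by simp)).clm_apply (hX c)).congr fun _ hy => d_apply_field_chart hv hy

theorem contMDiff_fieldDiv (hX : IsSmoothField X) :
    ContMDiff (𝓡 n) 𝓘(ℝ, ℝ) ∞ (fieldDiv g X) :=
  contMDiff_of_charts fun c =>
    (contDiffOn_divergence (isOpen_extChartAt_target c) (contDiffOn_density g c)
      (fun _ hy => (density_pos g hy).ne') (hX c)).congr fun _ hy => fieldDiv_chart g hX hy

theorem continuous_d_apply_field_add_fieldDiv_mul (hX : IsSmoothField X)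
    (hv : ContMDiff (𝓡 n) 𝓘(ℝ, ℂ) ∞ v) :
    Continuous fun p => d v p (X p) + (fieldDiv g X p : ℂ) * v p :=
  (contMDiff_d_apply_field hX hv).continuous.add
    ((Complex.continuous_ofReal.comp (contMDiff_fieldDiv g hX).continuous).mul hv.continuous)

theorem tsupport_d_apply_field_add_fieldDiv_mul :
    tsupport (fun p => d v p (X p) + (fieldDiv g X p : ℂ) * v p) ⊆ tsupport v := by
  refine closure_minimal (fun p hp => not_not.1 fun hpv => hp ?_) (isClosed_tsupport v)
  have hzero : v =ᶠ[𝓝 p] fun _ => 0 := notMem_tsupport_iff_eventuallyEq.1 hpv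
  have hd : d v p = 0 := (hzero.mfderiv_eq (I := 𝓡 n) (I' := 𝓘(ℝ, ℂ))).trans mfderiv_const
  simp [hd, hzero.self_of_nhds]

variable [T2Space S] [CompactSpace S] (hX : IsSmoothField X) (hv : ContMDiff (𝓡 n) 𝓘(ℝ, ℂ) ∞ v)
include hX hv

theorem integral_d_apply_field_add_of_tsupport {c : S}
    (hs : tsupport v ⊆ (extChartAt (𝓡 n) c).source) :
    integral g (fun p => d v p (X p) + (fieldDiv g X p : ℂ) * v p) = 0 := by
  rw [integral_eq_chartIntegral g ((tsupport_d_apply_field_add_fieldDiv_mul g).trans hs)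
    (continuous_d_apply_field_add_fieldDiv_mul g hX hv), chartIntegral]
  refine (setIntegral_congr_fun (isOpen_extChartAt_target c).measurableSet fun y hy => ?_).trans
    (setIntegral_density_smul_divergence_eq_zero (isOpen_extChartAt_target c)
      (isCompact_chartSupport hs) (chartSupport_subset hs) (contDiffOn_density g c)
      (fun y hy => (density_pos g hy).ne') (hX c) (contDiffOn_comp_chart_symm hv c)
      fun y hy hyK => image_eq_zero_of_notMem_tsupport (f := v)
        (notMem_tsupport_of_notMem_chartSupport hy hyK))
  simp only [d_apply_field_chart hv hy, fieldDiv_chart g hX hy, Complex.real_smul]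

theorem integral_d_apply_field :
    integral g (fun p => d v p (X p)) = -integral g (fun p => (fieldDiv g X p : ℂ) * v p) := by
  have hcont : Continuous fun p => (fieldDiv g X p : ℂ) * v p :=
    (Complex.continuous_ofReal.comp (contMDiff_fieldDiv g hX).continuous).mul hv.continuous
  rw [eq_neg_iff_add_eq_zero, ← integral_add g (contMDiff_d_apply_field hX hv).continuous hcont]
  have hparts : ∀ c, ContMDiff (𝓡 n) 𝓘(ℝ, ℂ) ∞ (chartPart n c v) := fun c =>
    contMDiff_chartPart c hv
  have hsum : ∀ p, d v p (X p) + (fieldDiv g X p : ℂ) * v p = ∑ c ∈ partitionIndices n S,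
      (d (chartPart n c v) p (X p) + (fieldDiv g X p : ℂ) * chartPart n c v p) := fun p => by
    rw [Finset.sum_add_distrib, ← Finset.mul_sum, sum_chartPart, ← sum_apply,
      ← d_finset_sum _ fun c _ => hparts c, Finset.sum_fn, funext (sum_chartPart v)]
  rw [funext hsum, integral_sum g _ fun c _ =>
    continuous_d_apply_field_add_fieldDiv_mul g hX (hparts c)]
  exact Finset.sum_eq_zero fun c _ =>
    integral_d_apply_field_add_of_tsupport g hX (hparts c) (tsupport_chartPart c v)

end DivergenceTheorem

/-! ### Gradient and Laplacian -/

open scoped Matrix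

section MusicalIsomorphism

theorem toMatrix_mulVec_repr {K W ι : Type*} [CommRing K] [AddCommGroup W] [Module K W] [Fintype ι]
    [DecidableEq ι] (b : Basis ι K W) (B : LinearMap.BilinForm K W) (x : W) :
    LinearMap.BilinForm.toMatrix b B *ᵥ b.repr x = fun i => B (b i) x := by
  funext i
  conv_rhs => rw [← b.sum_repr x]
  simp only [Matrix.mulVec, dotProduct, LinearMap.BilinForm.toMatrix_apply, map_sum, map_smul,
    smul_eq_mul, mul_comm]

theorem inv_toMatrix_mulVec {K W ι : Type*} [CommRing K] [AddCommGroup W] [Module K W] [Fintype ι]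
    [DecidableEq ι] (b : Basis ι K W) {B : LinearMap.BilinForm K W}
    (hB : IsUnit (LinearMap.BilinForm.toMatrix b B).det) (x : W) :
    (LinearMap.BilinForm.toMatrix b B)⁻¹ *ᵥ (fun i => B (b i) x) = b.repr x := by
  rw [← toMatrix_mulVec_repr, Matrix.mulVec_mulVec, Matrix.nonsing_inv_mul _ hB, Matrix.one_mulVec]

variable {E : Type*} [NormedAddCommGroup E] [NormedSpace ℝ E]

theorem isInvertible_of_pos [FiniteDimensional ℝ E] {b : E →L[ℝ] E →L[ℝ] ℝ}
    (hpos : ∀ v, v ≠ 0 → 0 < b v v) : b.IsInvertible := by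
  have hinj : Function.Injective b := (injective_iff_map_eq_zero b).2 fun v hv =>
    not_not.1 fun hne => (hpos v hne).ne' (by rw [hv, zero_apply])
  have hrank : finrank ℝ E = finrank ℝ (E →L[ℝ] ℝ) :=
    Subspace.dual_finrank_eq.symm.trans LinearMap.toContinuousLinearMap.finrank_eq
  exact ⟨(LinearEquiv.ofInjectiveOfFinrankEq b.toLinearMap hinj hrank).toContinuousLinearEquiv,
    rfl⟩

theorem contDiffOn_of_clm_apply [CompleteSpace E] {V F : Type*} [NormedAddCommGroup V]
    [NormedSpace ℝ V] [NormedAddCommGroup F] [NormedSpace ℝ F] {k : WithTop ℕ∞} {T : Set V}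
    {A : V → E →L[ℝ] F} {Z : V → E} (hA : ContDiffOn ℝ k A T)
    (hinv : ∀ y ∈ T, (A y).IsInvertible) (hAZ : ContDiffOn ℝ k (fun y => A y (Z y)) T) :
    ContDiffOn ℝ k Z T := by
  have hinverse : ContDiffOn ℝ k (fun y => (A y).inverse) T := fun y hy =>
    (hinv y hy).contDiffAt_map_inverse.comp_contDiffWithinAt y (hA y hy)
  exact (hinverse.clm_apply hAZ).congr fun y hy => ((hinv y hy).inverse_apply_self _).symm

end MusicalIsomorphism

section Gradient

variable {n : ℕ} {S : Type*} [TopologicalSpace S] [ChartedSpace (EuclideanSpace ℝ (Fin n)) S]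
  [IsManifold (𝓡 n) ∞ S] (g : Metric n S)

local notation "𝔼" => EuclideanSpace ℝ (Fin n)

/-- The gradient of a function, the image of its differential under the inverse of
`v ↦ g(v, ·)`. -/
noncomputable def gradient (u : S → ℝ) (p : S) : TangentSpace (𝓡 n) p :=
  (g.inner p).inverse (mfderiv (𝓡 n) 𝓘(ℝ, ℝ) u p)

theorem inner_gradient (u : S → ℝ) (p : S) (w : TangentSpace (𝓡 n) p) :
    g.inner p (gradient g u p) w = mfderiv (𝓡 n) 𝓘(ℝ, ℝ) u p w :=
  congrArg (fun L : 𝔼 →L[ℝ] ℝ => L w)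
    ((isInvertible_of_pos (E := 𝔼) (g.pos p)).self_apply_inverse (mfderiv (𝓡 n) 𝓘(ℝ, ℝ) u p))

variable {u : S → ℝ} (hu : ContMDiff (𝓡 n) 𝓘(ℝ, ℝ) ∞ u)
include hu

theorem metricInChart_fieldInChart_gradient {c : S} {y : 𝔼}
    (hy : y ∈ (extChartAt (𝓡 n) c).target) :
    metricInChart g c y (fieldInChart (𝓡 n) c (gradient g u) y) =
      fderiv ℝ (fun z => u ((extChartAt (𝓡 n) c).symm z)) y := by
  ext w
  rw [metricInChart_apply, chartDeriv_fieldInChart hy, inner_gradient,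
    fderiv_comp_chart_symm hy (hu.mdifferentiable (by simp) _)]

theorem isSmoothField_gradient : IsSmoothField (gradient g u) := fun c =>
  contDiffOn_of_clm_apply (contDiffOn_metricInChart g c)
    (fun _ hy => isInvertible_of_pos (metricInChart_pos g hy))
    (((contDiffOn_comp_chart_symm hu c).fderiv_of_isOpen (isOpen_extChartAt_target c)
      (by simp)).congr fun _ hy => metricInChart_fieldInChart_gradient g hu hy)

theorem inv_gram_mulVec_fderiv {c : S} {y : 𝔼} (hy : y ∈ (extChartAt (𝓡 n) c).target) :
    (gram g c y)⁻¹ *ᵥ (fun j => fderiv ℝ (fun z => u ((extChartAt (𝓡 n) c).symm z)) y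
      (EuclideanSpace.single j (1 : ℝ))) = fieldInChart (𝓡 n) c (gradient g u) y := by
  have hdet := (posDef_gram g hy).det_pos.ne'.isUnit
  rw [gram_eq_gramMatrix] at hdet ⊢
  refine Eq.trans (congrArg _ (funext fun j => ?_)) (inv_toMatrix_mulVec _ hdet _)
  rw [← metricInChart_fieldInChart_gradient g hu hy, metricInChart_symm]
  simp

end Gradient

section RealAndImaginaryParts

theorem fderiv_ofReal_add_I_mul {E : Type*} [NormedAddCommGroup E] [NormedSpace ℝ E] {a b : E → ℝ}
    {y : E} (ha : DifferentiableAt ℝ a y) (hb : DifferentiableAt ℝ b y) (v : E) :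
    fderiv ℝ (fun x => (a x : ℂ) + Complex.I * (b x : ℂ)) y v =
      (fderiv ℝ a y v : ℂ) + Complex.I * (fderiv ℝ b y v : ℂ) :=
  congrArg (fun L : E →L[ℝ] ℂ => L v)
    ((Complex.ofRealCLM.hasFDerivAt.comp y ha.hasFDerivAt).add
      ((Complex.ofRealCLM.hasFDerivAt.comp y hb.hasFDerivAt).const_mul Complex.I)).fderiv

variable {n : ℕ} {S : Type*} [TopologicalSpace S] [ChartedSpace (EuclideanSpace ℝ (Fin n)) S]

theorem mfderiv_clm_comp {F F' : Type*} [NormedAddCommGroup F] [NormedSpace ℝ F]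
    [NormedAddCommGroup F'] [NormedSpace ℝ F'] (L : F →L[ℝ] F') {f : S → F} {p : S}
    (hf : MDifferentiableAt (𝓡 n) 𝓘(ℝ, F) f p) (w : TangentSpace (𝓡 n) p) :
    mfderiv (𝓡 n) 𝓘(ℝ, F') (fun q => L (f q)) p w = L (mfderiv (𝓡 n) 𝓘(ℝ, F) f p w) :=
  congrArg (fun A : EuclideanSpace ℝ (Fin n) →L[ℝ] F' => A w)
    ((L.hasMFDerivAt (x := f p)).comp p hf.hasMFDerivAt).mfderiv

variable {u : S → ℂ} (hu : ContMDiff (𝓡 n) 𝓘(ℝ, ℂ) ∞ u)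
include hu

theorem contMDiff_re : ContMDiff (𝓡 n) 𝓘(ℝ, ℝ) ∞ (fun p => (u p).re) :=
  Complex.reCLM.contMDiff.comp hu

theorem contMDiff_im : ContMDiff (𝓡 n) 𝓘(ℝ, ℝ) ∞ (fun p => (u p).im) :=
  Complex.imCLM.contMDiff.comp hu

theorem mfderiv_re (p : S) (w : TangentSpace (𝓡 n) p) :
    mfderiv (𝓡 n) 𝓘(ℝ, ℝ) (fun p => (u p).re) p w = (d u p w).re :=
  mfderiv_clm_comp Complex.reCLM (hu.mdifferentiable (by simp) p) w

theorem mfderiv_im (p : S) (w : TangentSpace (𝓡 n) p) :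
    mfderiv (𝓡 n) 𝓘(ℝ, ℝ) (fun p => (u p).im) p w = (d u p w).im :=
  mfderiv_clm_comp Complex.imCLM (hu.mdifferentiable (by simp) p) w

end RealAndImaginaryParts

section Laplacian

variable {n : ℕ} {S : Type*} [TopologicalSpace S] [ChartedSpace (EuclideanSpace ℝ (Fin n)) S]
  [IsManifold (𝓡 n) ∞ S] (g : Metric n S)

local notation "𝔼" => EuclideanSpace ℝ (Fin n)

theorem differentiableAt_density_mul_fieldInChart {X : ∀ p : S, TangentSpace (𝓡 n) p}
    (hX : IsSmoothField X) {c : S} {y : 𝔼} (hy : y ∈ (extChartAt (𝓡 n) c).target) (i : Fin n) :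
    DifferentiableAt ℝ (fun z => density g c z * fieldInChart (𝓡 n) c X z i) y := by
  have hnhds := (isOpen_extChartAt_target c).mem_nhds hy
  have hfield : DifferentiableAt ℝ (fieldInChart (𝓡 n) c X) y :=
    ((hX c).differentiableOn (by simp)).differentiableAt hnhds
  have hcoord : DifferentiableAt ℝ (fun z => fieldInChart (𝓡 n) c X z i) y :=
    (EuclideanSpace.proj (𝕜 := ℝ) i : 𝔼 →L[ℝ] ℝ).differentiableAt.comp y hfield
  exact (((contDiffOn_density g c).differentiableOn (by simp)).differentiableAt hnhds).mul hcoord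

theorem fieldDiv_eq_sum_fderiv {X : ∀ p : S, TangentSpace (𝓡 n) p} (hX : IsSmoothField X) (p : S) :
    fieldDiv g X p = (density g p (extChartAt (𝓡 n) p p))⁻¹ * ∑ i,
      fderiv ℝ (fun y => density g p y * fieldInChart (𝓡 n) p X y i) (extChartAt (𝓡 n) p p)
        (EuclideanSpace.single i 1) := by
  have htarget : extChartAt (𝓡 n) p p ∈ (extChartAt (𝓡 n) p).target := mem_extChartAt_target p
  have hnhds := (isOpen_extChartAt_target p).mem_nhds htarget
  have hsum := divergence_eq_sum_fderiv_repr (EuclideanSpace.basisFun (Fin n) ℝ).toBasis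
    (((contDiffOn_density g p).differentiableOn (by simp)).differentiableAt hnhds)
    (density_pos g htarget).ne' (((hX p).differentiableOn (by simp)).differentiableAt hnhds)
  simpa [fieldDiv] using hsum

/-- The gradient of the real part of a complex function, which is the real part of its complex
gradient. -/
noncomputable def gradRe (u : S → ℂ) : ∀ p : S, TangentSpace (𝓡 n) p :=
  gradient g fun p => (u p).re

/-- The gradient of the imaginary part of a complex function, which is the imaginary part of its
complex gradient. -/
noncomputable def gradIm (u : S → ℂ) : ∀ p : S, TangentSpace (𝓡 n) p :=
  gradient g fun p => (u p).im

variable {u : S → ℂ} (hu : ContMDiff (𝓡 n) 𝓘(ℝ, ℂ) ∞ u)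
include hu

theorem isSmoothField_gradRe : IsSmoothField (gradRe g u) :=
  isSmoothField_gradient g (contMDiff_re hu)

theorem isSmoothField_gradIm : IsSmoothField (gradIm g u) :=
  isSmoothField_gradient g (contMDiff_im hu)

theorem d_eq_inner_gradient (p : S) (w : TangentSpace (𝓡 n) p) :
    d u p w = (g.inner p (gradRe g u p) w : ℂ) + Complex.I * (g.inner p (gradIm g u p) w : ℂ) := by
  rw [gradRe, gradIm, inner_gradient, inner_gradient, mfderiv_re hu, mfderiv_im hu,
    mul_comm Complex.I, Complex.re_add_im]

theorem fderiv_comp_chart_symm_eq_re_add_im {c : S} {y : 𝔼}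
    (hy : y ∈ (extChartAt (𝓡 n) c).target) (v : 𝔼) :
    fderiv ℝ (fun z => u ((extChartAt (𝓡 n) c).symm z)) y v =
      (fderiv ℝ (fun z => (u ((extChartAt (𝓡 n) c).symm z)).re) y v : ℂ) +
        Complex.I * (fderiv ℝ (fun z => (u ((extChartAt (𝓡 n) c).symm z)).im) y v : ℂ) := by
  have hdiff := ((contDiffOn_comp_chart_symm hu c).differentiableOn (by simp)).differentiableAt
    ((isOpen_extChartAt_target c).mem_nhds hy)
  refine Eq.trans ?_ (fderiv_ofReal_add_I_mul (Complex.reCLM.differentiableAt.comp y hdiff)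
    (Complex.imCLM.differentiableAt.comp y hdiff) v)
  simp only [Function.comp_apply, Complex.reCLM_apply, Complex.imCLM_apply, mul_comm Complex.I,
    Complex.re_add_im]

theorem sum_density_mul_inv_gram_mul_fderiv {c : S} {y : 𝔼}
    (hy : y ∈ (extChartAt (𝓡 n) c).target) (i : Fin n) :
    ∑ j, ((density g c y * (gram g c y)⁻¹ i j : ℝ) : ℂ) *
        fderiv ℝ (fun z => u ((extChartAt (𝓡 n) c).symm z)) y (EuclideanSpace.single j (1 : ℝ)) =
      ((density g c y * fieldInChart (𝓡 n) c (gradRe g u) y i : ℝ) : ℂ) +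
        Complex.I * ((density g c y * fieldInChart (𝓡 n) c (gradIm g u) y i : ℝ) : ℂ) := by
  have hre := congrFun (inv_gram_mulVec_fderiv g (contMDiff_re hu) hy) i
  have him := congrFun (inv_gram_mulVec_fderiv g (contMDiff_im hu) hy) i
  rw [gradRe, gradIm, ← hre, ← him]
  simp only [fderiv_comp_chart_symm_eq_re_add_im hu hy, Matrix.mulVec, dotProduct, Finset.mul_sum,
    Complex.ofReal_sum, ← Finset.sum_add_distrib]
  refine Finset.sum_congr rfl fun j _ => ?_
  push_cast
  ring

theorem laplacian_eq_neg_fieldDiv (p : S) :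
    laplacian g u p =
      -((fieldDiv g (gradRe g u) p : ℂ) + Complex.I * (fieldDiv g (gradIm g u) p : ℂ)) := by
  set y₀ : 𝔼 := extChartAt (𝓡 n) p p
  have htarget : y₀ ∈ (extChartAt (𝓡 n) p).target := mem_extChartAt_target p
  have hterm : ∀ i, fderiv ℝ (fun y => ∑ j, ((density g p y * (gram g p y)⁻¹ i j : ℝ) : ℂ) *
        fderiv ℝ (fun z => u ((extChartAt (𝓡 n) p).symm z)) y (EuclideanSpace.single j (1 : ℝ)))
        y₀ (EuclideanSpace.single i (1 : ℝ)) =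
      (fderiv ℝ (fun y => density g p y * fieldInChart (𝓡 n) p (gradRe g u) y i) y₀
          (EuclideanSpace.single i 1) : ℂ) +
        Complex.I * (fderiv ℝ (fun y => density g p y * fieldInChart (𝓡 n) p (gradIm g u) y i) y₀
          (EuclideanSpace.single i 1) : ℂ) := fun i => by
    rw [← fderiv_ofReal_add_I_mul
      (differentiableAt_density_mul_fieldInChart g (isSmoothField_gradRe g hu) htarget i)
      (differentiableAt_density_mul_fieldInChart g (isSmoothField_gradIm g hu) htarget i)]
    refine congrArg (fun L : 𝔼 →L[ℝ] ℂ => L _) (Filter.EventuallyEq.fderiv_eq ?_)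
    filter_upwards [(isOpen_extChartAt_target p).mem_nhds htarget] with y hy
      using sum_density_mul_inv_gram_mul_fderiv g hu hy i
  rw [laplacian, fieldDiv_eq_sum_fderiv g (isSmoothField_gradRe g hu),
    fieldDiv_eq_sum_fderiv g (isSmoothField_gradIm g hu),
    Finset.sum_congr rfl fun i _ => hterm i, Finset.sum_add_distrib, ← Finset.mul_sum]
  push_cast
  ring

end Laplacian

/-! ### Basic functions and adjoints -/

section CovectorInner

variable {W : Type*} [AddCommGroup W] [Module ℝ W]

theorem bilinForm_nondegenerate_of_pos {B : LinearMap.BilinForm ℝ W}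
    (hpos : ∀ v, v ≠ 0 → 0 < B v v) : B.Nondegenerate :=
  ⟨fun v hv => not_not.1 fun hne => (hpos v hne).ne' (hv v),
    fun v hv => not_not.1 fun hne => (hpos v hne).ne' (hv v)⟩

theorem covectorInner_dual [FiniteDimensional ℝ W] {B : LinearMap.BilinForm ℝ W}
    (hB : B.Nondegenerate) (α : W →ₗ[ℝ] ℂ) (x y : W) :
    covectorInner (fun v w => B v w) α (fun w => (B w x : ℂ) + Complex.I * (B w y : ℂ)) =
      α x - Complex.I * α y := by
  have hsum : ∀ z : W, ∑ i, ∑ j, ((((LinearMap.BilinForm.toMatrix (finBasis ℝ W) B)⁻¹ i j *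
      B (finBasis ℝ W j) z : ℝ) : ℂ) * α (finBasis ℝ W i)) = α z := fun z => by
    have hdet := ((LinearMap.BilinForm.nondegenerate_iff_det_ne_zero (finBasis ℝ W)).1 hB).isUnit
    have hrepr := inv_toMatrix_mulVec (finBasis ℝ W) hdet z
    conv_rhs => rw [← (finBasis ℝ W).sum_repr z]
    simp only [← hrepr, Matrix.mulVec, dotProduct, map_sum, map_smul, Complex.real_smul,
      Complex.ofReal_sum, Finset.sum_mul]
  rw [← hsum x, ← hsum y, Finset.mul_sum, ← Finset.sum_sub_distrib]
  refine Finset.sum_congr rfl fun i _ => ?_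
  rw [Finset.mul_sum, ← Finset.sum_sub_distrib]
  refine Finset.sum_congr rfl fun j _ => ?_
  have hmatrix : (Matrix.of fun k l => B (finBasis ℝ W k) (finBasis ℝ W l)) =
      LinearMap.BilinForm.toMatrix (finBasis ℝ W) B := by
    ext k l
    exact (LinearMap.BilinForm.toMatrix_apply _ _ _ _).symm
  rw [hmatrix]
  simp only [map_add, map_mul, Complex.conj_ofReal, Complex.conj_I, Complex.ofReal_mul]
  ring

end CovectorInner

section Derivation

variable {n : ℕ} {S : Type*} [TopologicalSpace S] [ChartedSpace (EuclideanSpace ℝ (Fin n)) S]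

/-- The derivative of `v` along the conjugate `X - √-1 Y` of the complex vector field
`X + √-1 Y`. -/
noncomputable def conjDeriv (X Y : ∀ p : S, TangentSpace (𝓡 n) p) (v : S → ℂ) (p : S) : ℂ :=
  d v p (X p) - Complex.I * d v p (Y p)

end Derivation

namespace SasakianStructure

variable {m : ℕ} {S : Type*} [TopologicalSpace S]
  [ChartedSpace (EuclideanSpace ℝ (Fin (2 * m + 1))) S] [IsManifold (𝓡 (2 * m + 1)) ∞ S]
  (𝓢 : SasakianStructure m S)

local notation "𝕁" => 𝓡 (2 * m + 1)

section TransverseStructure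

/-- The transverse complex structure `transverseJ` as a continuous linear map. -/
noncomputable def transverseEnd (p : S) : TangentSpace 𝕁 p →L[ℝ] TangentSpace 𝕁 p :=
  sliceEnd (fun _ => 𝓢.J (atOne p)) (0 : EuclideanSpace ℝ (Fin (2 * m + 1)))

theorem transverseEnd_apply (p : S) (v : TangentSpace 𝕁 p) :
    𝓢.transverseEnd p v = 𝓢.transverseJ p v := rfl

theorem transverseEnd_skew (p : S) (v w : TangentSpace 𝕁 p) :
    𝓢.g.inner p (𝓢.transverseEnd p v) w = -𝓢.g.inner p v (𝓢.transverseEnd p w) := by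
  refine forall_of_forall_chart 𝕁 (P := fun p => ∀ v w : TangentSpace 𝕁 p,
    𝓢.g.inner p (𝓢.transverseEnd p v) w = -𝓢.g.inner p v (𝓢.transverseEnd p w))
    (fun c y hy v w => ?_) p v w
  rw [← chartDeriv_chartDerivInv hy v, ← chartDeriv_chartDerivInv hy w, transverseEnd_apply,
    transverseEnd_apply, ← 𝓢.chartDeriv_transverseJInChart hy,
    ← 𝓢.chartDeriv_transverseJInChart hy]
  exact (𝓢.isLocalSasakian c).skew y hy _ _

theorem transverseEnd_reeb (p : S) : 𝓢.transverseEnd p (𝓢.reeb p) = 0 := by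
  refine forall_of_forall_chart 𝕁 (P := fun p => 𝓢.transverseEnd p (𝓢.reeb p) = 0)
    (fun c y hy => ?_) p
  rw [← 𝓢.chartDeriv_reebInChart hy, transverseEnd_apply, ← 𝓢.chartDeriv_transverseJInChart hy,
    (𝓢.isLocalSasakian c).Φ_reeb y hy, map_zero]

theorem transverseEnd_sq (p : S) (v : TangentSpace 𝕁 p) :
    𝓢.transverseEnd p (𝓢.transverseEnd p v) = -v + 𝓢.eta p v • 𝓢.reeb p := by
  refine forall_of_forall_chart 𝕁 (P := fun p => ∀ v : TangentSpace 𝕁 p,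
    𝓢.transverseEnd p (𝓢.transverseEnd p v) = -v + 𝓢.eta p v • 𝓢.reeb p)
    (fun c y hy v => ?_) p v
  rw [← chartDeriv_chartDerivInv hy v, transverseEnd_apply, transverseEnd_apply,
    ← 𝓢.chartDeriv_transverseJInChart hy, ← 𝓢.chartDeriv_transverseJInChart hy,
    (𝓢.isLocalSasakian c).Φ_sq y hy, map_add, map_neg, map_smul, metricInChart_apply,
    𝓢.chartDeriv_reebInChart hy]
  rfl

theorem transverseEnd_mem_contact (p : S) (v : TangentSpace 𝕁 p) :
    𝓢.transverseEnd p v ∈ 𝓢.contact p := by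
  have hskew := 𝓢.transverseEnd_skew p (𝓢.reeb p) v
  rw [transverseEnd_reeb, map_zero, zero_apply, zero_eq_neg] at hskew
  exact hskew

theorem transverseEnd_sq_of_mem_contact {p : S} {v : TangentSpace 𝕁 p} (hv : v ∈ 𝓢.contact p) :
    𝓢.transverseEnd p (𝓢.transverseEnd p v) = -v := by
  have heta : 𝓢.eta p v = 0 := hv
  rw [transverseEnd_sq, heta, zero_smul, add_zero]

/-- The transverse metric as a bilinear form on the contact bundle. -/
noncomputable def transverseForm (p : S) : LinearMap.BilinForm ℝ (𝓢.contact p) :=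
  LinearMap.mk₂ ℝ (𝓢.transverseMetric p) (fun _ _ _ => by simp [transverseMetric])
    (fun _ _ _ => by simp [transverseMetric]) (fun _ _ _ => by simp [transverseMetric])
    (fun _ _ _ => by simp [transverseMetric])

theorem transverseForm_nondegenerate (p : S) : (𝓢.transverseForm p).Nondegenerate :=
  bilinForm_nondegenerate_of_pos fun v hv => 𝓢.g.pos p v fun h => hv (Subtype.ext h)

theorem covectorInner_transverse {p : S} (α : TangentSpace 𝕁 p →L[ℝ] ℂ)
    {β : TangentSpace 𝕁 p → ℂ} {b₁ b₂ : TangentSpace 𝕁 p} (hb₁ : b₁ ∈ 𝓢.contact p)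
    (hb₂ : b₂ ∈ 𝓢.contact p)
    (hβ : ∀ w, β w = (𝓢.g.inner p b₁ w : ℂ) + Complex.I * (𝓢.g.inner p b₂ w : ℂ)) :
    covectorInner (𝓢.transverseMetric p) (fun w : 𝓢.contact p => α w)
      (fun w : 𝓢.contact p => β w) = α b₁ - Complex.I * α b₂ := by
  simp only [hβ, 𝓢.g.symm p b₁, 𝓢.g.symm p b₂]
  exact covectorInner_dual (𝓢.transverseForm_nondegenerate p)
    (α.toLinearMap.comp (𝓢.contact p).subtype) ⟨b₁, hb₁⟩ ⟨b₂, hb₂⟩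

/-- The covector `∂̄_B v` at a point, extended by zero along the Reeb field, as a continuous linear
map. -/
noncomputable def dbarCovector (v : S → ℂ) (p : S) : TangentSpace 𝕁 p →L[ℝ] ℂ :=
  (2⁻¹ : ℂ) • (d v p + Complex.I • (d v p).comp (𝓢.transverseEnd p))

theorem dbarCovector_apply (v : S → ℂ) (p : S) (w : TangentSpace 𝕁 p) :
    𝓢.dbarCovector v p w = 𝓢.dbar v p w :=
  (div_eq_inv_mul _ _).symm

theorem dbarCovector_transverseEnd (v : S → ℂ) {p : S} {w : TangentSpace 𝕁 p}
    (hw : w ∈ 𝓢.contact p) :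
    𝓢.dbarCovector v p (𝓢.transverseEnd p w) = -Complex.I * 𝓢.dbarCovector v p w := by
  simp only [dbarCovector_apply, dbar, ← transverseEnd_apply,
    𝓢.transverseEnd_sq_of_mem_contact hw, map_neg]
  linear_combination (d v p (𝓢.transverseEnd p w) / 2) * Complex.I_sq

end TransverseStructure

section BasicCovectors

variable {𝓢} {u : S → ℂ} (hu : 𝓢.IsBasic u)
include hu

theorem IsBasic.gradRe_mem_contact (p : S) : gradRe 𝓢.g u p ∈ 𝓢.contact p := by
  have hreeb := inner_gradient 𝓢.g (fun q => (u q).re) p (𝓢.reeb p)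
  rw [mfderiv_re hu.1, hu.2, 𝓢.g.symm] at hreeb
  exact hreeb

theorem IsBasic.gradIm_mem_contact (p : S) : gradIm 𝓢.g u p ∈ 𝓢.contact p := by
  have hreeb := inner_gradient 𝓢.g (fun q => (u q).im) p (𝓢.reeb p)
  rw [mfderiv_im hu.1, hu.2, 𝓢.g.symm] at hreeb
  exact hreeb

theorem covectorInner_dB (v : S → ℂ) (p : S) :
    covectorInner (𝓢.transverseMetric p) (fun w : 𝓢.contact p => 𝓢.dB v p w)
      (fun w : 𝓢.contact p => 𝓢.dB u p w) = conjDeriv (gradRe 𝓢.g u) (gradIm 𝓢.g u) v p :=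
  𝓢.covectorInner_transverse (d v p) (hu.gradRe_mem_contact p) (hu.gradIm_mem_contact p)
    (d_eq_inner_gradient 𝓢.g hu.1 p)

theorem dbar_eq_inner (p : S) (w : TangentSpace 𝕁 p) :
    𝓢.dbar u p w =
      (𝓢.g.inner p ((2⁻¹ : ℝ) • (gradRe 𝓢.g u p + 𝓢.transverseEnd p (gradIm 𝓢.g u p))) w : ℂ) +
        Complex.I *
          (𝓢.g.inner p ((2⁻¹ : ℝ) • (gradIm 𝓢.g u p - 𝓢.transverseEnd p (gradRe 𝓢.g u p))) w : ℂ)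
      := by
  rw [dbar, ← transverseEnd_apply, d_eq_inner_gradient 𝓢.g hu.1, d_eq_inner_gradient 𝓢.g hu.1]
  simp only [map_smul, map_add, map_sub, smul_apply, add_apply, sub_apply, transverseEnd_skew,
    smul_eq_mul]
  push_cast
  linear_combination (1 / 2 : ℂ) * (𝓢.g.inner p (gradIm 𝓢.g u p) (𝓢.transverseEnd p w) : ℂ) *
    Complex.I_sq

theorem covectorInner_dbar (v : S → ℂ) (p : S) :
    covectorInner (𝓢.transverseMetric p) (fun w : 𝓢.contact p => 𝓢.dbar v p w)
      (fun w : 𝓢.contact p => 𝓢.dbar u p w) =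
      (conjDeriv (gradRe 𝓢.g u) (gradIm 𝓢.g u) v p +
        Complex.I * conjDeriv (fun q => 𝓢.transverseEnd q (gradRe 𝓢.g u q))
          (fun q => 𝓢.transverseEnd q (gradIm 𝓢.g u q)) v p) / 2 := by
  have hre := hu.gradRe_mem_contact p
  have him := hu.gradIm_mem_contact p
  simp only [← 𝓢.dbarCovector_apply v]
  refine (𝓢.covectorInner_transverse (𝓢.dbarCovector v p)
    ((𝓢.contact p).smul_mem _ (add_mem hre (𝓢.transverseEnd_mem_contact p _)))
    ((𝓢.contact p).smul_mem _ (sub_mem him (𝓢.transverseEnd_mem_contact p _)))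
    (dbar_eq_inner hu p)).trans ?_
  -- `∂̄_B v` has type `(0,1)`, so the `(1,0)`-part of `du` does not contribute.
  have hproj : 𝓢.dbarCovector v p ((2⁻¹ : ℝ) •
        (gradRe 𝓢.g u p + 𝓢.transverseEnd p (gradIm 𝓢.g u p))) -
      Complex.I * 𝓢.dbarCovector v p ((2⁻¹ : ℝ) •
        (gradIm 𝓢.g u p - 𝓢.transverseEnd p (gradRe 𝓢.g u p))) =
      𝓢.dbarCovector v p (gradRe 𝓢.g u p) - Complex.I * 𝓢.dbarCovector v p (gradIm 𝓢.g u p) := by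
    simp only [map_smul, map_add, map_sub, 𝓢.dbarCovector_transverseEnd v hre,
      𝓢.dbarCovector_transverseEnd v him, Complex.real_smul]
    push_cast
    linear_combination (-(1 / 2) : ℂ) * 𝓢.dbarCovector v p (gradRe 𝓢.g u p) * Complex.I_sq
  rw [hproj]
  simp only [dbarCovector_apply, dbar, conjDeriv, transverseEnd_apply]
  ring

end BasicCovectors

end SasakianStructure

section Green

variable {n : ℕ} {S : Type*} [TopologicalSpace S] [ChartedSpace (EuclideanSpace ℝ (Fin n)) S]
  [IsManifold (𝓡 n) ∞ S] {X Y : ∀ p : S, TangentSpace (𝓡 n) p} {v : S → ℂ}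

theorem continuous_conjDeriv (hX : IsSmoothField X) (hY : IsSmoothField Y)
    (hv : ContMDiff (𝓡 n) 𝓘(ℝ, ℂ) ∞ v) : Continuous (conjDeriv X Y v) :=
  (contMDiff_d_apply_field hX hv).continuous.sub
    (continuous_const.mul (contMDiff_d_apply_field hY hv).continuous)

variable [T2Space S] [CompactSpace S] (g : Metric n S)

theorem integral_const_mul_add_const_mul {f₁ f₂ : S → ℂ} (hf₁ : Continuous f₁)
    (hf₂ : Continuous f₂) (a b : ℂ) :
    integral g (fun p => a * f₁ p + b * f₂ p) = a * integral g f₁ + b * integral g f₂ := by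
  rw [← integral_const_mul, ← integral_const_mul]
  exact integral_add g (continuous_const.mul hf₁) (continuous_const.mul hf₂)

theorem integral_conjDeriv (hX : IsSmoothField X) (hY : IsSmoothField Y)
    (hv : ContMDiff (𝓡 n) 𝓘(ℝ, ℂ) ∞ v) :
    integral g (conjDeriv X Y v) =
      integral g (fun p => v p *
        (starRingEnd ℂ) (-((fieldDiv g X p : ℂ) + Complex.I * (fieldDiv g Y p : ℂ)))) := by
  have hderiv : ∀ {Z : ∀ p : S, TangentSpace (𝓡 n) p}, IsSmoothField Z →
      Continuous fun p => d v p (Z p) := fun hZ => (contMDiff_d_apply_field hZ hv).continuous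
  have hdiv : ∀ {Z : ∀ p : S, TangentSpace (𝓡 n) p}, IsSmoothField Z →
      Continuous fun p => (fieldDiv g Z p : ℂ) * v p := fun hZ =>
    (Complex.continuous_ofReal.comp (contMDiff_fieldDiv g hZ).continuous).mul hv.continuous
  have hexpand : (fun p => v p *
      (starRingEnd ℂ) (-((fieldDiv g X p : ℂ) + Complex.I * (fieldDiv g Y p : ℂ)))) =
      fun p => -1 * ((fieldDiv g X p : ℂ) * v p) +
        Complex.I * ((fieldDiv g Y p : ℂ) * v p) := by
    funext p
    simp only [map_neg, map_add, map_mul, Complex.conj_ofReal, Complex.conj_I]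
    ring
  have hsplit : conjDeriv X Y v = fun p => 1 * d v p (X p) + -Complex.I * d v p (Y p) := by
    funext p
    rw [conjDeriv, one_mul, neg_mul, sub_eq_add_neg]
  rw [hexpand, hsplit, integral_const_mul_add_const_mul g (hderiv hX) (hderiv hY),
    integral_const_mul_add_const_mul g (hdiv hX) (hdiv hY), integral_d_apply_field g hX hv,
    integral_d_apply_field g hY hv]
  ring

end Green

namespace SasakianStructure

variable {m : ℕ} {S : Type*} [TopologicalSpace S]
  [ChartedSpace (EuclideanSpace ℝ (Fin (2 * m + 1))) S] [IsManifold (𝓡 (2 * m + 1)) ∞ S]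
  {𝓢 : SasakianStructure m S}

local notation "𝔼" => EuclideanSpace ℝ (Fin (2 * m + 1))
local notation "𝕁" => 𝓡 (2 * m + 1)

section Basic

variable {F F' : Type*} [NormedAddCommGroup F] [NormedSpace ℝ F] [NormedAddCommGroup F']
  [NormedSpace ℝ F']

variable (𝓢) in
/-- Basic functions with values in a real normed space; for the value space `ℂ` this is
`IsBasic`. -/
def IsBasicMap (f : S → F) : Prop :=
  ContMDiff 𝕁 𝓘(ℝ, F) ∞ f ∧ ∀ p : S, mfderiv 𝕁 𝓘(ℝ, F) f p (𝓢.reeb p) = 0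

theorem isBasicMap_iff_isBasic {f : S → ℂ} : 𝓢.IsBasicMap f ↔ 𝓢.IsBasic f := Iff.rfl

theorem IsBasicMap.clm_comp {f : S → F} (hf : 𝓢.IsBasicMap f) (L : F →L[ℝ] F') :
    𝓢.IsBasicMap (fun p => L (f p)) :=
  ⟨L.contMDiff.comp hf.1, fun p => by
    rw [mfderiv_clm_comp L (hf.1.mdifferentiable (by simp) p), hf.2]
    exact map_zero L⟩

theorem IsBasicMap.sub {f₁ f₂ : S → F} (hf₁ : 𝓢.IsBasicMap f₁) (hf₂ : 𝓢.IsBasicMap f₂) :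
    𝓢.IsBasicMap (fun p => f₁ p - f₂ p) := by
  refine ⟨hf₁.1.sub hf₂.1, fun p => ?_⟩
  have hderiv := ((hf₁.1.mdifferentiable (by simp) p).hasMFDerivAt.sub
    (hf₂.1.mdifferentiable (by simp) p).hasMFDerivAt).mfderiv
  refine (congrArg (fun A : 𝔼 →L[ℝ] F => A (𝓢.reeb p)) hderiv).trans ?_
  exact (congrArg₂ (fun a b : F => a - b) (hf₁.2 p) (hf₂.2 p)).trans (sub_zero 0)

theorem IsBasicMap.fderiv_reebInChart {f : S → F} (hf : 𝓢.IsBasicMap f) {c : S} {y : 𝔼}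
    (hy : y ∈ (extChartAt 𝕁 c).target) :
    fderiv ℝ (fun z => f ((extChartAt 𝕁 c).symm z)) y (𝓢.reebInChart c y) = 0 := by
  rw [fderiv_comp_chart_symm hy (hf.1.mdifferentiable (by simp) _), chartDeriv_reebInChart 𝓢 hy]
  exact hf.2 _

theorem IsBasic.const_mul {f : S → ℂ} (hf : 𝓢.IsBasic f) (a : ℂ) :
    𝓢.IsBasic (fun p => a * f p) :=
  isBasicMap_iff_isBasic.1 ((isBasicMap_iff_isBasic.2 hf).clm_comp (ContinuousLinearMap.mul ℝ ℂ a))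

theorem IsBasic.re {u : S → ℂ} (hu : 𝓢.IsBasic u) : 𝓢.IsBasicMap (fun p => (u p).re) :=
  (isBasicMap_iff_isBasic.2 hu).clm_comp Complex.reCLM

theorem IsBasic.im {u : S → ℂ} (hu : 𝓢.IsBasic u) : 𝓢.IsBasicMap (fun p => (u p).im) :=
  (isBasicMap_iff_isBasic.2 hu).clm_comp Complex.imCLM

end Basic

section Divergence

theorem fieldInChart_transverseEnd (X : ∀ p : S, TangentSpace 𝕁 p) {c : S} {y : 𝔼}
    (hy : y ∈ (extChartAt 𝕁 c).target) :
    fieldInChart 𝕁 c (fun p => 𝓢.transverseEnd p (X p)) y =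
      𝓢.transverseJInChart c y (fieldInChart 𝕁 c X y) := by
  apply chartDeriv_injective (I := 𝕁) hy
  rw [chartDeriv_fieldInChart hy, chartDeriv_transverseJInChart 𝓢 hy, chartDeriv_fieldInChart hy,
    transverseEnd_apply]

theorem isSmoothField_transverseEnd {X : ∀ p : S, TangentSpace 𝕁 p} (hX : IsSmoothField X) :
    IsSmoothField (fun p => 𝓢.transverseEnd p (X p)) := fun c =>
  ((𝓢.isLocalSasakian c).smooth_Φ.clm_apply (hX c)).congr fun _ hy =>
    fieldInChart_transverseEnd X hy

variable {u : S → ℝ} (hu : 𝓢.IsBasicMap u)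
include hu

theorem IsBasicMap.fieldDiv_gradient : 𝓢.IsBasicMap (fieldDiv 𝓢.g (gradient 𝓢.g u)) := by
  have hgrad := isSmoothField_gradient 𝓢.g hu.1
  have hdiv := contMDiff_fieldDiv 𝓢.g hgrad
  refine ⟨hdiv, forall_of_forall_chart 𝕁 fun c y hy => ?_⟩
  rw [← 𝓢.chartDeriv_reebInChart hy, ← fderiv_comp_chart_symm hy (hdiv.mdifferentiable (by simp) _),
    (𝓢.isLocalSasakian c).fderiv_congr hy fun x hx => fieldDiv_chart 𝓢.g hgrad hx]
  exact (𝓢.isLocalSasakian c).fderiv_divergence_gradient_reeb hy _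
    (fun x hx => density_sq 𝓢.g hx) (contDiffOn_comp_chart_symm hu.1 c) (hgrad c)
    (fun x hx => metricInChart_fieldInChart_gradient 𝓢.g hu.1 hx)
    (fun x hx => hu.fderiv_reebInChart hx) (contDiffOn_density 𝓢.g c)

theorem IsBasicMap.fieldDiv_transverseEnd_gradient (p : S) :
    fieldDiv 𝓢.g (fun q => 𝓢.transverseEnd q (gradient 𝓢.g u q)) p = 0 := by
  have htarget := mem_extChartAt_target (I := 𝕁) p
  have hzero := (𝓢.isLocalSasakian p).divergence_Φ_gradient htarget _
    (fun x hx => density_sq 𝓢.g hx) (contDiffOn_comp_chart_symm hu.1 p)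
    (isSmoothField_gradient 𝓢.g hu.1 p)
    (fun x hx => metricInChart_fieldInChart_gradient 𝓢.g hu.1 hx)
    (fun x hx => hu.fderiv_reebInChart hx)
  refine (divergence_congr Filter.EventuallyEq.rfl ?_).trans hzero
  filter_upwards [(isOpen_extChartAt_target p).mem_nhds htarget] with x hx
    using fieldInChart_transverseEnd _ hx

end Divergence

section Laplacian

variable {u v : S → ℂ} (hu : 𝓢.IsBasic u) (hv : 𝓢.IsBasic v)
include hu

theorem IsBasic.laplacian : 𝓢.IsBasic (laplacian 𝓢.g u) := by
  have hdiff := (hu.re.fieldDiv_gradient.clm_comp (-Complex.ofRealCLM)).sub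
    (hu.im.fieldDiv_gradient.clm_comp (Complex.I • Complex.ofRealCLM))
  refine isBasicMap_iff_isBasic.1 ((congrArg 𝓢.IsBasicMap (funext fun p => ?_)).mp hdiff)
  rw [laplacian_eq_neg_fieldDiv 𝓢.g hu.1]
  exact (neg_add' _ _).symm

include hv

variable [T2Space S] [CompactSpace S]

theorem IsBasic.integral_conjDeriv_gradient :
    integral 𝓢.g (conjDeriv (gradRe 𝓢.g u) (gradIm 𝓢.g u) v) =
      𝓢.functionInner v (Sasaki.laplacian 𝓢.g u) := by
  rw [integral_conjDeriv 𝓢.g (isSmoothField_gradRe 𝓢.g hu.1) (isSmoothField_gradIm 𝓢.g hu.1) hv.1,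
    functionInner]
  simp only [laplacian_eq_neg_fieldDiv 𝓢.g hu.1]

theorem IsBasic.integral_conjDeriv_transverseEnd_gradient :
    integral 𝓢.g (conjDeriv (fun p => 𝓢.transverseEnd p (gradRe 𝓢.g u p))
      (fun p => 𝓢.transverseEnd p (gradIm 𝓢.g u p)) v) = 0 := by
  rw [integral_conjDeriv 𝓢.g (isSmoothField_transverseEnd (isSmoothField_gradRe 𝓢.g hu.1))
    (isSmoothField_transverseEnd (isSmoothField_gradIm 𝓢.g hu.1)) hv.1]
  have hre := hu.re.fieldDiv_transverseEnd_gradient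
  have him := hu.im.fieldDiv_transverseEnd_gradient
  simp only [gradRe, gradIm, hre, him, Complex.ofReal_zero, mul_zero, add_zero, neg_zero, map_zero]
  simpa using integral_const_mul 𝓢.g 0 fun _ => 0

end Laplacian

section Adjoint

variable [T2Space S] [CompactSpace S] {u : S → ℂ}

theorem isAdjointValue_dB (hu : 𝓢.IsBasic u) :
    𝓢.IsAdjointValue 𝓢.dB (𝓢.dB u) (laplacian 𝓢.g u) := by
  refine ⟨hu.laplacian, fun v hv => ?_⟩
  rw [← hu.integral_conjDeriv_gradient hv, formInner]
  exact congrArg _ (funext fun p => covectorInner_dB hu v p)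

theorem isAdjointValue_dbar (hu : 𝓢.IsBasic u) :
    𝓢.IsAdjointValue 𝓢.dbar (𝓢.dbar u) (fun p => 1 / 2 * laplacian 𝓢.g u p) := by
  refine ⟨hu.laplacian.const_mul _, fun v hv => ?_⟩
  have hre := isSmoothField_gradRe 𝓢.g hu.1
  have him := isSmoothField_gradIm 𝓢.g hu.1
  have hsplit : (fun p => covectorInner (𝓢.transverseMetric p)
      (fun w : 𝓢.contact p => 𝓢.dbar v p w) (fun w : 𝓢.contact p => 𝓢.dbar u p w)) = fun p =>
      1 / 2 * conjDeriv (gradRe 𝓢.g u) (gradIm 𝓢.g u) v p +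
        Complex.I / 2 * conjDeriv (fun q => 𝓢.transverseEnd q (gradRe 𝓢.g u q))
          (fun q => 𝓢.transverseEnd q (gradIm 𝓢.g u q)) v p := by
    funext p
    rw [covectorInner_dbar hu]
    ring
  have hhalf : (fun p => v p * (starRingEnd ℂ) (1 / 2 * laplacian 𝓢.g u p)) =
      fun p => 1 / 2 * (v p * (starRingEnd ℂ) (laplacian 𝓢.g u p)) := by
    funext p
    simp only [map_mul, map_div₀, map_one, map_ofNat]
    ring
  rw [formInner, functionInner, hsplit, hhalf,
    integral_const_mul_add_const_mul 𝓢.g (continuous_conjDeriv hre him hv.1)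
      (continuous_conjDeriv (isSmoothField_transverseEnd hre)
        (isSmoothField_transverseEnd him) hv.1), integral_const_mul,
    hu.integral_conjDeriv_gradient hv, hu.integral_conjDeriv_transverseEnd_gradient hv, mul_zero,
    add_zero, functionInner]

variable {T : (S → ℂ) → ∀ p : S, TangentSpace (𝓡 (2 * m + 1)) p → ℂ}
  {α : ∀ p : S, TangentSpace (𝓡 (2 * m + 1)) p → ℂ} {f f' : S → ℂ}

theorem IsAdjointValue.unique (hf : 𝓢.IsAdjointValue T α f) (hf' : 𝓢.IsAdjointValue T α f') :
    f' = f := by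
  let w : S → ℂ := fun p => f' p - f p
  have hw : 𝓢.IsBasic w := isBasicMap_iff_isBasic.1
    (IsBasicMap.sub (isBasicMap_iff_isBasic.2 hf'.1) (isBasicMap_iff_isBasic.2 hf.1))
  have hinner : 𝓢.functionInner w f' = 𝓢.functionInner w f :=
    (hf'.2 w hw).symm.trans (hf.2 w hw)
  have hsplit : (fun p => w p * (starRingEnd ℂ) (f' p)) =
      fun p => w p * (starRingEnd ℂ) (w p) + w p * (starRingEnd ℂ) (f p) := by
    funext p
    rw [← mul_add, ← map_add, sub_add_cancel]
  have hmul : ∀ {h : S → ℂ}, 𝓢.IsBasic h → Continuous fun p => w p * (starRingEnd ℂ) (h p) :=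
    fun hh => hw.1.continuous.mul (Complex.continuous_conj.comp hh.1.continuous)
  rw [functionInner, functionInner, hsplit, integral_add _ (hmul hw) (hmul hf.1),
    add_eq_right] at hinner
  have hzero : f' - f = 0 := eq_zero_of_integral_mul_conj_eq_zero 𝓢.g hw.1.continuous hinner
  exact sub_eq_zero.1 hzero

theorem IsAdjointValue.existsUnique (hf : 𝓢.IsAdjointValue T α f) :
    ∃! f : S → ℂ, 𝓢.IsAdjointValue T α f :=
  ⟨f, hf, fun _ => hf.unique⟩

theorem IsAdjointValue.adjoint_eq (hf : 𝓢.IsAdjointValue T α f) : 𝓢.adjoint T α = f :=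
  hf.unique (Classical.epsilon_spec (p := 𝓢.IsAdjointValue T α) ⟨f, hf⟩)

end Adjoint

end SasakianStructure

end Sasaki

theorem mainTheorem10 (m : ℕ) {S : Type*} [TopologicalSpace S] [T2Space S] [CompactSpace S]
    [ChartedSpace (EuclideanSpace ℝ (Fin (2 * m + 1))) S] [IsManifold (𝓡 (2 * m + 1)) ∞ S]
    (𝓢 : Sasaki.SasakianStructure m S) (u : S → ℂ) (hu : 𝓢.IsBasic u) :
    (∃! f : S → ℂ, 𝓢.IsAdjointValue 𝓢.dB (𝓢.dB u) f) ∧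
    (∃! f : S → ℂ, 𝓢.IsAdjointValue 𝓢.dbar (𝓢.dbar u) f) ∧
    Sasaki.laplacian 𝓢.g u = 𝓢.basicLaplacian u ∧
    𝓢.basicLaplacian u = fun p => 2 * 𝓢.basicDolbeaultLaplacian u p := by
  have hdB := Sasaki.SasakianStructure.isAdjointValue_dB hu
  have hdbar := Sasaki.SasakianStructure.isAdjointValue_dbar hu
  refine ⟨hdB.existsUnique, hdbar.existsUnique, hdB.adjoint_eq.symm, ?_⟩
  rw [Sasaki.SasakianStructure.basicLaplacian, Sasaki.SasakianStructure.basicDolbeaultLaplacian,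
    hdB.adjoint_eq, hdbar.adjoint_eq]
  funext p
  ring
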